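/- **Setting.** All points are in the plane. For an $n$-tuple $x=(x_1,\dots,x_n)$ of points, let $h(x)$ be the number of indices $i$ such that $x_i$ lies on the boundary of the convex hull of $\{x_1,\dots,x_n\}$. Let $P_D^{n,m}$ be the probability that $h(z)=m$ when $z=(z_1,\dots,z_n)$ consists of $n$ i.i.d. uniform points in a disk $D$ of positive radius, and let $P_D^n=P_D^{n,n}$ be the probability that these points are in convex position. For $R>0$ and $\theta\in(0,2\pi)$, let $\mathrm{SEG}(\theta,R)$ be the circular segment that is the convex hull of the arc $\{Re^{i\nu}:-\theta/2\le\nu\le\theta/2\}$, and let $w_1=Re^{-i\theta/2}$, $w_2=Re^{i\theta/2}$ be the endpoints of its chord. For integers $n,m\ge0$, let $B_{n,m}(\theta)$ be the probability that $h(w_1,w_2,z_1,\dots,z_n)=m+2$ when $z_1,\dots,z_n$ are i.i.d. uniform in $\mathrm{SEG}(\theta,R)$ (this does not depend on $R$), and set $$L_{n,m}(\theta)=\frac{B_{n,m}(\theta)\,(\theta-\sin\theta)^n\,\sin(\theta/2)}{n!},\qquad B_n=B_{n,n},\quad L_n=L_{n,n}.$$ **Theorem.** In the statements below all integrands are integrable.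 Indices $n_i,m_i$ in sums range over the non-negative integers. - (i) For every $n\ge1$, $\displaystyle P_D^n=\lim_{t\to2\pi^-}B_{n-1}(t)$. - (i′) For every $n\ge2$, $$P_D^n=\frac{(n-2)!}{2^{n-2}\pi^{n-1}}\int_0^{2\pi}\sum_{k=0}^{n-2}L_k(\phi)\,L_{n-2-k}(2\pi-\phi)\,d\phi .$$ - (ii) For every $\theta\in(0,2\pi)$ and $n\ge1$, $$\frac{L_n(\theta)}2=\int_0^\theta\frac{\sin(\theta/2)^{2n+1}}{\sin(\phi/2)^{2n+1}}\int_0^\phi\sum_{k=0}^{n-1}L_k(\eta)\,L_{n-1-k}(\phi-\eta)\,d\eta\,d\phi .$$ - (iii) For every $\theta\in(0,2\pi)$, $L_{k,l}(\theta)=0$ whenever $k\ge 0$ and $l\ge k+1$. For every $\theta\in(0,2\pi)$, $n\ge1$ and $1\le m\le n$, $$\frac{L_{n,m}(\theta)}2=\int_0^\theta\int_0^\phi\frac{\sin(\theta/2)^{2n+1}}{\sin(\phi/2)^{2n+1}}\sum_{\substack{n_1+n_2+n_3=n-1\\ m_1+m_2=m-1}}\frac{(\sin\eta+\sin(\phi-\eta)-\sin\phi)^{n_3}}{n_3!}\,L_{n_1,m_1}(\eta)\,L_{n_2,m_2}(\phi-\eta)\,d\eta\,d\phi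 ,$$ and here $\sin\eta+\sin(\phi-\eta)-\sin\phi=4\sin\frac{\phi-\eta}2\,\sin\frac\phi2\,\sin\frac\eta2$. - (iii′) For every $n\ge2$ and $1\le m\le n$, $$P_D^{n,m}=\frac{(n-2)!}{2^{n-2}\pi^{n-1}}\int_0^{2\pi}\sum_{\substack{n_1+n_2=n-2\\ m_1+m_2=m-2}}L_{n_1,m_1}(\phi)\,L_{n_2,m_2}(2\pi-\phi)\,d\phi$$ (for $m=1$ the sum is empty and both sides are $0$). - (iv) For every $n\ge1$ and $m\ge1$, $\displaystyle P_D^{n,m}=\lim_{t\to2\pi^-}B_{n-1,m-1}(t)$. -/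

import Mathlib

open MeasureTheory Filter Topology


noncomputable section

namespace ConvexPosition

/-- `CP n m`: the `n`-tuples `x` of points of the plane for which exactly `m` indices `i` are such
that `x i` lies on the boundary of the convex hull of all the points of `x`. -/
def CP (n m : ℕ) : Set (Fin n → ℂ) :=
  {x | {i : Fin n | x i ∈ frontier (convexHull ℝ (Set.range x))}.ncard = m}

/-- The law of `n` i.i.d. points, uniform in `H`: the `n`-fold product of the normalised
restriction of the Lebesgue measure of the plane to `H`. -/
def unifLaw (H : Set ℂ) (n : ℕ) : Measure (Fin n → ℂ) :=
  Measure.pi fun _ : Fin n => ProbabilityTheory.cond (volume : Measure ℂ) H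

/-- The probability that exactly `m` of `n` i.i.d. uniform points of `H` lie on the boundary of
their convex hull. For `m = n`: the probability that they are in convex position. -/
def hullProb (H : Set ℂ) (n m : ℕ) : ℝ :=
  (unifLaw H n).real (CP n m)

/-- The point `R e^{iν}`. -/
def circlePoint (R ν : ℝ) : ℂ :=
  (R : ℂ) * Complex.exp ((ν : ℂ) * Complex.I)

/-- The arc of circle of angle `θ` and radius `R`. -/
def arc (θ R : ℝ) : Set ℂ :=
  circlePoint R '' Set.Icc (-θ / 2) (θ / 2)

/-- The circular segment of angle `θ` and radius `R`. -/
def seg (θ R : ℝ) : Set ℂ :=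
  convexHull ℝ (arc θ R)

/-- The tuple `(w₁, w₂, z₁, …, zₙ)`, where `w₁ = R e^{-iθ/2}` and `w₂ = R e^{iθ/2}` are the two
endpoints of the chord of `seg θ R`. -/
def bipointed {n : ℕ} (θ R : ℝ) (z : Fin n → ℂ) : Fin (n + 2) → ℂ :=
  Fin.cons (circlePoint R (-θ / 2)) (Fin.cons (circlePoint R (θ / 2)) z)

/-- `B R n m θ`: for `n` i.i.d. uniform points of `seg θ R`, the probability that, in the tuple of
these points together with the two endpoints of the chord, exactly `m + 2` entries are on the
boundary of the convex hull. -/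
def B (R : ℝ) (n m : ℕ) (θ : ℝ) : ℝ :=
  (unifLaw (seg θ R) n).real {z | bipointed θ R z ∈ CP (n + 2) (m + 2)}

/-- `L R n m θ = B R n m θ (θ - sin θ)ⁿ sin (θ / 2) / n!`. -/
def L (R : ℝ) (n m : ℕ) (θ : ℝ) : ℝ :=
  B R n m θ * (θ - Real.sin θ) ^ n * Real.sin (θ / 2) / (n.factorial : ℝ)

end ConvexPosition

end

open ConvexPosition

/-!
Probabilities are volumes: `B` and `hullProb` are, up to explicit factors, volumes `hullVol` of sets
of tuples with a given number `outer` of entries on the boundary of a convex hull.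

The recursion comes from conditioning on one point. Through every point of the circular segment of
angle `θ` there is exactly one circular arc with the same chord; let `φ` be its angle. The point of
largest `φ` is on the boundary of the hull, because all the other points are in the segment of
angle `φ` on the same chord, which, up to a similarity, is the standard one (`volume_cons_arcCoord`,
`segVol_succ_eq_lintegral`). The position of this point is recorded by `φ` and by its angular
distance `η` from an endpoint of the chord. These are bipolar coordinates, with an explicit Jacobian
(`lintegral_openSeg`). The two chords from this point to the endpoints cut the segment of angle `φ`
into the segments of angles `η` and `φ - η` and a triangle. The points in the triangle are never on
the boundary, and those in the two smaller segments do not interact: beyond a line that meets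
the hull inside a segment joining two of the points, the hull depends only on these two points and
on the points beyond the line (`mem_interior_convexHull_iff_of_line`, `hullVol_seg_three`). In the
normalization of `L`, this is `recursion`.

In a disk, conditioning on the farthest point from the center, and rescaling, one may assume
that one of the points is a fixed point of the bounding circle (`hullVol_disk_succ`). As `θ → 2π`,
the circular segment fills the disk, and the endpoints of its chord merge into one point of the
circle. Almost surely, the tuple is in general position and its boundary count does not change near
the limit; dominated convergence then gives `tendsto_B`.

The integral formulas for the disk are the limits of the recursion. In the recursion at `θ`, the
factor `sin (θ / 2) ^ (2 * n + 1) / sin (φ / 2) ^ (2 * n + 1)` concentrates the integral near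
`φ = θ` as `θ → 2π` (`tendsto_sin_pow_mul_integral`), so that only the inner integral at `φ = 2π`
remains. There the triangle is flat and the two segments are complementary (`convThree_two_pi`).
The formulas for convex position are the case `m = n` of the general ones, since `L R k l` vanishes
for `k < l` (`convThree_diag`).
-/

namespace ConvexPosition
open scoped ENNReal

/-! ### Convex hulls and boundary counts -/

/-- A point is not in the interior of the hull of `s` if and only if a line through it leaves `s` on
one side. When the hull has empty interior, a parallel to a line that contains `s` will do. -/
theorem notMem_interior_convexHull_iff {s : Set ℂ} {p : ℂ} :
    p ∉ interior (convexHull ℝ s) ↔ ∃ u : ℂ, ‖u‖ = 1 ∧ ∀ q ∈ s, 0 ≤ inner ℝ u (q - p) := by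
  constructor
  · intro hp
    suffices h : ∃ v : ℂ, v ≠ 0 ∧ ∀ q ∈ s, 0 ≤ inner ℝ v (q - p) by
      obtain ⟨v, hv, h⟩ := h
      refine ⟨(‖v‖⁻¹ : ℝ) • v, by simp [hv], fun q hq => ?_⟩
      rw [real_inner_smul_left]
      exact mul_nonneg (by positivity) (h q hq)
    by_cases hne : (interior (convexHull ℝ s)).Nonempty
    · obtain ⟨f, hf, hfs⟩ :=
        geometric_hahn_banach_of_nonempty_interior_point (convex_convexHull ℝ s) hp hne
      refine ⟨-(InnerProductSpace.toDual ℝ ℂ).symm f, by simpa using hf, fun q hq => ?_⟩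
      rw [inner_neg_left, InnerProductSpace.toDual_symm_apply, map_sub]
      linarith [hfs q (subset_convexHull ℝ s hq)]
    · rw [interior_convexHull_nonempty_iff_affineSpan_eq_top] at hne
      rcases s.eq_empty_or_nonempty with rfl | ⟨q₀, hq₀⟩
      · exact ⟨1, one_ne_zero, by simp⟩
      have hV : vectorSpan ℝ s ≠ ⊤ := fun h =>
        hne ((AffineSubspace.affineSpan_eq_top_iff_vectorSpan_eq_top_of_nonempty ℝ ℂ ℂ
          ⟨q₀, hq₀⟩).2 h)
      have hV' : (vectorSpan ℝ s)ᗮ ≠ ⊥ := fun h => hV (Submodule.orthogonal_eq_bot_iff.1 h)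
      obtain ⟨v, hv, hv0⟩ := Submodule.exists_mem_ne_zero_of_ne_bot hV'
      have key : ∀ q ∈ s, inner ℝ v (q - p) = inner ℝ v (q₀ - p) := by
        intro q hq
        have := Submodule.inner_left_of_mem_orthogonal
          (vsub_mem_vectorSpan ℝ hq hq₀) hv
        have e : q - p = (q -ᵥ q₀) + (q₀ - p) := by simp
        rw [e, inner_add_right, this, zero_add]
      rcases le_total 0 (inner ℝ v (q₀ - p)) with h | h
      · exact ⟨v, hv0, fun q hq => by rw [key q hq]; exact h⟩
      · exact ⟨-v, neg_ne_zero.2 hv0, fun q hq => by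
          rw [inner_neg_left, key q hq]; linarith⟩
  · rintro ⟨u, hu, hs⟩ hp
    have hle : ∀ q ∈ convexHull ℝ s, 0 ≤ inner ℝ u (q - p) := by
      have hc : Convex ℝ {q : ℂ | inner ℝ u p ≤ innerSL ℝ u q} :=
        convex_halfSpace_ge (f := innerSL ℝ u) (innerSL ℝ u).toLinearMap.isLinear _
      intro q hq
      have : q ∈ {q : ℂ | inner ℝ u p ≤ innerSL ℝ u q} :=
        convexHull_min (fun q hq => by
          have := hs q hq
          rw [inner_sub_right] at this
          simpa using this) hc hq
      rw [inner_sub_right]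
      simpa using this
    obtain ⟨ε, hε, hb⟩ := Metric.isOpen_iff.1 isOpen_interior p hp
    have hmem : p - (ε / 2 : ℝ) • u ∈ Metric.ball p ε := by
      rw [Metric.mem_ball, dist_eq_norm]
      simp only [sub_sub_cancel_left, norm_neg, norm_smul, hu, Real.norm_eq_abs,
        abs_of_pos (half_pos hε)]
      linarith
    have h1 := hle _ (interior_subset (hb hmem))
    rw [sub_sub_cancel_left, inner_neg_right, real_inner_smul_right, real_inner_self_eq_norm_sq, hu]
      at h1
    linarith

/-- Not being interior to the hull is a closed condition, since the unit normal vectors of the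
supporting lines range over a compact set. -/
theorem isClosed_notMem_interior_convexHull {X κ : Type*} [TopologicalSpace X] [Finite κ]
    {f : κ → X → ℂ} (hf : ∀ k, Continuous (f k)) {p : X → ℂ} (hp : Continuous p) :
    IsClosed {x | p x ∉ interior (convexHull ℝ (Set.range fun k => f k x))} := by
  have hC : IsClosed {y : Metric.sphere (0 : ℂ) 1 × X |
      ∀ k, 0 ≤ inner ℝ (y.1 : ℂ) (f k y.2 - p y.2)} := by
    simp only [Set.ofPred_forall]
    refine isClosed_iInter fun k => isClosed_le continuous_const ?_
    have := hf k
    fun_prop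
  convert! isClosedMap_snd_of_compactSpace _ hC using 1
  ext x
  simp only [Set.mem_ofPred_eq, notMem_interior_convexHull_iff, Set.forall_mem_range, Set.mem_image,
    Prod.exists, exists_eq_right, Subtype.exists, mem_sphere_zero_iff_norm, exists_prop]

/-- The number of indices `i` such that `z i` is on the boundary of the convex hull of the points
of `z` together with those of `T`. The boundary is encoded as the complement of the interior, which
is the same thing for a point of the hull. -/
noncomputable def outer {ι : Type*} (T : Set ℂ) (z : ι → ℂ) : ℕ :=
  {i | z i ∉ interior (convexHull ℝ (T ∪ Set.range z))}.ncard

theorem mem_frontier_convexHull_iff {s : Set ℂ} {p : ℂ} (hp : p ∈ s) :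
    p ∈ frontier (convexHull ℝ s) ↔ p ∉ interior (convexHull ℝ s) :=
  ⟨fun h => h.2, fun h => ⟨subset_closure (subset_convexHull ℝ s hp), h⟩⟩

theorem outer_comp_equiv {ι κ : Type*} (T : Set ℂ) (z : ι → ℂ) (e : κ ≃ ι) :
    outer T (z ∘ e) = outer T z := by
  unfold outer
  rw [e.surjective.range_comp]
  exact Set.ncard_preimage_of_injective_subset_range (s := {i | z i ∉ _}) e.injective
    (by simp [e.range_eq_univ])

theorem outer_le_card {ι : Type*} [Fintype ι] (T : Set ℂ) (z : ι → ℂ) :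
    outer T z ≤ Fintype.card ι := by
  rw [← Nat.card_eq_fintype_card]
  exact Set.ncard_le_card _

open Classical in
theorem outer_eq_sum {ι : Type*} [Fintype ι] (T : Set ℂ) (z : ι → ℂ) :
    outer T z =
      ∑ i, if z i ∉ interior (convexHull ℝ (T ∪ Set.range z)) then 1 else 0 := by
  unfold outer
  rw [Set.ncard_eq_toFinset_card', Finset.sum_boole]
  simp

theorem outer_cons {n : ℕ} (T : Set ℂ) (x : ℂ) (z : Fin n → ℂ)
    (hx : x ∉ interior (convexHull ℝ (T ∪ Set.range (Fin.cons x z : Fin (n + 1) → ℂ)))) :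
    outer T (Fin.cons x z : Fin (n + 1) → ℂ) = outer (insert x T) z + 1 := by
  classical
  rw [outer_eq_sum, outer_eq_sum, Fin.sum_univ_succ, add_comm]
  have h : T ∪ Set.range (Fin.cons x z : Fin (n + 1) → ℂ) = insert x T ∪ Set.range z := by
    rw [Fin.range_cons]; ext; simp; tauto
  simp only [Fin.cons_zero, Fin.cons_succ]
  rw [if_pos hx, h]

open Classical in
theorem measurable_outer {X τ ι : Type*} [TopologicalSpace X] [MeasurableSpace X]
    [OpensMeasurableSpace X] [Fintype τ] [Fintype ι] {g : τ → X → ℂ} (hg : ∀ t, Continuous (g t))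
    {z : ι → X → ℂ} (hz : ∀ i, Continuous (z i)) :
    Measurable fun x => outer (Set.range fun t => g t x) fun i => z i x := by
  simp only [outer_eq_sum]
  refine Finset.measurable_sum _ fun i _ => Measurable.ite ?_ measurable_const measurable_const
  have := isClosed_notMem_interior_convexHull (f := Sum.elim g z) (Sum.rec hg hz) (hz i)
  convert! this.measurableSet using 1
  ext x
  simp only [Set.mem_ofPred_eq]
  rw [← Set.Sum.elim_range]
  have e : (fun k => Sum.elim g z k x) = Sum.elim (fun t => g t x) fun i => z i x := by
    ext k; cases k <;> rfl
  rw [e]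

/-- The similarity `w ↦ c w + d` preserves boundary counts. -/
theorem outer_similarity {ι : Type*} {c : ℂ} (hc : c ≠ 0) (d : ℂ) (T : Set ℂ) (z : ι → ℂ) :
    outer ((fun w => c * w + d) '' T) (fun i => c * z i + d) = outer T z := by
  have h1 : ∀ s : Set ℂ, (fun w => c * w + d) '' interior (convexHull ℝ s) =
      interior (convexHull ℝ ((fun w => c * w + d) '' s)) := by
    intro s
    have e1 := ((Homeomorph.mulLeft₀ c hc).trans (Homeomorph.addRight d)).image_interior
      (convexHull ℝ s)
    have e2 := ((LinearMap.mulLeft ℝ c).toAffineMap + AffineMap.const ℝ ℂ d).image_convexHull s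
    have f1 : ⇑((Homeomorph.mulLeft₀ c hc).trans (Homeomorph.addRight d)) =
      fun w => c * w + d := rfl
    have f2 : ⇑((LinearMap.mulLeft ℝ c).toAffineMap + AffineMap.const ℝ ℂ d) =
      fun w => c * w + d := rfl
    rw [f1] at e1; rw [f2] at e2
    rw [e1, e2]
  have hinj : Function.Injective (fun w : ℂ => c * w + d) := fun x y h => by
    simpa [hc] using h
  unfold outer
  congr 1
  ext i
  have h2 : (fun w => c * w + d) '' T ∪ Set.range (fun i => c * z i + d) =
      (fun w => c * w + d) '' (T ∪ Set.range z) := by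
    rw [Set.image_union, ← Set.range_comp]; rfl
  rw [Set.mem_ofPred_eq, Set.mem_ofPred_eq, h2, ← h1, not_iff_not]
  exact hinj.mem_set_image (a := z i)

/-- Suppose that the line `f = t` meets the convex hull of `s` inside the segment `[a, p]`, whose
endpoints are in `s`. Beyond this line, the hull of `s` is that of `a`, `p` and the points of `s`
beyond the line. -/
theorem mem_interior_convexHull_iff_of_line {s s' : Set ℂ} {f : ℂ →L[ℝ] ℝ} {t : ℝ} {a p q : ℂ}
    (ha : a ∈ s) (hfa : f a = t)
    (hline : ∀ w ∈ convexHull ℝ s, f w = t → w ∈ segment ℝ a p)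
    (has' : a ∈ s') (hps' : p ∈ s') (hs' : s' ⊆ s) (hbeyond : ∀ w ∈ s, t < f w → w ∈ s')
    (hq : t < f q) :
    q ∈ interior (convexHull ℝ s) ↔ q ∈ interior (convexHull ℝ s') := by
  have hlin := f.toLinearMap.isLinear
  have key : ∀ w ∈ convexHull ℝ s, t < f w → w ∈ convexHull ℝ s' := by
    intro w hw hfw
    have hs : s = {w ∈ s | t < f w} ∪ {w ∈ s | f w ≤ t} := by
      ext x; simp only [Set.mem_union, Set.mem_ofPred_eq, ← and_or_left, lt_or_ge, and_true]
    have hne : {w ∈ s | t < f w}.Nonempty := by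
      by_contra h
      rw [Set.not_nonempty_iff_eq_empty] at h
      have : convexHull ℝ s ⊆ {w | f w ≤ t} := by
        refine convexHull_min (fun x hx => ?_) (convex_halfSpace_le hlin t)
        by_contra hx'
        have : x ∈ {w ∈ s | t < f w} := ⟨hx, not_le.1 hx'⟩
        rw [h] at this; exact this
      exact absurd (this hw) (not_le.2 hfw)
    have hne' : {w ∈ s | f w ≤ t}.Nonempty := ⟨a, ha, hfa.le⟩
    rw [hs, convexHull_union hne hne', mem_convexJoin] at hw
    obtain ⟨x, hx, y, hy, hxy⟩ := hw
    have hfx : t < f x := by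
      have : convexHull ℝ {w ∈ s | t < f w} ⊆ {w | t < f w} :=
        convexHull_min (fun x hx => hx.2) (convex_halfSpace_gt hlin t)
      exact this hx
    have hfy : f y ≤ t := by
      have : convexHull ℝ {w ∈ s | f w ≤ t} ⊆ {w | f w ≤ t} :=
        convexHull_min (fun x hx => hx.2) (convex_halfSpace_le hlin t)
      exact this hy
    have hxs' : x ∈ convexHull ℝ s' := convexHull_mono (fun w hw => hbeyond w hw.1 hw.2) hx
    have hxs : x ∈ convexHull ℝ s := convexHull_mono (fun w hw => hw.1) hx
    have hys : y ∈ convexHull ℝ s := convexHull_mono (fun w hw => hw.1) hy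
    -- `v` is the point of the line on the segment from `x` to `y`
    obtain ⟨r, hr, rfl⟩ := (segment_eq_image_lineMap ℝ x y ▸ hxy : w ∈ _ '' _)
    have hd : 0 < f x - f y := by linarith
    set ρ : ℝ := (f x - t) / (f x - f y) with hρ
    have hρ0 : 0 < ρ := div_pos (by linarith) hd
    have hρ1 : ρ ≤ 1 := (div_le_one hd).2 (by linarith)
    have hfl : ∀ k : ℝ, f (AffineMap.lineMap x y k) = f x - k * (f x - f y) := by
      intro k
      rw [AffineMap.lineMap_apply_module, map_add, map_smul, map_smul, smul_eq_mul, smul_eq_mul]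
      ring
    have hv : AffineMap.lineMap x y ρ ∈ convexHull ℝ s' := by
      refine (convex_convexHull ℝ s').segment_subset (subset_convexHull ℝ s' has')
        (subset_convexHull ℝ s' hps') (hline _ ?_ ?_)
      · exact (convex_convexHull ℝ s).segment_subset hxs hys
          (segment_eq_image_lineMap ℝ x y ▸ ⟨ρ, ⟨hρ0.le, hρ1⟩, rfl⟩)
      · rw [hfl, hρ]; field_simp; ring
    have hrρ : r < ρ := by
      rw [hρ, lt_div_iff₀ hd]
      have := hfl r
      linarith
    refine (convex_convexHull ℝ s').segment_subset hxs' hv ?_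
    rw [segment_eq_image_lineMap]
    refine ⟨r / ρ, ⟨div_nonneg hr.1 hρ0.le, (div_le_one hρ0).2 hrρ.le⟩, ?_⟩
    simp only [AffineMap.lineMap_apply_module]
    rw [smul_add, smul_smul, smul_smul, ← add_assoc, ← add_smul]
    congr 2 <;> field_simp
    ring
  have hU : IsOpen {w | t < f w} := isOpen_lt continuous_const f.continuous
  have hEq : convexHull ℝ s ∩ {w | t < f w} = convexHull ℝ s' ∩ {w | t < f w} := by
    ext w
    exact ⟨fun h => ⟨key w h.1 h.2, h.2⟩, fun h => ⟨convexHull_mono hs' h.1, h.2⟩⟩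
  have := congrArg interior hEq
  rw [interior_inter, interior_inter, hU.interior_eq] at this
  have h2 := Set.ext_iff.1 this q
  simpa [hq] using h2

/-- Cutting along the line `f = t`: the points beyond the line and those before it contribute
independently to the boundary count. -/
theorem outer_eq_add_of_line {ι : Type*} [Fintype ι] {C T : Set ℂ} {f : ℂ →L[ℝ] ℝ} {t : ℝ}
    {a p : ℂ} (hC : Convex ℝ C) (hTC : T ⊆ C) (ha : a ∈ T) (hp : p ∈ T) (hfa : f a = t)
    (hfT : ∀ w ∈ T, f w ≤ t)
    (hline : ∀ w ∈ C, f w = t → w ∈ segment ℝ a p) {P : ι → Prop} [DecidablePred P]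
    {z : ι → ℂ} (hzC : ∀ i, z i ∈ C) (hP : ∀ i, P i → t < f (z i))
    (hP' : ∀ i, ¬ P i → f (z i) < t) :
    outer T z = outer {a, p} (fun i : {i // P i} => z i) +
      outer T (fun i : {i // ¬ P i} => z i) := by
  classical
  have hsub : convexHull ℝ (T ∪ Set.range z) ⊆ C :=
    convexHull_min (Set.union_subset hTC (Set.range_subset_iff.2 hzC)) hC
  have h1 : ∀ i : {i // P i}, z i ∈ interior (convexHull ℝ (T ∪ Set.range z)) ↔
      z i ∈ interior (convexHull ℝ ({a, p} ∪ Set.range fun i : {i // P i} => z i)) := by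
    intro i
    refine mem_interior_convexHull_iff_of_line (f := f) (t := t) (a := a) (p := p)
      (Or.inl ha) hfa (fun w hw => hline w (hsub hw)) (by simp) (by simp) ?_ ?_ (hP i i.2)
    · rintro w (hw | ⟨j, rfl⟩)
      · rcases hw with rfl | hw
        · exact Or.inl ha
        · exact Or.inl (hw ▸ hp)
      · exact Or.inr ⟨j, rfl⟩
    · rintro w (hw | ⟨j, rfl⟩) hfw
      · exact absurd (hfT w hw) (not_le.2 hfw)
      · refine Or.inr ⟨⟨j, ?_⟩, rfl⟩
        by_contra hj
        exact lt_asymm hfw (hP' j hj)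
  have h2 : ∀ i : {i // ¬ P i}, z i ∈ interior (convexHull ℝ (T ∪ Set.range z)) ↔
      z i ∈ interior (convexHull ℝ (T ∪ Set.range fun i : {i // ¬ P i} => z i)) := by
    intro i
    refine mem_interior_convexHull_iff_of_line (f := -f) (t := -t) (a := a) (p := p)
      (Or.inl ha) (by simp [hfa]) (fun w hw h => hline w (hsub hw) (by simpa using h))
      (Or.inl ha) (Or.inl hp) ?_ ?_ (by simpa using hP' i i.2)
    · rintro w (hw | ⟨j, rfl⟩)
      · exact Or.inl hw
      · exact Or.inr ⟨j, rfl⟩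
    · rintro w (hw | ⟨j, rfl⟩) hfw
      · exact Or.inl hw
      · refine Or.inr ⟨⟨j, fun hj => ?_⟩, rfl⟩
        have := hP j hj
        simp at hfw
        exact lt_asymm hfw this
  rw [outer_eq_sum, outer_eq_sum, outer_eq_sum, ← Fintype.sum_subtype_add_sum_subtype P]
  simp only [h1, h2]

/-! ### The volume of a set of tuples with a given boundary count -/

/-- The volume of the set of `n`-tuples of points of `S` with exactly `m` entries on the boundary
of the convex hull of `T` and the tuple. -/
noncomputable def hullVol (S T : Set ℂ) (n m : ℕ) : ℝ≥0∞ :=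
  volume {z : Fin n → ℂ | (∀ i, z i ∈ S) ∧ outer T z = m}

theorem measurableSet_outer_eq {ι : Type*} [Fintype ι] {S T : Set ℂ} (hS : MeasurableSet S)
    (hT : T.Finite) (m : ℕ) :
    MeasurableSet {z : ι → ℂ | (∀ i, z i ∈ S) ∧ outer T z = m} := by
  have := hT.fintype
  have h : Measurable fun z : ι → ℂ => outer T z := by
    have := measurable_outer (X := ι → ℂ) (g := fun (t : T) _ => (t : ℂ))
      (z := fun i z => z i) (fun _ => continuous_const) (fun i => continuous_apply i)
    simpa using this
  refine MeasurableSet.inter (?_ : MeasurableSet {z : ι → ℂ | ∀ i, z i ∈ S})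
    (h (measurableSet_singleton m))
  rw [Set.ofPred_forall]
  exact MeasurableSet.iInter fun i => measurable_pi_apply i hS

theorem volume_outer_eq {ι : Type*} [Fintype ι] (S T : Set ℂ) (m : ℕ) :
    volume {z : ι → ℂ | (∀ i, z i ∈ S) ∧ outer T z = m} = hullVol S T (Fintype.card ι) m := by
  have e := Fintype.equivFin ι
  have h := (volume_measurePreserving_piCongrLeft (fun _ => ℂ) e).measure_preimage_equiv
    {z : Fin (Fintype.card ι) → ℂ | (∀ i, z i ∈ S) ∧ outer T z = m}
  rw [hullVol, ← h]
  congr 1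
  ext z
  have hz : (MeasurableEquiv.piCongrLeft (fun _ => ℂ) e z : Fin (Fintype.card ι) → ℂ) ∘ e = z := by
    ext i
    exact Equiv.piCongrLeft_apply_apply (P := fun _ => ℂ) e z i
  simp only [Set.mem_preimage, Set.mem_ofPred_eq]
  rw [← outer_comp_equiv T _ e, hz, ← e.forall_congr_right]
  have : ∀ i, MeasurableEquiv.piCongrLeft (fun _ => ℂ) e z (e i) = z i := fun i => congrFun hz i
  simp only [this]

theorem volume_outer_congr {ι : Type*} [Fintype ι] {S S' : Set ℂ}
    (h : S =ᵐ[volume] S') (P : (ι → ℂ) → Prop) :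
    volume {z : ι → ℂ | (∀ i, z i ∈ S) ∧ P z} = volume {z : ι → ℂ | (∀ i, z i ∈ S') ∧ P z} := by
  refine measure_congr ?_
  have h' : ∀ i : ι, ∀ᵐ z : ι → ℂ, z i ∈ S ↔ z i ∈ S' := fun i =>
    (Measure.quasiMeasurePreserving_eval (fun _ : ι => (volume : Measure ℂ)) i).ae h.mem_iff
  filter_upwards [ae_all_iff.2 h'] with z hz
  refine propext ?_
  change ((∀ i, z i ∈ S) ∧ P z) ↔ ((∀ i, z i ∈ S') ∧ P z)
  simp only [hz]

theorem hullVol_congr {S S' : Set ℂ} (h : S =ᵐ[volume] S') (T : Set ℂ) (n m : ℕ) :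
    hullVol S T n m = hullVol S' T n m :=
  volume_outer_congr h _

theorem volume_preimage_similarity {n : ℕ} {c : ℂ} (hc : c ≠ 0) (d : ℂ) {A : Set (Fin n → ℂ)}
    (hA : MeasurableSet A) :
    volume A = ENNReal.ofReal (‖c‖ ^ (2 * n)) *
      volume {z : Fin n → ℂ | (fun i => c * z i + d) ∈ A} := by
  have hn : ‖c‖ ≠ 0 := norm_ne_zero_iff.2 hc
  set a : Circle := ⟨c / (‖c‖ : ℝ), by
    rw [Submonoid.unitSphere, Submonoid.mem_mk]; simp [hn]⟩ with ha
  have hca : ∀ w : ℂ, c * w = (‖c‖ : ℝ) • ((a : ℂ) * w) := by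
    intro w
    have : (‖c‖ : ℂ) ≠ 0 := by exact_mod_cast hn
    simp only [ha, Complex.real_smul]
    field_simp
  have h1 : MeasurePreserving (fun (z : Fin n → ℂ) i => (a : ℂ) * z i) :=
    volume_preserving_pi fun _ => (rotation a).measurePreserving
  have h2 : {z : Fin n → ℂ | (fun i => c * z i + d) ∈ A} =
      (fun (z : Fin n → ℂ) i => (a : ℂ) * z i) ⁻¹'
        ((fun z : Fin n → ℂ => ‖c‖ • z) ⁻¹' ((fun z : Fin n → ℂ => z + fun _ => d) ⁻¹' A)) := by
    ext z
    simp only [hca]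
    rfl
  have m1 : MeasurableSet ((fun z : Fin n → ℂ => z + fun _ => d) ⁻¹' A) :=
    measurable_add_const _ hA
  have m2 := measurable_const_smul (α := Fin n → ℂ) ‖c‖ m1
  rw [h2, h1.measure_preimage m2.nullMeasurableSet, Measure.addHaar_preimage_smul _ hn,
    measure_preimage_add_right, ← mul_assoc, ← ENNReal.ofReal_mul (by positivity)]
  have hfr : Module.finrank ℝ (Fin n → ℂ) = 2 * n := by
    rw [Module.finrank_pi_fintype]; simp [mul_comm]
  rw [hfr, abs_of_nonneg (by positivity), mul_inv_cancel₀ (by positivity), ENNReal.ofReal_one,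
    one_mul]

theorem hullVol_similarity {c : ℂ} (hc : c ≠ 0) (d : ℂ) {S T : Set ℂ} (hS : MeasurableSet S)
    (hT : T.Finite) (n m : ℕ) :
    hullVol ((fun w => c * w + d) '' S) ((fun w => c * w + d) '' T) n m =
      ENNReal.ofReal (‖c‖ ^ (2 * n)) * hullVol S T n m := by
  have hinj : Function.Injective (fun w : ℂ => c * w + d) := fun x y h => by
    simpa [hc] using h
  have hS' : MeasurableSet ((fun w => c * w + d) '' S) := by
    exact ((Homeomorph.mulLeft₀ c hc).trans
      (Homeomorph.addRight d)).toMeasurableEquiv.measurableSet_image.2 hS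
  rw [hullVol, volume_preimage_similarity hc d (measurableSet_outer_eq hS' (hT.image _) m), hullVol]
  congr 2
  ext z
  simp only [Set.mem_ofPred_eq, outer_similarity hc]
  refine and_congr_left fun _ => forall_congr' fun i => hinj.mem_set_image (a := z i)

theorem hullVol_ne_top_and_le {S : Set ℂ} (hS : volume S ≠ ∞) (T : Set ℂ) (n m : ℕ) :
    hullVol S T n m ≠ ∞ ∧ hullVol S T n m ≤ volume S ^ n := by
  have : hullVol S T n m ≤ volume S ^ n := by
    refine (measure_mono fun z hz => ?_ : _ ≤ volume (Set.univ.pi fun _ : Fin n => S)).trans ?_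
    · exact fun i _ => hz.1 i
    · rw [volume_pi_pi]; simp
  exact ⟨ne_top_of_le_ne_top (ENNReal.pow_ne_top hS) this, this⟩

theorem hullVol_eq_zero_of_lt (S T : Set ℂ) {n m : ℕ} (h : n < m) : hullVol S T n m = 0 := by
  have : {z : Fin n → ℂ | (∀ i, z i ∈ S) ∧ outer T z = m} = ∅ := by
    ext z
    simp only [Set.mem_ofPred_eq, Set.mem_empty_iff_false, iff_false, not_and]
    intro _ hz
    have := outer_le_card T z
    simp at this
    omega
  rw [hullVol, this, measure_empty]

theorem volume_line {f : ℂ →L[ℝ] ℝ} (hf : f ≠ 0) (t : ℝ) : volume {w : ℂ | f w = t} = 0 := by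
  obtain ⟨w₁, hw₁⟩ : ∃ w, f w ≠ 0 := by
    by_contra! h
    exact hf (ContinuousLinearMap.ext h)
  have h1 : (AffineSubspace.mk' ((t / f w₁) • w₁) (LinearMap.ker f.toLinearMap) : Set ℂ) =
      {w : ℂ | f w = t} := by
    ext w
    have e : f ((t / f w₁) • w₁) = t := by
      rw [map_smul, smul_eq_mul, div_mul_cancel₀ _ hw₁]
    rw [SetLike.mem_coe, AffineSubspace.mem_mk', LinearMap.mem_ker]
    change f (w - (t / f w₁) • w₁) = 0 ↔ f w = t
    rw [map_sub, e, sub_eq_zero]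
  rw [← h1]
  refine Measure.addHaar_affineSubspace _ _ fun h => hw₁ ?_
  have : w₁ + (t / f w₁) • w₁ ∈
      AffineSubspace.mk' ((t / f w₁) • w₁) (LinearMap.ker f.toLinearMap) := by
    rw [h]; trivial
  simpa using this

theorem ae_eq_union_of_line {f : ℂ →L[ℝ] ℝ} (hf : f ≠ 0) (t : ℝ) (S : Set ℂ) :
    S =ᵐ[volume] (S ∩ {w | t < f w} ∪ S ∩ {w | f w < t} : Set ℂ) := by
  have : ∀ᵐ w : ℂ, f w ≠ t := by rw [ae_iff]; simpa using volume_line hf t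
  filter_upwards [this] with w hw
  refine propext ?_
  change w ∈ S ↔ w ∈ S ∩ {w | t < f w} ∪ S ∩ {w | f w < t}
  rw [← Set.inter_union_distrib_left]
  exact ⟨fun h => ⟨h, (lt_or_gt_of_ne hw).symm⟩, fun h => h.1⟩

theorem volume_eq_add_of_line {f : ℂ →L[ℝ] ℝ} (hf : f ≠ 0) (t : ℝ) {S : Set ℂ}
    (hS : MeasurableSet S) :
    volume S = volume (S ∩ {w | t < f w}) + volume (S ∩ {w | f w < t}) := by
  rw [measure_congr (ae_eq_union_of_line hf t S), measure_union _
    (hS.inter (measurableSet_lt f.measurable measurable_const))]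
  exact Set.disjoint_left.2 fun w h1 h2 => lt_asymm (show t < f w from h1.2) h2.2

/-- Cutting along the line `f = t`: one sums over the set of the indices of the points that are
beyond the line, and this set matters only through its cardinality. -/
theorem hullVol_split {C S T : Set ℂ} {f : ℂ →L[ℝ] ℝ} {t : ℝ} {a p : ℂ} (hC : Convex ℝ C)
    (hSC : S ⊆ C) (hS : MeasurableSet S) (hTC : T ⊆ C) (hT : T.Finite) (ha : a ∈ T) (hp : p ∈ T)
    (hfa : f a = t) (hf0 : f ≠ 0)
    (hfT : ∀ w ∈ T, f w ≤ t) (hline : ∀ w ∈ C, f w = t → w ∈ segment ℝ a p) (n m : ℕ) :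
    hullVol S T n m = ∑ k ∈ Finset.HasAntidiagonal.antidiagonal n, (n.choose k.1 : ℝ≥0∞) *
      ∑ b ∈ Finset.HasAntidiagonal.antidiagonal m,
        hullVol (S ∩ {w | t < f w}) {a, p} k.1 b.1 * hullVol (S ∩ {w | f w < t}) T k.2 b.2 := by
  classical
  set X := S ∩ {w | t < f w} with hX
  set Y := S ∩ {w | f w < t} with hY
  have hXm : MeasurableSet X := hS.inter (measurableSet_lt measurable_const f.measurable)
  have hYm : MeasurableSet Y := hS.inter (measurableSet_lt f.measurable measurable_const)
  have hSXY : S =ᵐ[volume] (X ∪ Y : Set ℂ) := ae_eq_union_of_line hf0 t S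
  -- `E J`: the points beyond the line are those with index in `J`
  set E : Finset (Fin n) → Set (Fin n → ℂ) := fun J =>
    {z | (∀ i, if i ∈ J then z i ∈ X else z i ∈ Y) ∧ outer T z = m} with hE
  have hXY : ∀ w, w ∈ X → w ∈ Y → False := fun w h1 h2 =>
    lt_asymm (show t < f w from h1.2) h2.2
  have hunion : {z : Fin n → ℂ | (∀ i, z i ∈ X ∪ Y) ∧ outer T z = m} =
      ⋃ J ∈ (Finset.univ : Finset (Finset (Fin n))), E J := by
    ext z
    simp only [hE, Set.mem_ofPred_eq, Set.mem_iUnion, Finset.mem_univ, exists_prop, true_and]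
    constructor
    · rintro ⟨h, hm⟩
      refine ⟨Finset.univ.filter fun i => z i ∈ X, fun i => ?_, hm⟩
      by_cases hi : z i ∈ X
      · simp [hi]
      · simpa [hi] using (h i).resolve_left hi
    · rintro ⟨J, h, hm⟩
      refine ⟨fun i => ?_, hm⟩
      have := h i
      split_ifs at this
      exacts [Or.inl this, Or.inr this]
  have hpre : ∀ J : Finset (Fin n), E J =
      (MeasurableEquiv.piEquivPiSubtypeProd (fun _ : Fin n => ℂ) (fun i => i ∈ J)) ⁻¹'
      ⋃ b ∈ Finset.HasAntidiagonal.antidiagonal m,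
        {z : {i // i ∈ J} → ℂ | (∀ i, z i ∈ X) ∧ outer {a, p} z = b.1} ×ˢ
        {z : {i // ¬ i ∈ J} → ℂ | (∀ i, z i ∈ Y) ∧ outer T z = b.2} := by
    intro J
    ext z
    have h1 : (∀ i, if i ∈ J then z i ∈ X else z i ∈ Y) ↔
        (∀ i : {i // i ∈ J}, z i ∈ X) ∧ ∀ i : {i // ¬ i ∈ J}, z i ∈ Y := by
      constructor
      · exact fun h => ⟨fun i => by simpa [i.2] using h i, fun i => by simpa [i.2] using h i⟩
      · intro h i
        split_ifs with hi
        exacts [h.1 ⟨i, hi⟩, h.2 ⟨i, hi⟩]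
    have h2 : (MeasurableEquiv.piEquivPiSubtypeProd (fun _ : Fin n => ℂ) (fun i => i ∈ J)) z =
      (fun i : {i // i ∈ J} => z i, fun i : {i // ¬ i ∈ J} => z i) := rfl
    simp only [hE, Set.mem_preimage, h2, Set.mem_iUnion, Set.mem_prod, Set.mem_ofPred_eq,
      exists_prop, Prod.exists, h1]
    have h3 : ((∀ i : {i // i ∈ J}, z i ∈ X) ∧ ∀ i : {i // ¬ i ∈ J}, z i ∈ Y) →
        outer T z = outer {a, p} (fun i : {i // i ∈ J} => z i) +
          outer T (fun i : {i // ¬ i ∈ J} => z i) := by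
      rintro ⟨hx, hy⟩
      refine outer_eq_add_of_line hC hTC ha hp hfa hfT hline (fun i => ?_)
        (fun i hi => (hx ⟨i, hi⟩).2) (fun i hi => (hy ⟨i, hi⟩).2)
      by_cases hi : i ∈ J
      exacts [hSC (hx ⟨i, hi⟩).1, hSC (hy ⟨i, hi⟩).1]
    constructor
    · rintro ⟨h, hm⟩
      exact ⟨_, _, Finset.HasAntidiagonal.mem_antidiagonal.2 ((h3 h).symm.trans hm),
        ⟨h.1, rfl⟩, h.2, rfl⟩
    · rintro ⟨k, l, hkl, ⟨hx, rfl⟩, hy, rfl⟩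
      exact ⟨⟨hx, hy⟩, (h3 ⟨hx, hy⟩).trans (Finset.HasAntidiagonal.mem_antidiagonal.1 hkl)⟩
  have hpm : ∀ (J : Finset (Fin n)) (b : ℕ × ℕ), MeasurableSet
      ({z : {i // i ∈ J} → ℂ | (∀ i, z i ∈ X) ∧ outer {a, p} z = b.1} ×ˢ
        {z : {i // ¬ i ∈ J} → ℂ | (∀ i, z i ∈ Y) ∧ outer T z = b.2}) := fun J b =>
    (measurableSet_outer_eq hXm (by simp) _).prod (measurableSet_outer_eq hYm hT _)
  have hEm : ∀ J, MeasurableSet (E J) := by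
    intro J
    rw [hpre J]
    exact (MeasurableEquiv.measurable _) (Finset.measurableSet_biUnion _ fun b _ => hpm J b)
  have hEv : ∀ J : Finset (Fin n), volume (E J) = ∑ b ∈ Finset.HasAntidiagonal.antidiagonal m,
      hullVol X {a, p} J.card b.1 * hullVol Y T (n - J.card) b.2 := by
    intro J
    rw [hpre J, (volume_preserving_piEquivPiSubtypeProd (fun _ : Fin n => ℂ)
      (fun i => i ∈ J)).measure_preimage_equiv, measure_biUnion_finset _ fun b _ => hpm J b]
    · refine Finset.sum_congr rfl fun b _ => ?_
      rw [Measure.volume_eq_prod, Measure.prod_prod, @volume_outer_eq _ (_), volume_outer_eq]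
      congr 2
      · convert! Fintype.card_coe J
      · rw [Fintype.card_subtype_compl]; simp
    · intro b hb b' hb' hne
      refine Set.disjoint_left.2 fun z hz hz' => hne ?_
      exact Prod.ext (hz.1.2.symm.trans hz'.1.2) (hz.2.2.symm.trans hz'.2.2)
  rw [hullVol_congr hSXY, hullVol, hunion, measure_biUnion_finset _ fun J _ => hEm J]
  · simp only [hEv]
    rw [← Finset.powerset_univ, Finset.sum_powerset_apply_card
      (fun k => ∑ b ∈ Finset.HasAntidiagonal.antidiagonal m,
        hullVol X {a, p} k b.1 * hullVol Y T (n - k) b.2), Finset.card_fin,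
      Finset.Nat.sum_antidiagonal_eq_sum_range_succ_mk]
    simp
  · intro J _ J' _ hne
    refine Set.disjoint_left.2 fun z hz hz' => hne ?_
    ext i
    have h1 := hz.1 i
    have h2 := hz'.1 i
    by_cases hi : i ∈ J <;> by_cases hi' : i ∈ J' <;>
      simp only [hi, hi', if_true, if_false] at h1 h2 ⊢
    · exact (hXY _ h1 h2).elim
    · exact (hXY _ h2 h1).elim

theorem hullVol_of_subset_interior {S T : Set ℂ} (h : S ⊆ interior (convexHull ℝ T)) (n m : ℕ) :
    hullVol S T n m = if m = 0 then volume S ^ n else 0 := by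
  have h0 : ∀ z : Fin n → ℂ, (∀ i, z i ∈ S) → outer T z = 0 := by
    intro z hz
    have : {i | z i ∉ interior (convexHull ℝ (T ∪ Set.range z))} = ∅ := by
      ext i
      simpa using interior_mono (convexHull_mono Set.subset_union_left) (h (hz i))
    rw [outer, this, Set.ncard_empty]
  split_ifs with hm
  · have : {z : Fin n → ℂ | (∀ i, z i ∈ S) ∧ outer T z = m} = Set.univ.pi fun _ => S := by
      ext z
      simp only [Set.mem_ofPred_eq, Set.mem_univ_pi]
      exact ⟨fun h => h.1, fun h => ⟨h, (h0 z h).trans hm.symm⟩⟩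
    rw [hullVol, this, volume_pi_pi]; simp
  · have : {z : Fin n → ℂ | (∀ i, z i ∈ S) ∧ outer T z = m} = ∅ := by
      ext z
      simp only [Set.mem_ofPred_eq, Set.mem_empty_iff_false, iff_false, not_and]
      exact fun h hm' => hm (hm'.symm.trans (h0 z h))
    rw [hullVol, this, measure_empty]

theorem outer_insertNth {n : ℕ} (T : Set ℂ) (i : Fin (n + 1)) (x : ℂ) (z : Fin n → ℂ) :
    outer T (i.insertNth x z : Fin (n + 1) → ℂ) = outer T (Fin.cons x z : Fin (n + 1) → ℂ) := by
  classical
  rw [outer_eq_sum, outer_eq_sum, Fin.sum_univ_succAbove _ i, Fin.sum_univ_succ, Fin.range_cons]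
  have hr : Set.range (i.insertNth x z : Fin (n + 1) → ℂ) = insert x (Set.range z) := by
    ext w
    simp only [Set.mem_range, Fin.exists_iff_succAbove i, Fin.insertNth_apply_same,
      Fin.insertNth_apply_succAbove, Set.mem_insert_iff, eq_comm]
  simp only [hr, Fin.insertNth_apply_same, Fin.insertNth_apply_succAbove, Fin.cons_zero,
    Fin.cons_succ]

/-- Almost surely, a unique entry of the tuple has the largest key `κ`. By symmetry, it may be taken
to be the first one, at the cost of a factor `n + 1`. -/
theorem hullVol_succ_eq_lintegral {S T : Set ℂ} (hS : MeasurableSet S) (hT : T.Finite)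
    {κ : ℂ → ℝ} (hκ : Measurable κ) (hκ0 : ∀ c, volume (S ∩ {x | κ x = c}) = 0) (n m : ℕ) :
    hullVol S T (n + 1) m = (n + 1) * ∫⁻ x in S, volume {z : Fin n → ℂ |
      (∀ j, z j ∈ S ∩ {w | κ w < κ x}) ∧ outer T (Fin.cons x z : Fin (n + 1) → ℂ) = m} := by
  classical
  set E : Fin (n + 1) → Set (Fin (n + 1) → ℂ) := fun i => {z | ((∀ j, z j ∈ S) ∧ outer T z = m) ∧
    ∀ j : Fin n, κ (z (i.succAbove j)) < κ (z i)} with hE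
  set G : Set (ℂ × (Fin n → ℂ)) := {y | y.1 ∈ S ∧ (∀ j, y.2 j ∈ S ∩ {w | κ w < κ y.1}) ∧
    outer T (Fin.cons y.1 y.2 : Fin (n + 1) → ℂ) = m} with hG
  have hEm : ∀ i, MeasurableSet (E i) := by
    intro i
    refine (measurableSet_outer_eq hS hT m).inter (?_ : MeasurableSet
      {z : Fin (n + 1) → ℂ | ∀ j : Fin n, κ (z (i.succAbove j)) < κ (z i)})
    rw [Set.ofPred_forall]
    exact MeasurableSet.iInter fun j => measurableSet_lt (hκ.comp (measurable_pi_apply _))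
      (hκ.comp (measurable_pi_apply _))
  have hpre : ∀ i, E i = MeasurableEquiv.piFinSuccAbove (fun _ => ℂ) i ⁻¹' G := by
    intro i
    ext z
    obtain ⟨x, w, rfl⟩ : ∃ x w, z = (i.insertNth x w : Fin (n + 1) → ℂ) :=
      ⟨z i, i.removeNth z, (Fin.insertNth_self_removeNth i z).symm⟩
    have e : MeasurableEquiv.piFinSuccAbove (fun _ => ℂ) i (i.insertNth x w) = (x, w) := by
      rw [MeasurableEquiv.piFinSuccAbove_apply]
      exact (Fin.insertNthEquiv (fun _ => ℂ) i).symm_apply_apply (x, w)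
    simp only [hE, hG, Set.mem_preimage, e, Set.mem_ofPred_eq, outer_insertNth,
      Fin.forall_iff_succAbove (P := fun j => (i.insertNth x w : Fin (n + 1) → ℂ) j ∈ S) i,
      Fin.insertNth_apply_same, Fin.insertNth_apply_succAbove, Set.mem_inter_iff, forall_and]
    tauto
  have hGm : MeasurableSet G := by
    have := (hEm 0)
    rw [hpre 0, MeasurableEquiv.measurableSet_preimage] at this
    exact this
  have hEv : ∀ i, volume (E i) = volume G := fun i => by
    rw [hpre i, (volume_preserving_piFinSuccAbove (fun _ => ℂ) i).measure_preimage_equiv]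
  have htie : ∀ i : Fin (n + 1), ∀ j : Fin n, ∀ᵐ z : Fin (n + 1) → ℂ,
      z i ∈ S → κ (z (i.succAbove j)) ≠ κ (z i) := by
    intro i j
    set H : Set (ℂ × (Fin n → ℂ)) := {y | y.1 ∈ S ∧ κ (y.2 j) = κ y.1} with hH
    have hHm : MeasurableSet H := (measurable_fst hS).inter
      (measurableSet_eq_fun (hκ.comp ((measurable_pi_apply j).comp measurable_snd))
        (hκ.comp measurable_fst))
    have hH0 : volume H = 0 := by
      rw [Measure.volume_eq_prod, Measure.prod_apply_symm hHm]
      refine (lintegral_congr fun w => ?_).trans lintegral_zero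
      convert! hκ0 (κ (w j)) using 2
      ext x
      simp [hH, eq_comm]
    have := (volume_preserving_piFinSuccAbove (fun _ => ℂ) i).measure_preimage_equiv H
    rw [ae_iff, ← hH0, ← this]
    congr 1
    ext z
    simp [hH, Fin.removeNth]
  have hdisj : Pairwise (Function.onFun Disjoint E) := by
    intro i i' hne
    refine Set.disjoint_left.2 fun z hz hz' => ?_
    obtain ⟨j, hj⟩ := Fin.exists_succAbove_eq hne
    obtain ⟨j', hj'⟩ := Fin.exists_succAbove_eq hne.symm
    have h1 := hz.2 j'
    have h2 := hz'.2 j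
    rw [hj'] at h1
    rw [hj] at h2
    exact lt_asymm h1 h2
  have hae : {z : Fin (n + 1) → ℂ | (∀ j, z j ∈ S) ∧ outer T z = m} =ᵐ[volume] ⋃ i, E i := by
    filter_upwards [ae_all_iff.2 fun i => ae_all_iff.2 (htie i)] with z hz
    refine propext ?_
    change ((∀ j, z j ∈ S) ∧ outer T z = m) ↔ z ∈ ⋃ i, E i
    simp only [hE, Set.mem_iUnion, Set.mem_ofPred_eq]
    refine ⟨fun h => ?_, fun ⟨i, h⟩ => h.1⟩
    obtain ⟨i, hi⟩ := Finite.exists_max fun i => κ (z i)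
    exact ⟨i, h, fun j => lt_of_le_of_ne (hi _) (hz i j (h.1 i))⟩
  rw [hullVol, measure_congr hae, measure_iUnion hdisj hEm]
  simp only [hEv, tsum_fintype, Finset.sum_const, Finset.card_fin, nsmul_eq_mul]
  push_cast
  congr 1
  rw [Measure.volume_eq_prod, Measure.prod_apply hGm, ← lintegral_indicator hS]
  refine lintegral_congr fun x => ?_
  by_cases hx : x ∈ S
  · simp only [Set.indicator_of_mem hx]
    congr 1
    ext w
    simp [hG, hx]
  · simp [hG, hx]

/-! ### Circular segments -/

theorem circlePoint_re (R ν : ℝ) : (circlePoint R ν).re = R * Real.cos ν := by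
  simp [circlePoint, Complex.exp_ofReal_mul_I_re]

theorem circlePoint_im (R ν : ℝ) : (circlePoint R ν).im = R * Real.sin ν := by
  simp [circlePoint, Complex.exp_ofReal_mul_I_im]

theorem norm_circlePoint {R : ℝ} (hR : 0 ≤ R) (ν : ℝ) : ‖circlePoint R ν‖ = R := by
  simp [circlePoint, Complex.norm_exp_ofReal_mul_I, abs_of_nonneg hR]

theorem circlePoint_one_mul (R ν μ : ℝ) :
    circlePoint 1 μ * circlePoint R ν = circlePoint R (ν + μ) := by
  simp only [circlePoint, Complex.ofReal_one, one_mul, Complex.ofReal_add, add_mul,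
    Complex.exp_add]
  ring

theorem continuous_circlePoint (R : ℝ) : Continuous (circlePoint R) := by
  unfold circlePoint; fun_prop

theorem norm_le_iff_sq {z : ℂ} {R : ℝ} (hR : 0 ≤ R) : ‖z‖ ≤ R ↔ z.re ^ 2 + z.im ^ 2 ≤ R ^ 2 := by
  rw [← sq_le_sq₀ (norm_nonneg z) hR, Complex.sq_norm, Complex.normSq_apply, sq, sq, sq]

theorem norm_lt_iff_sq {z : ℂ} {R : ℝ} (hR : 0 ≤ R) : ‖z‖ < R ↔ z.re ^ 2 + z.im ^ 2 < R ^ 2 := by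
  rw [← sq_lt_sq₀ (norm_nonneg z) hR, Complex.sq_norm, Complex.normSq_apply, sq, sq, sq]

/-- A point of the disk lies on a chord perpendicular to the real axis. -/
theorem mem_segment_circlePoint {R : ℝ} {z : ℂ} (hR : 0 < R) (hz : ‖z‖ ≤ R) {ν : ℝ}
    (hν : 0 ≤ Real.sin ν) (hre : z.re = R * Real.cos ν) :
    z ∈ segment ℝ (circlePoint R (-ν)) (circlePoint R ν) := by
  rw [norm_le_iff_sq hR.le] at hz
  have him : |z.im| ≤ R * Real.sin ν := by
    rw [← abs_of_nonneg (mul_nonneg hR.le hν), ← sq_le_sq]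
    rw [hre] at hz
    linear_combination hz - R ^ 2 * Real.sin_sq_add_cos_sq ν
  rw [abs_le] at him
  rcases hν.eq_or_lt with h0 | h0
  · have h1 : z = circlePoint R ν := by
      apply Complex.ext
      · rw [hre, circlePoint_re]
      · rw [circlePoint_im]; rw [← h0] at him ⊢; linarith
    exact h1 ▸ right_mem_segment ℝ _ _
  · have hRs : 0 < R * Real.sin ν := mul_pos hR h0
    refine ⟨(R * Real.sin ν - z.im) / (2 * (R * Real.sin ν)),
      (R * Real.sin ν + z.im) / (2 * (R * Real.sin ν)), div_nonneg (by linarith) (by linarith),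
      div_nonneg (by linarith) (by linarith), by field_simp; ring, ?_⟩
    apply Complex.ext
    · simp only [Complex.add_re, Complex.real_smul, Complex.re_ofReal_mul, circlePoint_re,
        Real.cos_neg, hre]
      field_simp; ring
    · simp only [Complex.add_im, Complex.real_smul, Complex.im_ofReal_mul, circlePoint_im,
        Real.sin_neg]
      field_simp; ring

theorem cos_le_cos_of_abs_le {ν δ : ℝ} (hδ : δ ≤ Real.pi) (h : |ν| ≤ δ) :
    Real.cos δ ≤ Real.cos ν := by
  rw [← Real.cos_abs ν]
  exact Real.cos_le_cos_of_nonneg_of_le_pi (abs_nonneg _) hδ h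

theorem arc_eq (θ R : ℝ) : arc θ R = {z | ∃ ν, |ν| ≤ θ / 2 ∧ circlePoint R ν = z} := by
  ext z; simp [arc, abs_le, neg_div]

theorem seg_eq {θ R : ℝ} (h0 : 0 < θ) (h1 : θ < 2 * Real.pi) (hR : 0 < R) :
    seg θ R = {z | ‖z‖ ≤ R ∧ R * Real.cos (θ / 2) ≤ z.re} := by
  apply Set.Subset.antisymm
  · refine convexHull_min ?_ ?_
    · rw [arc_eq]
      rintro _ ⟨ν, hν, rfl⟩
      refine ⟨(norm_circlePoint hR.le ν).le, ?_⟩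
      rw [circlePoint_re]
      exact mul_le_mul_of_nonneg_left (cos_le_cos_of_abs_le (by linarith) hν) hR.le
    · have e : {z : ℂ | ‖z‖ ≤ R ∧ R * Real.cos (θ / 2) ≤ z.re} =
          Metric.closedBall 0 R ∩ {z | R * Real.cos (θ / 2) ≤ z.re} := by
        ext; simp
      rw [e]
      exact (convex_closedBall _ _).inter (convex_halfSpace_re_ge _)
  · rintro z ⟨hz, hre⟩
    have hz1 : |z.re| ≤ R := (Complex.abs_re_le_norm z).trans hz
    rw [abs_le] at hz1
    set ν := Real.arccos (z.re / R) with hν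
    have hcos : Real.cos ν = z.re / R :=
      Real.cos_arccos (by rw [le_div_iff₀ hR]; linarith) (by rw [div_le_iff₀ hR]; linarith)
    have hν0 : 0 ≤ ν := Real.arccos_nonneg _
    have hνπ : ν ≤ Real.pi := Real.arccos_le_pi _
    have hνθ : ν ≤ θ / 2 := by
      by_contra! h
      have := Real.cos_lt_cos_of_nonneg_of_le_pi (by linarith) hνπ h
      rw [hcos, div_lt_iff₀ hR] at this
      linarith
    refine (convex_convexHull ℝ (arc θ R)).segment_subset (subset_convexHull _ _ ?_)
      (subset_convexHull _ _ ?_)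
      (mem_segment_circlePoint hR hz (Real.sin_nonneg_of_nonneg_of_le_pi hν0 hνπ) ?_)
    · rw [arc_eq]; exact ⟨-ν, by rwa [abs_neg, abs_of_nonneg hν0], rfl⟩
    · rw [arc_eq]; exact ⟨ν, by rwa [abs_of_nonneg hν0], rfl⟩
    · rw [hcos]; field_simp

theorem seg_scale (θ : ℝ) {R : ℝ} :
    seg θ R = (fun w : ℂ => (R : ℂ) * w + 0) '' seg θ 1 := by
  have h : (fun w : ℂ => (R : ℂ) * w + 0) = ⇑(R • (LinearMap.id : ℂ →ₗ[ℝ] ℂ)) := by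
    ext w; simp
  rw [h, seg, seg, (R • (LinearMap.id : ℂ →ₗ[ℝ] ℂ)).image_convexHull, ← h, arc, arc,
    ← Set.image_comp]
  congr 2
  ext ν
  simp [circlePoint]

theorem convex_seg (θ R : ℝ) : Convex ℝ (seg θ R) := convex_convexHull _ _

theorem isClosed_seg {θ R : ℝ} (h0 : 0 < θ) (h1 : θ < 2 * Real.pi) (hR : 0 < R) :
    IsClosed (seg θ R) := by
  rw [seg_eq h0 h1 hR]
  exact (isClosed_le continuous_norm continuous_const).inter
    (isClosed_le continuous_const Complex.continuous_re)

/-- The interior of the segment of angle `θ` of the unit disk. -/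
def openSeg (θ : ℝ) : Set ℂ := {z | ‖z‖ < 1 ∧ Real.cos (θ / 2) < z.re}

theorem isOpen_openSeg (θ : ℝ) : IsOpen (openSeg θ) :=
  (isOpen_lt continuous_norm continuous_const).inter
    (isOpen_lt continuous_const Complex.continuous_re)

theorem openSeg_subset_seg {θ : ℝ} (h0 : 0 < θ) (h1 : θ < 2 * Real.pi) : openSeg θ ⊆ seg θ 1 := by
  rw [seg_eq h0 h1 one_pos]
  exact fun z hz => ⟨hz.1.le, by rw [one_mul]; exact hz.2.le⟩

theorem ae_norm_ne_one : ∀ᵐ z : ℂ, ‖z‖ ≠ 1 := by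
  rw [ae_iff]
  convert! Measure.addHaar_sphere (volume : Measure ℂ) 0 1 using 2
  ext; simp

theorem openSeg_ae_eq_seg {θ : ℝ} (h0 : 0 < θ) (h1 : θ < 2 * Real.pi) :
    openSeg θ =ᵐ[volume] seg θ 1 := by
  rw [seg_eq h0 h1 one_pos]
  have e2 : ∀ᵐ z : ℂ, z.re ≠ Real.cos (θ / 2) := by
    rw [ae_iff]
    have : Complex.reCLM ≠ 0 := fun h => by simpa using congrArg (· 1) h
    simpa using volume_line this (Real.cos (θ / 2))
  filter_upwards [ae_norm_ne_one, e2] with z h1 h2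
  refine propext ?_
  change (‖z‖ < 1 ∧ Real.cos (θ / 2) < z.re) ↔ (‖z‖ ≤ 1 ∧ 1 * Real.cos (θ / 2) ≤ z.re)
  rw [one_mul, lt_iff_le_and_ne, lt_iff_le_and_ne]
  tauto

theorem volume_seg {θ : ℝ} (h0 : 0 < θ) (h1 : θ < 2 * Real.pi) :
    volume (seg θ 1) = ENNReal.ofReal ((θ - Real.sin θ) / 2) := by
  rw [← measure_congr (openSeg_ae_eq_seg h0 h1)]
  have hc : -1 < Real.cos (θ / 2) := by
    rw [← Real.cos_pi]
    exact Real.cos_lt_cos_of_nonneg_of_le_pi (by linarith) le_rfl (by linarith)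
  have hpre : openSeg θ = Complex.measurableEquivRealProd ⁻¹'
      regionBetween (fun x => -√(1 - x ^ 2)) (fun x => √(1 - x ^ 2))
        (Set.Ioc (Real.cos (θ / 2)) 1) := by
    ext z
    simp only [openSeg, regionBetween, Set.mem_ofPred_eq, Set.mem_preimage,
      Complex.measurableEquivRealProd_apply, Set.mem_Ioc, Set.mem_Ioo, norm_lt_iff_sq one_pos.le,
      ← abs_lt]
    constructor
    · rintro ⟨h, h'⟩
      refine ⟨⟨h', by nlinarith⟩, ?_⟩
      apply Real.lt_sqrt_of_sq_lt
      rw [sq_abs]; linarith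
    · rintro ⟨⟨h, _⟩, h'⟩
      rw [Real.lt_sqrt (abs_nonneg _), sq_abs] at h'
      exact ⟨by linarith, h⟩
  have hcont : Continuous fun x : ℝ => √(1 - x ^ 2) := by fun_prop
  rw [hpre, Complex.volume_preserving_equiv_real_prod.measure_preimage_equiv,
    Measure.volume_eq_prod, volume_regionBetween_eq_integral (f := fun x => -√(1 - x ^ 2))
      (hcont.neg.integrableOn_Icc.mono_set Set.Ioc_subset_Icc_self)
      (hcont.integrableOn_Icc.mono_set Set.Ioc_subset_Icc_self) measurableSet_Ioc
      (fun x _ => by have := Real.sqrt_nonneg (1 - x ^ 2); linarith)]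
  congr 1
  rw [← intervalIntegral.integral_of_le (Real.cos_le_one _)]
  have hF : ∀ x ∈ Set.Ioo (Real.cos (θ / 2)) 1,
      HasDerivAt (fun x => x * √(1 - x ^ 2) - Real.arccos x)
        (((fun x => √(1 - x ^ 2)) - fun x => -√(1 - x ^ 2)) x) x := by
    intro x hx
    have hx1 : x < 1 := hx.2
    have hx2 : -1 < x := hc.trans hx.1
    have hpos : 0 < 1 - x ^ 2 := by nlinarith
    have d1 : HasDerivAt (fun x : ℝ => 1 - x ^ 2) (-(2 * x)) x := by
      simpa using (hasDerivAt_pow 2 x).const_sub 1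
    have d := ((hasDerivAt_id x).mul (d1.sqrt hpos.ne')).sub
      (Real.hasDerivAt_arccos hx2.ne' hx1.ne)
    refine d.congr_deriv ?_
    have hs : √(1 - x ^ 2) ≠ 0 := (Real.sqrt_pos.2 hpos).ne'
    have hs2 : √(1 - x ^ 2) ^ 2 = 1 - x ^ 2 := Real.sq_sqrt hpos.le
    simp only [id, Pi.sub_apply]
    field_simp
    linear_combination (-1 : ℝ) * hs2
  rw [intervalIntegral.integral_eq_sub_of_hasDerivAt_of_le (Real.cos_le_one _)
    (by exact ((continuous_id.mul hcont).sub Real.continuous_arccos).continuousOn) hF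
    ((hcont.sub hcont.neg).intervalIntegrable _ _)]
  have hs : √(1 - Real.cos (θ / 2) ^ 2) = Real.sin (θ / 2) := by
    rw [← Real.sin_sq, Real.sqrt_sq (Real.sin_nonneg_of_nonneg_of_le_pi (by linarith)
      (by linarith))]
  rw [hs, Real.arccos_cos (by linarith) (by linarith)]
  have h2 : Real.sin θ = 2 * Real.sin (θ / 2) * Real.cos (θ / 2) := by
    rw [← Real.sin_two_mul]; ring_nf
  rw [h2]
  norm_num
  ring

/-! ### Splitting a circular segment by two chords -/

/-- The volume form of `B`: the volume of the set of `n`-tuples of the unit circular segment of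
angle `θ` with exactly `m` entries on the boundary of the hull of the tuple and the two endpoints
of the chord. -/
noncomputable def segVol (n m : ℕ) (θ : ℝ) : ℝ≥0∞ :=
  hullVol (seg θ 1) {circlePoint 1 (-θ / 2), circlePoint 1 (θ / 2)} n m

/-- The orthogonal projection on the direction `e^{iμ}`. The chord of the unit circle between the
angles `μ - δ` and `μ + δ` is on the line `proj μ = cos δ`. -/
noncomputable def proj (μ : ℝ) : ℂ →L[ℝ] ℝ :=
  Complex.reCLM.comp (ContinuousLinearMap.mul ℝ ℂ (circlePoint 1 (-μ)))

theorem proj_apply (μ : ℝ) (z : ℂ) : proj μ z = (circlePoint 1 (-μ) * z).re := rfl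

theorem proj_circlePoint (μ ν : ℝ) : proj μ (circlePoint 1 ν) = Real.cos (ν - μ) := by
  rw [proj_apply, circlePoint_one_mul, circlePoint_re, one_mul, sub_eq_add_neg]

theorem proj_ne_zero (μ : ℝ) : proj μ ≠ 0 := fun h => by
  have := proj_circlePoint μ μ
  rw [h] at this
  simp at this

theorem circlePoint_neg_mul (μ : ℝ) (z : ℂ) :
    circlePoint 1 μ * (circlePoint 1 (-μ) * z) = z := by
  rw [← mul_assoc, circlePoint_one_mul]
  simp [circlePoint]

theorem mem_segment_of_proj {μ δ : ℝ} (hδ : 0 ≤ Real.sin δ) {w : ℂ} (hw : ‖w‖ ≤ 1)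
    (h : proj μ w = Real.cos δ) :
    w ∈ segment ℝ (circlePoint 1 (μ - δ)) (circlePoint 1 (μ + δ)) := by
  have h1 : circlePoint 1 (-μ) * w ∈ segment ℝ (circlePoint 1 (-δ)) (circlePoint 1 δ) := by
    refine mem_segment_circlePoint one_pos ?_ hδ ?_
    · rwa [norm_mul, norm_circlePoint zero_le_one, one_mul]
    · rw [one_mul]; exact h
  obtain ⟨x, y, hx, hy, hxy, e⟩ := h1
  refine ⟨x, y, hx, hy, hxy, ?_⟩
  have e' := congrArg (circlePoint 1 μ * ·) e
  simp only [circlePoint_neg_mul, mul_add, mul_smul_comm, circlePoint_one_mul] at e'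
  rw [← e', neg_add_eq_sub, add_comm δ μ]

theorem cos_le_cos_of_le_abs {δ x : ℝ} (hδ : 0 ≤ δ) (h1 : δ ≤ |x|) (h2 : |x| ≤ 2 * Real.pi - δ) :
    Real.cos x ≤ Real.cos δ := by
  rw [← Real.cos_abs x]
  rcases le_total |x| Real.pi with h | h
  · exact Real.cos_le_cos_of_nonneg_of_le_pi hδ h h1
  · rw [← Real.cos_two_pi_sub]
    exact Real.cos_le_cos_of_nonneg_of_le_pi hδ (by linarith) (by linarith)

/-- The cap of the unit disk beyond a chord is the image of a circular segment by a rotation. -/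
theorem cap_eq {μ δ : ℝ} (h0 : 0 < δ) (h1 : δ < Real.pi) :
    {z : ℂ | ‖z‖ ≤ 1 ∧ Real.cos δ ≤ proj μ z} =
      (fun w => circlePoint 1 μ * w + 0) '' seg (2 * δ) 1 := by
  rw [seg_eq (by linarith) (by linarith) one_pos]
  ext z
  simp only [Set.mem_ofPred_eq, Set.mem_image, add_zero]
  constructor
  · rintro ⟨hz, hp⟩
    refine ⟨circlePoint 1 (-μ) * z, ⟨?_, ?_⟩, circlePoint_neg_mul μ z⟩
    · rwa [norm_mul, norm_circlePoint zero_le_one, one_mul]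
    · rw [one_mul, mul_div_cancel_left₀ _ two_ne_zero]; exact hp
  · rintro ⟨w, ⟨hw, hp⟩, rfl⟩
    refine ⟨by rwa [norm_mul, norm_circlePoint zero_le_one, one_mul], ?_⟩
    rw [one_mul, mul_div_cancel_left₀ _ two_ne_zero] at hp
    have := circlePoint_neg_mul (-μ) w
    rw [neg_neg] at this
    rwa [proj_apply, this]

theorem cap_subset_of_convex {μ δ : ℝ} (h0 : 0 < δ) (h1 : δ < Real.pi) {K : Set ℂ}
    (hK : Convex ℝ K) (h : ∀ ν, |ν - μ| ≤ δ → circlePoint 1 ν ∈ K) :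
    {z : ℂ | ‖z‖ ≤ 1 ∧ Real.cos δ ≤ proj μ z} ⊆ K := by
  rw [cap_eq h0 h1, Set.image_subset_iff]
  refine convexHull_min ?_ ?_
  · rw [arc_eq]
    rintro _ ⟨ν, hν, rfl⟩
    rw [Set.mem_preimage, circlePoint_one_mul, add_zero]
    refine h _ ?_
    rwa [add_sub_cancel_right, ← mul_div_cancel_left₀ δ (two_ne_zero' ℝ)]
  · simp only [add_zero]
    exact hK.linear_preimage (LinearMap.mulLeft ℝ (circlePoint 1 μ))

theorem cap_ae_eq {μ δ : ℝ} (h0 : 0 < δ) (h1 : δ < Real.pi) :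
    {z : ℂ | ‖z‖ ≤ 1 ∧ Real.cos δ < proj μ z} =ᵐ[volume]
      (fun w => circlePoint 1 μ * w + 0) '' seg (2 * δ) 1 := by
  rw [← cap_eq h0 h1]
  have e : ∀ᵐ z : ℂ, proj μ z ≠ Real.cos δ := by
    rw [ae_iff]; simpa using volume_line (proj_ne_zero μ) (Real.cos δ)
  filter_upwards [e] with z hz
  refine propext ?_
  change (‖z‖ ≤ 1 ∧ Real.cos δ < proj μ z) ↔ (‖z‖ ≤ 1 ∧ Real.cos δ ≤ proj μ z)
  rw [lt_iff_le_and_ne]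
  have := hz.symm
  tauto

theorem hullVol_cap {μ δ : ℝ} (h0 : 0 < δ) (h1 : δ < Real.pi) (n m : ℕ) :
    hullVol {z : ℂ | ‖z‖ ≤ 1 ∧ Real.cos δ < proj μ z}
      {circlePoint 1 (μ - δ), circlePoint 1 (μ + δ)} n m = segVol n m (2 * δ) := by
  have hc : circlePoint 1 μ ≠ 0 := by
    rw [← norm_ne_zero_iff, norm_circlePoint zero_le_one]; exact one_ne_zero
  have hT : ({circlePoint 1 (μ - δ), circlePoint 1 (μ + δ)} : Set ℂ) =
      (fun w => circlePoint 1 μ * w + 0) ''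
        {circlePoint 1 (-(2 * δ) / 2), circlePoint 1 (2 * δ / 2)} := by
    rw [Set.image_pair, add_zero, add_zero, circlePoint_one_mul, circlePoint_one_mul]
    congr 2 <;> ring_nf
  have hm := (isClosed_seg (θ := 2 * δ) (by linarith) (by linarith) one_pos).measurableSet
  rw [hullVol_congr (cap_ae_eq h0 h1), hT, hullVol_similarity hc 0 hm (by simp),
    norm_circlePoint zero_le_one, one_pow, ENNReal.ofReal_one, one_mul, segVol]

theorem volume_cap {μ δ : ℝ} (h0 : 0 < δ) (h1 : δ < Real.pi) :
    volume {z : ℂ | ‖z‖ ≤ 1 ∧ Real.cos δ < proj μ z} =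
      ENNReal.ofReal ((2 * δ - Real.sin (2 * δ)) / 2) := by
  have h : (fun w => circlePoint 1 μ * w + 0) =
      rotation (Circle.exp μ) := by
    ext w
    rw [add_zero, rotation_apply, Circle.coe_exp, circlePoint, Complex.ofReal_one, one_mul]
  rw [measure_congr (cap_ae_eq h0 h1), h, ← volume_seg (by linarith) (by linarith)]
  exact (rotation _).toHomeomorph.toMeasurableEquiv.image_eq_preimage_symm _ ▸
    ((rotation _).symm.measurePreserving.measure_preimage_equiv
      (f := (rotation _).symm.toHomeomorph.toMeasurableEquiv) _)

theorem sin_add_sin_sub_sin (φ η : ℝ) : Real.sin η + Real.sin (φ - η) - Real.sin φ =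
    4 * Real.sin ((φ - η) / 2) * Real.sin (φ / 2) * Real.sin (η / 2) := by
  obtain ⟨x, rfl⟩ : ∃ x, η = 2 * x := ⟨η / 2, by ring⟩
  obtain ⟨y, rfl⟩ : ∃ y, φ = 2 * (x + y) := ⟨φ / 2 - x, by ring⟩
  have e1 : 2 * (x + y) - 2 * x = 2 * y := by ring
  have e2 : 2 * y / 2 = y := by ring
  have e3 : 2 * (x + y) / 2 = x + y := by ring
  have e4 : 2 * x / 2 = x := by ring
  rw [e1, e2, e3, e4, Real.sin_two_mul, Real.sin_two_mul, Real.sin_two_mul, Real.sin_add,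
    Real.cos_add]
  have hx := Real.sin_sq_add_cos_sq x
  have hy := Real.sin_sq_add_cos_sq y
  linear_combination (2 * Real.sin x * Real.cos x * (-1 : ℝ) ) * hy +
    (-2 * Real.sin y * Real.cos y) * hx

section three
variable {φ η : ℝ}

/-- The part of a circular segment below two adjacent chords lies, up to a null set, in the interior
of the triangle spanned by the chords. -/
theorem openSeg_inter_subset_interior (h0 : 0 < η) (h1 : η < φ) (h2 : φ < 2 * Real.pi) :
    openSeg φ ∩ {w | proj ((η - φ) / 2) w < Real.cos (η / 2)} ∩
        {w | proj (η / 2) w < Real.cos ((φ - η) / 2)} ⊆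
      interior (convexHull ℝ {circlePoint 1 (η - φ / 2), circlePoint 1 (-φ / 2),
        circlePoint 1 (φ / 2)}) := by
  set a := circlePoint 1 (-φ / 2)
  set p := circlePoint 1 (η - φ / 2)
  set b := circlePoint 1 (φ / 2)
  rintro q ⟨⟨hq, hq1⟩, hq2⟩
  have hq0 : q ∈ interior (convexHull ℝ (arc φ 1)) :=
    interior_mono (openSeg_subset_seg (h0.trans h1) h2) ((isOpen_openSeg φ).interior_eq.symm ▸ hq)
  have hball : ∀ s ⊆ arc φ 1, convexHull ℝ s ⊆ Metric.closedBall 0 1 := by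
    intro s hs
    refine convexHull_min (hs.trans ?_) (convex_closedBall _ _)
    rw [arc_eq]
    rintro _ ⟨ν, _, rfl⟩
    simp [norm_circlePoint]
  have ea : a = circlePoint 1 ((η - φ) / 2 - η / 2) := by simp only [a]; ring_nf
  have ep : p = circlePoint 1 ((η - φ) / 2 + η / 2) := by simp only [p]; ring_nf
  have ep' : p = circlePoint 1 (η / 2 - (φ - η) / 2) := by simp only [p]; ring_nf
  have eb : b = circlePoint 1 (η / 2 + (φ - η) / 2) := by simp only [b]; ring_nf
  have hline1 : ∀ w : ℂ, ‖w‖ ≤ 1 → proj ((η - φ) / 2) w = Real.cos (η / 2) →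
      w ∈ segment ℝ a p := fun w hw h => by
    rw [ea, ep]
    exact mem_segment_of_proj (Real.sin_nonneg_of_nonneg_of_le_pi (by linarith) (by linarith)) hw h
  have hline2 : ∀ w : ℂ, ‖w‖ ≤ 1 → proj (η / 2) w = Real.cos ((φ - η) / 2) →
      w ∈ segment ℝ p b := fun w hw h => by
    rw [ep', eb]
    exact mem_segment_of_proj (Real.sin_nonneg_of_nonneg_of_le_pi (by linarith) (by linarith)) hw h
  have hamem : a ∈ arc φ 1 := by
    rw [arc_eq]; exact ⟨_, by rw [neg_div, abs_neg, abs_of_nonneg (by linarith)], rfl⟩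
  have hpmem : p ∈ arc φ 1 := by
    rw [arc_eq]; exact ⟨_, by rw [abs_le]; constructor <;> linarith, rfl⟩
  have hbmem : b ∈ arc φ 1 := by
    rw [arc_eq]; exact ⟨_, by rw [abs_of_nonneg (by linarith)], rfl⟩
  have hfa : proj ((η - φ) / 2) a = Real.cos (η / 2) := by
    rw [ea, proj_circlePoint, ← Real.cos_neg]; ring_nf
  have hfp : proj (η / 2) p = Real.cos ((φ - η) / 2) := by
    rw [ep', proj_circlePoint, ← Real.cos_neg]; ring_nf
  set s' : Set ℂ := insert a (circlePoint 1 '' Set.Icc (η - φ / 2) (φ / 2)) with hs'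
  have hps' : p ∈ s' := Or.inr ⟨_, ⟨le_rfl, by linarith⟩, rfl⟩
  have hs'sub : s' ⊆ arc φ 1 := by
    rintro _ (rfl | ⟨ν, hν, rfl⟩)
    · exact hamem
    · rw [arc_eq]; exact ⟨_, by rw [abs_le]; constructor <;> linarith [hν.1, hν.2], rfl⟩
  have hq' : q ∈ interior (convexHull ℝ s') := by
    refine (mem_interior_convexHull_iff_of_line (f := -proj ((η - φ) / 2))
      (t := -Real.cos (η / 2)) (a := a) (p := p) hamem (by simp [hfa])
      (fun w hw h => hline1 w (by simpa using hball _ subset_rfl hw) (by simpa using h))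
      (Or.inl rfl) hps' hs'sub ?_ (by simpa using hq1)).1 hq0
    intro w hw hfw
    rw [arc_eq] at hw
    obtain ⟨ν, hν, rfl⟩ := hw
    refine Or.inr ⟨ν, ⟨?_, (abs_le.1 hν).2⟩, rfl⟩
    by_contra! hlt
    have : Real.cos (η / 2) ≤ Real.cos (ν - (η - φ) / 2) :=
      cos_le_cos_of_abs_le (by linarith)
        (by rw [abs_le]; constructor <;> linarith [(abs_le.1 hν).1])
    simp only [neg_apply, proj_circlePoint] at hfw
    linarith
  refine (mem_interior_convexHull_iff_of_line (f := -proj (η / 2))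
      (t := -Real.cos ((φ - η) / 2)) (a := p) (p := b) hps' (by simp [hfp])
      (fun w hw h => hline2 w (by simpa using hball _ hs'sub hw) (by simpa using h))
      (by simp) (by simp) ?_ ?_ (by simpa using hq2)).1 hq'
  · rintro _ (rfl | rfl | rfl)
    · exact hps'
    · exact Or.inl rfl
    · exact Or.inr ⟨_, ⟨by linarith, le_rfl⟩, rfl⟩
  · rintro _ (rfl | ⟨ν, hν, rfl⟩) hfw
    · simp
    · have : Real.cos ((φ - η) / 2) ≤ Real.cos (ν - η / 2) :=
        cos_le_cos_of_abs_le (by linarith)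
          (by rw [abs_le]; constructor <;> linarith [hν.1, hν.2])
      simp only [neg_apply, proj_circlePoint] at hfw
      linarith

/-- Given the point of the arc at angular distance `η` from the first endpoint of the chord, each
remaining point falls beyond one of the two new chords, or in the triangle, where it is never on the
boundary of the hull. -/
theorem hullVol_seg_three (h0 : 0 < η) (h1 : η < φ) (h2 : φ < 2 * Real.pi) (n m : ℕ) :
    hullVol (seg φ 1) {circlePoint 1 (η - φ / 2), circlePoint 1 (-φ / 2), circlePoint 1 (φ / 2)}
      n m =
    ∑ k ∈ Finset.HasAntidiagonal.antidiagonal n, (n.choose k.1 : ℝ≥0∞) *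
      ∑ b ∈ Finset.HasAntidiagonal.antidiagonal m, segVol k.1 b.1 η *
        ∑ l ∈ Finset.HasAntidiagonal.antidiagonal k.2, (k.2.choose l.1 : ℝ≥0∞) *
          (segVol l.1 b.2 (φ - η) *
            ENNReal.ofReal ((Real.sin η + Real.sin (φ - η) - Real.sin φ) / 2) ^ l.2) := by
  set a := circlePoint 1 (-φ / 2)
  set p := circlePoint 1 (η - φ / 2)
  set b := circlePoint 1 (φ / 2)
  set T : Set ℂ := {p, a, b}
  set X₁ := {z : ℂ | ‖z‖ ≤ 1 ∧ Real.cos (η / 2) < proj ((η - φ) / 2) z} with hX₁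
  set X₂ := {z : ℂ | ‖z‖ ≤ 1 ∧ Real.cos ((φ - η) / 2) < proj (η / 2) z} with hX₂
  set Y := seg φ 1 ∩ {w | proj ((η - φ) / 2) w < Real.cos (η / 2)} with hY
  set Z := Y ∩ {w | proj (η / 2) w < Real.cos ((φ - η) / 2)} with hZ
  have ea : a = circlePoint 1 ((η - φ) / 2 - η / 2) := by simp only [a]; ring_nf
  have ep : p = circlePoint 1 ((η - φ) / 2 + η / 2) := by simp only [p]; ring_nf
  have ep' : p = circlePoint 1 (η / 2 - (φ - η) / 2) := by simp only [p]; ring_nf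
  have eb : b = circlePoint 1 (η / 2 + (φ - η) / 2) := by simp only [b]; ring_nf
  have hTC : T ⊆ Metric.closedBall 0 1 := by
    rintro _ (rfl | rfl | rfl) <;> simp [a, p, b, norm_circlePoint]
  have hC : Convex ℝ (Metric.closedBall (0 : ℂ) 1) := convex_closedBall _ _
  have hSC : seg φ 1 ⊆ Metric.closedBall 0 1 := by
    rw [seg_eq (h0.trans h1) h2 one_pos]
    intro z hz; simpa using hz.1
  have hSm : MeasurableSet (seg φ 1) := (isClosed_seg (h0.trans h1) h2 one_pos).measurableSet
  have hYm : MeasurableSet Y := hSm.inter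
    (measurableSet_lt (proj ((η - φ) / 2)).measurable measurable_const)
  have hline1 : ∀ w ∈ Metric.closedBall (0 : ℂ) 1,
      proj ((η - φ) / 2) w = Real.cos (η / 2) → w ∈ segment ℝ a p := fun w hw h => by
    rw [ea, ep]
    exact mem_segment_of_proj (Real.sin_nonneg_of_nonneg_of_le_pi (by linarith) (by linarith))
      (by simpa using hw) h
  have hline2 : ∀ w ∈ Metric.closedBall (0 : ℂ) 1,
      proj (η / 2) w = Real.cos ((φ - η) / 2) → w ∈ segment ℝ p b := fun w hw h => by
    rw [ep', eb]
    exact mem_segment_of_proj (Real.sin_nonneg_of_nonneg_of_le_pi (by linarith) (by linarith))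
      (by simpa using hw) h
  have hfa : proj ((η - φ) / 2) a = Real.cos (η / 2) := by
    rw [ea, proj_circlePoint, ← Real.cos_neg]; ring_nf
  have hfp : proj (η / 2) p = Real.cos ((φ - η) / 2) := by
    rw [ep', proj_circlePoint, ← Real.cos_neg]; ring_nf
  have hf1T : ∀ w ∈ T, proj ((η - φ) / 2) w ≤ Real.cos (η / 2) := by
    rintro _ (rfl | rfl | rfl)
    · rw [ep, proj_circlePoint]; ring_nf; rfl
    · exact hfa.le
    · rw [proj_circlePoint]
      exact cos_le_cos_of_le_abs (by linarith) (by rw [abs_of_nonneg] <;> linarith)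
        (by rw [abs_of_nonneg] <;> linarith)
  have hf2T : ∀ w ∈ T, proj (η / 2) w ≤ Real.cos ((φ - η) / 2) := by
    rintro _ (rfl | rfl | rfl)
    · exact hfp.le
    · rw [proj_circlePoint]
      exact cos_le_cos_of_le_abs (by linarith) (by rw [abs_of_nonpos] <;> linarith)
        (by rw [abs_of_nonpos] <;> linarith)
    · rw [eb, proj_circlePoint]; ring_nf; rfl
  have hcap1 : {z : ℂ | ‖z‖ ≤ 1 ∧ Real.cos (η / 2) ≤ proj ((η - φ) / 2) z} ⊆
      seg φ 1 ∩ {w | proj (η / 2) w ≤ Real.cos ((φ - η) / 2)} := by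
    refine cap_subset_of_convex (by linarith) (by linarith) ((convex_seg φ 1).inter
      (convex_halfSpace_le (proj (η / 2)).toLinearMap.isLinear _)) fun ν hν => ⟨?_, ?_⟩
    · rw [abs_le] at hν
      refine subset_convexHull _ _ ?_
      rw [arc_eq]
      exact ⟨ν, by rw [abs_le]; constructor <;> linarith, rfl⟩
    · rw [abs_le] at hν
      rw [Set.mem_ofPred_eq, proj_circlePoint]
      exact cos_le_cos_of_le_abs (by linarith) (by rw [abs_of_nonpos] <;> linarith)
        (by rw [abs_of_nonpos] <;> linarith)
  have hcap2 : {z : ℂ | ‖z‖ ≤ 1 ∧ Real.cos ((φ - η) / 2) ≤ proj (η / 2) z} ⊆ seg φ 1 := by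
    refine cap_subset_of_convex (by linarith) (by linarith) (convex_seg φ 1) fun ν hν => ?_
    rw [abs_le] at hν
    refine subset_convexHull _ _ ?_
    rw [arc_eq]
    exact ⟨ν, by rw [abs_le]; constructor <;> linarith, rfl⟩
  have hS1 : seg φ 1 ∩ {w | Real.cos (η / 2) < proj ((η - φ) / 2) w} = X₁ := by
    ext w
    exact ⟨fun h => ⟨by simpa using hSC h.1, h.2⟩, fun h => ⟨(hcap1 ⟨h.1, h.2.le⟩).1, h.2⟩⟩
  have hY2 : Y ∩ {w | Real.cos ((φ - η) / 2) < proj (η / 2) w} = X₂ := by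
    ext w
    refine ⟨fun h => ⟨by simpa using hSC h.1.1, h.2⟩, fun h => ⟨⟨hcap2 ⟨h.1, h.2.le⟩, ?_⟩, h.2⟩⟩
    by_contra hge
    exact not_le.2 h.2 (hcap1 ⟨h.1, not_lt.1 hge⟩).2
  have hZae : (openSeg φ ∩ {w | proj ((η - φ) / 2) w < Real.cos (η / 2)} ∩
        {w | proj (η / 2) w < Real.cos ((φ - η) / 2)} : Set ℂ) =ᵐ[volume] Z :=
    ((openSeg_ae_eq_seg (h0.trans h1) h2).inter (ae_eq_refl _)).inter (ae_eq_refl _)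
  have hZvol : volume Z = ENNReal.ofReal ((Real.sin η + Real.sin (φ - η) - Real.sin φ) / 2) := by
    have e1 := volume_eq_add_of_line (proj_ne_zero ((η - φ) / 2)) (Real.cos (η / 2)) hSm
    have e2 := volume_eq_add_of_line (proj_ne_zero (η / 2)) (Real.cos ((φ - η) / 2)) hYm
    rw [hS1, ← hY, e2, hY2, ← hZ, hX₁, hX₂, volume_cap (by linarith) (by linarith),
      volume_cap (by linarith) (by linarith), volume_seg (h0.trans h1) h2,
      mul_div_cancel₀ _ two_ne_zero, mul_div_cancel₀ _ two_ne_zero] at e1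
    have p1 : 0 ≤ (η - Real.sin η) / 2 := by linarith [Real.sin_le h0.le]
    have p2 : 0 ≤ (φ - η - Real.sin (φ - η)) / 2 := by
      linarith [Real.sin_le (sub_nonneg.2 h1.le)]
    rw [← add_assoc, ← ENNReal.ofReal_add p1 p2] at e1
    have e3 := ENNReal.sub_eq_of_eq_add_rev ENNReal.ofReal_ne_top e1
    rw [← e3, ← ENNReal.ofReal_sub _ (add_nonneg p1 p2)]
    congr 1; ring
  have hTf : T.Finite := by simp [T]
  rw [hullVol_split hC hSC hSm hTC hTf (a := a) (p := p) (by simp [T]) (by simp [T]) hfa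
    (proj_ne_zero _) hf1T hline1]
  refine Finset.sum_congr rfl fun k _ => ?_
  congr 1
  refine Finset.sum_congr rfl fun c _ => ?_
  rw [hS1, ← hY]
  congr 1
  · rw [ea, ep, hX₁, hullVol_cap (by linarith) (by linarith), mul_div_cancel₀ _ two_ne_zero]
  · rw [hullVol_split hC (Set.inter_subset_left.trans hSC) hYm hTC hTf (a := p) (p := b)
      (by simp [T]) (by simp [T]) hfp (proj_ne_zero _) hf2T hline2]
    refine Finset.sum_congr rfl fun l _ => ?_
    congr 1
    rw [hY2, ← hZ, Finset.sum_eq_single_of_mem (c.2, 0) (by simp)]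
    · rw [← hullVol_congr hZae, hullVol_of_subset_interior
        (openSeg_inter_subset_interior h0 h1 h2), if_pos rfl, measure_congr hZae, hZvol, ep', eb,
        hX₂, hullVol_cap (by linarith) (by linarith), mul_div_cancel₀ _ two_ne_zero]
    · rintro ⟨i, j⟩ hij hne
      rw [← hullVol_congr hZae, hullVol_of_subset_interior
        (openSeg_inter_subset_interior h0 h1 h2), if_neg, mul_zero]
      rintro rfl
      rw [Finset.HasAntidiagonal.mem_antidiagonal] at hij
      exact hne (Prod.ext hij rfl)

end three

/-! ### Bipolar coordinates on a circular segment -/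

/-- The pairs `(φ, η)` with `0 < η < φ < θ`. -/
def angleDomain (θ : ℝ) : Set (ℝ × ℝ) := {y | 0 < y.2 ∧ y.2 < y.1 ∧ y.1 < θ}

theorem measurableSet_angleDomain (θ : ℝ) : MeasurableSet (angleDomain θ) :=
  (measurableSet_lt measurable_const measurable_snd).inter
    ((measurableSet_lt measurable_snd measurable_fst).inter
      (measurableSet_lt measurable_fst measurable_const))

/-- The point of coordinates `(φ, η)` in the unit circular segment of angle `θ`: it is on the
circular arc of angle `φ` with the same chord, at angular distance `η` from the first endpoint of
the chord. -/
noncomputable def arcCoord (θ : ℝ) (y : ℝ × ℝ) : ℝ × ℝ :=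
  (Real.cos (θ / 2) + Real.sin (θ / 2) *
    ((Real.cos (y.2 - y.1 / 2) - Real.cos (y.1 / 2)) * (Real.sin (y.1 / 2))⁻¹),
   Real.sin (θ / 2) * (Real.sin (y.2 - y.1 / 2) * (Real.sin (y.1 / 2))⁻¹))

/-- The Jacobian matrix of `arcCoord`. -/
noncomputable def arcCoordDeriv (θ : ℝ) (y : ℝ × ℝ) : ℝ × ℝ →L[ℝ] ℝ × ℝ :=
  (Matrix.toLin (.finTwoProd ℝ) (.finTwoProd ℝ)
    !![Real.sin (θ / 2) * ((Real.sin (y.2 - y.1 / 2) + Real.sin (y.1 / 2)) / 2 *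
          (Real.sin (y.1 / 2))⁻¹ - (Real.cos (y.2 - y.1 / 2) - Real.cos (y.1 / 2)) *
          (Real.cos (y.1 / 2) / 2) * (Real.sin (y.1 / 2) ^ 2)⁻¹),
        -(Real.sin (θ / 2) * (Real.sin (y.2 - y.1 / 2) * (Real.sin (y.1 / 2))⁻¹));
      Real.sin (θ / 2) * (-(Real.cos (y.2 - y.1 / 2) / 2) * (Real.sin (y.1 / 2))⁻¹ -
          Real.sin (y.2 - y.1 / 2) * (Real.cos (y.1 / 2) / 2) * (Real.sin (y.1 / 2) ^ 2)⁻¹),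
        Real.sin (θ / 2) * (Real.cos (y.2 - y.1 / 2) * (Real.sin (y.1 / 2))⁻¹)]
    ).toContinuousLinearMap

theorem hasFDerivAt_arcCoord (θ : ℝ) {y : ℝ × ℝ} (hy : Real.sin (y.1 / 2) ≠ 0) :
    HasFDerivAt (arcCoord θ) (arcCoordDeriv θ y) y := by
  unfold arcCoordDeriv
  rw [Matrix.toLin_finTwoProd_toContinuousLinearMap]
  have hu : HasFDerivAt (fun y : ℝ × ℝ => y.1 / 2)
      ((2⁻¹ : ℝ) • ContinuousLinearMap.fst ℝ ℝ ℝ) y := by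
    simpa [div_eq_mul_inv] using (hasFDerivAt_fst (𝕜 := ℝ) (p := y)).mul_const (2⁻¹ : ℝ)
  have hv : HasFDerivAt (fun y : ℝ × ℝ => y.2 - y.1 / 2)
      (ContinuousLinearMap.snd ℝ ℝ ℝ - (2⁻¹ : ℝ) • ContinuousLinearMap.fst ℝ ℝ ℝ) y :=
    hasFDerivAt_snd.sub hu
  have hi := (hasDerivAt_inv hy).comp_hasFDerivAt y hu.sin
  have h1 := (((hv.cos.sub hu.cos).mul hi).const_mul (Real.sin (θ / 2))).const_add
    (Real.cos (θ / 2))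
  have h2 := (hv.sin.mul hi).const_mul (Real.sin (θ / 2))
  refine (h1.prodMk h2).congr_fderiv ?_
  ext <;> simp <;> (try left) <;> field_simp <;> ring

theorem det_arcCoordDeriv (θ : ℝ) {y : ℝ × ℝ} (hy : Real.sin (y.1 / 2) ≠ 0) :
    (arcCoordDeriv θ y).det = Real.sin (θ / 2) ^ 2 *
      (Real.cos (y.2 - y.1 / 2) - Real.cos (y.1 / 2)) / (2 * Real.sin (y.1 / 2) ^ 3) := by
  unfold arcCoordDeriv
  simp only [LinearMap.det_toContinuousLinearMap, LinearMap.det_toLin, Matrix.det_fin_two_of]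
  have hu := Real.sin_sq_add_cos_sq (y.1 / 2)
  have hv := Real.sin_sq_add_cos_sq (y.2 - y.1 / 2)
  generalize Real.sin (y.1 / 2) = su, Real.cos (y.1 / 2) = cu, Real.sin (y.2 - y.1 / 2) = sv,
    Real.cos (y.2 - y.1 / 2) = cv, Real.sin (θ / 2) = s at *
  field_simp
  linear_combination s ^ 2 * cv * hu - s ^ 2 * cu * hv

theorem cos_sub_cos_half (φ η : ℝ) : Real.cos (η - φ / 2) - Real.cos (φ / 2) =
    2 * Real.sin (η / 2) * Real.sin ((φ - η) / 2) := by
  have e1 : η - φ / 2 = η / 2 - (φ - η) / 2 := by ring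
  have e2 : φ / 2 = η / 2 + (φ - η) / 2 := by ring
  rw [e1, e2, Real.cos_sub, Real.cos_add]; ring

/-- The position of a point of the arc of angle `φ` with respect to the unit circle. -/
theorem arcCoord_normSq (θ : ℝ) {y : ℝ × ℝ} (hy : Real.sin (y.1 / 2) ≠ 0) :
    1 - ((arcCoord θ y).1 ^ 2 + (arcCoord θ y).2 ^ 2) =
      2 * ((arcCoord θ y).1 - Real.cos (θ / 2)) *
        (Real.sin ((θ - y.1) / 2) / Real.sin (y.1 / 2)) := by
  have hu := Real.sin_sq_add_cos_sq (y.1 / 2)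
  have hv := Real.sin_sq_add_cos_sq (y.2 - y.1 / 2)
  have ht := Real.sin_sq_add_cos_sq (θ / 2)
  rw [sub_div θ, Real.sin_sub]
  simp only [arcCoord]
  generalize Real.sin (y.1 / 2) = su, Real.cos (y.1 / 2) = cu, Real.sin (y.2 - y.1 / 2) = sv,
    Real.cos (y.2 - y.1 / 2) = cv, Real.sin (θ / 2) = s, Real.cos (θ / 2) = c at *
  field_simp
  linear_combination (-su ^ 2) * ht - s ^ 2 * hv + s ^ 2 * hu

theorem arctan_cot {x : ℝ} (h0 : 0 < x) (h1 : x < Real.pi) :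
    Real.arctan (Real.cos x / Real.sin x) = Real.pi / 2 - x := by
  have : Real.cos x / Real.sin x = Real.tan (Real.pi / 2 - x) := by
    rw [Real.tan_pi_div_two_sub, Real.tan_eq_sin_div_cos, inv_div]
  rw [this, Real.arctan_tan (by linarith) (by linarith)]

section
variable {θ : ℝ} (h0 : 0 < θ) (h1 : θ < 2 * Real.pi)
include h0 h1

theorem sin_half_pos : 0 < Real.sin (θ / 2) :=
  Real.sin_pos_of_pos_of_lt_pi (by linarith) (by linarith)

theorem injOn_arcCoord : Set.InjOn (arcCoord θ) (angleDomain θ) := by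
  have hs := sin_half_pos h0 h1
  -- the angles at the two endpoints of the chord are recovered from their cotangents
  let g : ℝ × ℝ → ℝ × ℝ := fun x =>
    (2 * Real.pi -
      2 * Real.arctan ((Real.sin (θ / 2) - x.2) / (x.1 - Real.cos (θ / 2))) -
      2 * Real.arctan ((Real.sin (θ / 2) + x.2) / (x.1 - Real.cos (θ / 2))),
     Real.pi - 2 * Real.arctan ((Real.sin (θ / 2) - x.2) / (x.1 - Real.cos (θ / 2))))
  refine Set.LeftInvOn.injOn (f₁' := g) ?_
  rintro ⟨φ, η⟩ ⟨hη, hηφ, hφ⟩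
  simp only at hη hηφ hφ
  have hα := Real.sin_pos_of_pos_of_lt_pi (x := η / 2) (by linarith) (by linarith)
  have hβ := Real.sin_pos_of_pos_of_lt_pi (x := (φ - η) / 2) (by linarith) (by linarith)
  have hu := Real.sin_pos_of_pos_of_lt_pi (x := φ / 2) (by linarith) (by linarith)
  have e1 : η - φ / 2 = η / 2 - (φ - η) / 2 := by ring
  have e2 : φ / 2 = η / 2 + (φ - η) / 2 := by ring
  have hA : (Real.sin (θ / 2) - (arcCoord θ (φ, η)).2) /
      ((arcCoord θ (φ, η)).1 - Real.cos (θ / 2)) = Real.cos (η / 2) / Real.sin (η / 2) := by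
    simp only [arcCoord, cos_sub_cos_half, add_sub_cancel_left]
    rw [e1, Real.sin_sub]
    field_simp
    rw [e2, Real.sin_add]
    ring
  have hB : (Real.sin (θ / 2) + (arcCoord θ (φ, η)).2) /
      ((arcCoord θ (φ, η)).1 - Real.cos (θ / 2)) =
      Real.cos ((φ - η) / 2) / Real.sin ((φ - η) / 2) := by
    simp only [arcCoord, cos_sub_cos_half, add_sub_cancel_left]
    rw [e1, Real.sin_sub]
    field_simp
    rw [e2, Real.sin_add]
    ring
  simp only [g]
  rw [hA, hB, arctan_cot (by linarith) (by linarith), arctan_cot (by linarith) (by linarith)]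
  refine Prod.ext ?_ ?_ <;> simp only <;> ring

theorem image_arcCoord : arcCoord θ '' angleDomain θ =
    {x | x.1 ^ 2 + x.2 ^ 2 < 1 ∧ Real.cos (θ / 2) < x.1} := by
  have hs := sin_half_pos h0 h1
  ext ⟨x, y⟩
  constructor
  · rintro ⟨⟨φ, η⟩, ⟨hη, hηφ, hφ⟩, e⟩
    simp only at hη hηφ hφ
    have hα := Real.sin_pos_of_pos_of_lt_pi (x := η / 2) (by linarith) (by linarith)
    have hβ := Real.sin_pos_of_pos_of_lt_pi (x := (φ - η) / 2) (by linarith) (by linarith)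
    have hu := Real.sin_pos_of_pos_of_lt_pi (x := φ / 2) (by linarith) (by linarith)
    have hd := Real.sin_pos_of_pos_of_lt_pi (x := (θ - φ) / 2) (by linarith) (by linarith)
    have hX : 0 < (arcCoord θ (φ, η)).1 - Real.cos (θ / 2) := by
      simp only [arcCoord, cos_sub_cos_half, add_sub_cancel_left]
      positivity
    have := arcCoord_normSq θ (y := (φ, η)) hu.ne'
    rw [← e]
    refine ⟨?_, by linarith⟩
    have h3 : 0 < 2 * ((arcCoord θ (φ, η)).1 - Real.cos (θ / 2)) *
        (Real.sin ((θ - φ) / 2) / Real.sin (φ / 2)) := by positivity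
    simp only at this
    linarith
  · rintro ⟨hxy, hx⟩
    simp only at hxy hx
    set s := Real.sin (θ / 2) with hsdef
    set c := Real.cos (θ / 2) with hcdef
    have hX : 0 < x - c := by linarith
    set A := (s - y) / (x - c) with hA
    set B := (s + y) / (x - c) with hB
    set α := Real.pi / 2 - Real.arctan A with hα
    set β := Real.pi / 2 - Real.arctan B with hβ
    have hα0 : 0 < α := by linarith [Real.arctan_lt_pi_div_two A]
    have hα1 : α < Real.pi := by linarith [Real.neg_pi_div_two_lt_arctan A]
    have hβ0 : 0 < β := by linarith [Real.arctan_lt_pi_div_two B]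
    have hβ1 : β < Real.pi := by linarith [Real.neg_pi_div_two_lt_arctan B]
    have sα := Real.sin_pos_of_pos_of_lt_pi hα0 hα1
    have sβ := Real.sin_pos_of_pos_of_lt_pi hβ0 hβ1
    have cα : Real.cos α = A * Real.sin α := by
      rw [hα, Real.cos_pi_div_two_sub, Real.sin_pi_div_two_sub]
      have := Real.tan_mul_cos (Real.cos_arctan_pos A).ne'
      rw [Real.tan_arctan] at this
      exact this.symm
    have cβ : Real.cos β = B * Real.sin β := by
      rw [hβ, Real.cos_pi_div_two_sub, Real.sin_pi_div_two_sub]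
      have := Real.tan_mul_cos (Real.cos_arctan_pos B).ne'
      rw [Real.tan_arctan] at this
      exact this.symm
    have hAX : A * (x - c) = s - y := div_mul_cancel₀ _ hX.ne'
    have hBX : B * (x - c) = s + y := div_mul_cancel₀ _ hX.ne'
    have hsum : Real.sin (α + β) * (x - c) = 2 * s * (Real.sin α * Real.sin β) := by
      rw [Real.sin_add, cα, cβ]
      linear_combination Real.sin α * Real.sin β * (hAX + hBX)
    have hsin : 0 < Real.sin (α + β) := by
      have : 0 < Real.sin (α + β) * (x - c) := by rw [hsum]; positivity
      exact (pos_iff_pos_of_mul_pos this).2 hX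
    have hsq : s ^ 2 + c ^ 2 = 1 := Real.sin_sq_add_cos_sq _
    have hdiff : Real.sin (θ / 2 - (α + β)) * (x - c) ^ 2 =
        Real.sin α * Real.sin β * s * (1 - (x ^ 2 + y ^ 2)) := by
      rw [Real.sin_sub, Real.cos_add, Real.sin_add, ← hsdef, ← hcdef, cα, cβ]
      have : A * B * (x - c) ^ 2 = s ^ 2 - y ^ 2 := by
        linear_combination B * (x - c) * hAX + (s - y) * hBX
      linear_combination s * Real.sin α * Real.sin β * this
        - c * (x - c) * Real.sin α * Real.sin β * (hAX + hBX) + s * Real.sin α * Real.sin β * hsq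
    have hdpos : 0 < Real.sin (θ / 2 - (α + β)) := by
      have h3 : 0 < Real.sin (θ / 2 - (α + β)) * (x - c) ^ 2 := by
        rw [hdiff]
        have : 0 < 1 - (x ^ 2 + y ^ 2) := by linarith
        positivity
      exact (pos_iff_pos_of_mul_pos h3).2 (by positivity)
    have hαβ : α + β < Real.pi := by
      by_contra! h
      have := Real.sin_nonneg_of_nonneg_of_le_pi (x := α + β - Real.pi) (by linarith) (by linarith)
      rw [Real.sin_sub_pi] at this
      linarith
    have hlt : α + β < θ / 2 := by
      by_contra! h
      have := Real.sin_nonpos_of_nonpos_of_neg_pi_le (x := θ / 2 - (α + β)) (by linarith)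
        (by linarith)
      linarith
    refine ⟨(2 * (α + β), 2 * α), ⟨by simp only; linarith, by simp only; linarith,
      by simp only; linarith⟩, ?_⟩
    have e1 : 2 * (α + β) / 2 = α + β := by ring
    have e2 : 2 * α - (α + β) = α - β := by ring
    simp only [arcCoord, e1, e2, ← hsdef, ← hcdef]
    refine Prod.ext ?_ ?_
    · simp only
      rw [Real.cos_sub, Real.cos_add]
      field_simp
      linear_combination -hsum
    · simp only
      rw [Real.sin_sub, cα, cβ]
      field_simp
      rw [Real.sin_add, cα, cβ]
      have h5 : s * (A - B) = y * (A + B) * (-1) := by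
        have : (s * (A - B)) * (x - c) = (y * (A + B) * (-1)) * (x - c) := by
          linear_combination (s + y) * hAX - (s - y) * hBX
        exact mul_right_cancel₀ hX.ne' this
      linear_combination (-Real.sin α * Real.sin β) * h5

/-- Integration over a circular segment in the coordinates `arcCoord`. -/
theorem lintegral_openSeg (g : ℂ → ℝ≥0∞) :
    ∫⁻ x in openSeg θ, g x = ∫⁻ y in angleDomain θ,
      ENNReal.ofReal (Real.sin (θ / 2) ^ 2 / Real.sin (y.1 / 2) ^ 3 *
        (Real.sin (y.2 / 2) * Real.sin ((y.1 - y.2) / 2))) *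
      g ⟨(arcCoord θ y).1, (arcCoord θ y).2⟩ := by
  have hm := measurableSet_angleDomain θ
  have hsin : ∀ y ∈ angleDomain θ, 0 < Real.sin (y.1 / 2) := fun y hy =>
    Real.sin_pos_of_pos_of_lt_pi (by linarith [hy.1, hy.2.1]) (by linarith [hy.2.2])
  have hpre : openSeg θ = Complex.measurableEquivRealProd ⁻¹' (arcCoord θ '' angleDomain θ) := by
    rw [image_arcCoord h0 h1]
    ext z
    simp [openSeg, norm_lt_iff_sq zero_le_one]
  have e := Complex.volume_preserving_equiv_real_prod.setLIntegral_comp_preimage_emb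
    Complex.measurableEquivRealProd.measurableEmbedding
    (fun x : ℝ × ℝ => g ⟨x.1, x.2⟩) (arcCoord θ '' angleDomain θ)
  rw [← hpre] at e
  have e' : ∫⁻ x in openSeg θ, g x = ∫⁻ (x : ℝ × ℝ) in arcCoord θ '' angleDomain θ, g ⟨x.1, x.2⟩ :=
    e
  rw [e', lintegral_image_eq_lintegral_abs_det_fderiv_mul volume hm
    (fun y hy => (hasFDerivAt_arcCoord θ (hsin y hy).ne').hasFDerivWithinAt)
    (injOn_arcCoord h0 h1)]
  refine setLIntegral_congr_fun hm fun y hy => ?_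
  have hs := sin_half_pos h0 h1
  have hu := hsin y hy
  have hα := Real.sin_pos_of_pos_of_lt_pi (x := y.2 / 2) (by linarith [hy.1])
    (by linarith [hy.2.1, hy.2.2])
  have hβ := Real.sin_pos_of_pos_of_lt_pi (x := (y.1 - y.2) / 2) (by linarith [hy.2.1])
    (by linarith [hy.1, hy.2.2])
  congr 2
  rw [det_arcCoordDeriv θ hu.ne', cos_sub_cos_half, abs_of_nonneg (by positivity)]
  field_simp

end

/-! ### Conditioning on the point of largest arc angle -/

/-- The key ordering the points of the unit circular segment of angle `θ`: its level sets are the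
circular arcs with the same chord, and it increases with the angle of the arc. -/
noncomputable def arcKey (θ : ℝ) (z : ℂ) : ℝ := (‖z‖ ^ 2 - 1) / (2 * (z.re - Real.cos (θ / 2)))

theorem measurable_arcKey (θ : ℝ) : Measurable (arcKey θ) := by
  unfold arcKey
  exact ((measurable_norm.pow_const 2).sub_const 1).div
    ((Complex.measurable_re.sub_const _).const_mul 2)

theorem sq_norm_eq (z : ℂ) : ‖z‖ ^ 2 = z.re ^ 2 + z.im ^ 2 := by
  rw [Complex.sq_norm, Complex.normSq_apply, sq, sq]

theorem volume_arcKey_eq (θ c : ℝ) : volume (openSeg θ ∩ {z | arcKey θ z = c}) = 0 := by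
  refine measure_mono_null (t := Metric.sphere (c : ℂ) √(1 - 2 * c * Real.cos (θ / 2) + c ^ 2))
    ?_ (Measure.addHaar_sphere _ _ _)
  rintro z ⟨⟨_, hz⟩, hk⟩
  have hX : 2 * (z.re - Real.cos (θ / 2)) ≠ 0 := by
    have : 0 < z.re - Real.cos (θ / 2) := by linarith
    positivity
  rw [Set.mem_ofPred_eq, arcKey, div_eq_iff hX, sq_norm_eq] at hk
  rw [mem_sphere_iff_norm, ← Real.sqrt_sq (norm_nonneg _), sq_norm_eq]
  congr 1
  simp only [Complex.sub_re, Complex.ofReal_re, Complex.sub_im, Complex.ofReal_im]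
  linarith

section
variable {θ : ℝ}

/-- The similarity that maps the unit circular segment of angle `φ` to the one with the same arc
angle and the chord of the unit circular segment of angle `θ`. -/
noncomputable def rescale (θ φ : ℝ) (w : ℂ) : ℂ :=
  ((Real.sin (θ / 2) / Real.sin (φ / 2) : ℝ) : ℂ) * w +
    ((Real.cos (θ / 2) - Real.sin (θ / 2) / Real.sin (φ / 2) * Real.cos (φ / 2) : ℝ) : ℂ)

theorem rescale_re (θ φ : ℝ) (w : ℂ) : (rescale θ φ w).re =
    Real.cos (θ / 2) + Real.sin (θ / 2) / Real.sin (φ / 2) * (w.re - Real.cos (φ / 2)) := by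
  rw [rescale, Complex.add_re, Complex.re_ofReal_mul, Complex.ofReal_re]; ring

theorem rescale_im (θ φ : ℝ) (w : ℂ) :
    (rescale θ φ w).im = Real.sin (θ / 2) / Real.sin (φ / 2) * w.im := by
  rw [rescale, Complex.add_im, Complex.im_ofReal_mul, Complex.ofReal_im, add_zero]

theorem rescale_circlePoint (θ : ℝ) (y : ℝ × ℝ) :
    rescale θ y.1 (circlePoint 1 (y.2 - y.1 / 2)) = ⟨(arcCoord θ y).1, (arcCoord θ y).2⟩ := by
  apply Complex.ext
  · rw [rescale_re, circlePoint_re]; simp only [arcCoord]; ring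
  · rw [rescale_im, circlePoint_im]; simp only [arcCoord]; ring

theorem rescale_endpoint {φ : ℝ} (hφ : Real.sin (φ / 2) ≠ 0) :
    rescale θ φ (circlePoint 1 (φ / 2)) = circlePoint 1 (θ / 2) ∧
    rescale θ φ (circlePoint 1 (-φ / 2)) = circlePoint 1 (-θ / 2) := by
  constructor <;> apply Complex.ext <;>
    simp only [rescale_re, rescale_im, circlePoint_re, circlePoint_im, neg_div, Real.cos_neg,
      Real.sin_neg] <;> field_simp <;> ring

theorem sq_norm_rescale {φ : ℝ} (hφ : Real.sin (φ / 2) ≠ 0) (w : ℂ) :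
    ‖rescale θ φ w‖ ^ 2 - 1 = (Real.sin (θ / 2) / Real.sin (φ / 2)) ^ 2 * (‖w‖ ^ 2 - 1) -
      2 * ((rescale θ φ w).re - Real.cos (θ / 2)) *
        (Real.sin ((θ - φ) / 2) / Real.sin (φ / 2)) := by
  have hu := Real.sin_sq_add_cos_sq (φ / 2)
  have ht := Real.sin_sq_add_cos_sq (θ / 2)
  rw [sq_norm_eq, sq_norm_eq, rescale_re, rescale_im, sub_div θ, Real.sin_sub]
  generalize Real.sin (φ / 2) = su, Real.cos (φ / 2) = cu, Real.sin (θ / 2) = s,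
    Real.cos (θ / 2) = c at *
  field_simp
  linear_combination su ^ 2 * ht - s ^ 2 * hu

variable (h0 : 0 < θ) (h1 : θ < 2 * Real.pi)
include h0 h1

theorem rescale_image_openSeg {y : ℝ × ℝ} (hy : y ∈ angleDomain θ) :
    openSeg θ ∩ {z | arcKey θ z < arcKey θ (rescale θ y.1 (circlePoint 1 (y.2 - y.1 / 2)))} =
      rescale θ y.1 '' openSeg y.1 := by
  obtain ⟨φ, η⟩ := y
  obtain ⟨hη, hηφ, hφ⟩ := hy
  simp only at hη hηφ hφ
  simp only
  have hs := sin_half_pos h0 h1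
  have hu := sin_half_pos (θ := φ) (by linarith) (by linarith)
  have hK : 0 < Real.sin ((θ - φ) / 2) / Real.sin (φ / 2) :=
    div_pos (Real.sin_pos_of_pos_of_lt_pi (by linarith) (by linarith)) hu
  have hl : 0 < Real.sin (θ / 2) / Real.sin (φ / 2) := div_pos hs hu
  have hp : arcKey θ (rescale θ φ (circlePoint 1 (η - φ / 2))) =
      -(Real.sin ((θ - φ) / 2) / Real.sin (φ / 2)) := by
    have hX : 0 < (rescale θ φ (circlePoint 1 (η - φ / 2))).re - Real.cos (θ / 2) := by
      rw [rescale_re, add_sub_cancel_left, circlePoint_re, one_mul, cos_sub_cos_half]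
      have hα := Real.sin_pos_of_pos_of_lt_pi (x := η / 2) (by linarith) (by linarith)
      have hβ := Real.sin_pos_of_pos_of_lt_pi (x := (φ - η) / 2) (by linarith) (by linarith)
      positivity
    rw [arcKey, sq_norm_rescale hu.ne', norm_circlePoint zero_le_one,
      div_eq_iff (by positivity)]
    ring
  rw [hp]
  have key : ∀ w, rescale θ φ w ∈ openSeg θ ∩
      {z | arcKey θ z < -(Real.sin ((θ - φ) / 2) / Real.sin (φ / 2))} ↔ w ∈ openSeg φ := by
    intro w
    have e1 : Real.cos (θ / 2) < (rescale θ φ w).re ↔ Real.cos (φ / 2) < w.re := by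
      rw [rescale_re, lt_add_iff_pos_right, mul_pos_iff_of_pos_left hl, sub_pos]
    simp only [openSeg, Set.mem_inter_iff, Set.mem_ofPred_eq, e1]
    have aux : ∀ v : ℂ, ‖v‖ < 1 ↔ ‖v‖ ^ 2 - 1 < 0 := fun v => by
      rw [← sq_lt_sq₀ (norm_nonneg v) zero_le_one, one_pow, sub_neg]
    by_cases hw : Real.cos (φ / 2) < w.re
    · have hX : 0 < (rescale θ φ w).re - Real.cos (θ / 2) := sub_pos.2 (e1.2 hw)
      have e2 : arcKey θ (rescale θ φ w) < -(Real.sin ((θ - φ) / 2) / Real.sin (φ / 2)) ↔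
          ‖w‖ < 1 := by
        rw [arcKey, div_lt_iff₀ (by positivity), sq_norm_rescale hu.ne', aux, sub_lt_iff_lt_add]
        have : -(Real.sin ((θ - φ) / 2) / Real.sin (φ / 2)) *
            (2 * ((rescale θ φ w).re - Real.cos (θ / 2))) +
            2 * ((rescale θ φ w).re - Real.cos (θ / 2)) *
              (Real.sin ((θ - φ) / 2) / Real.sin (φ / 2)) = 0 := by ring
        rw [this, mul_neg_iff]
        have : 0 < (Real.sin (θ / 2) / Real.sin (φ / 2)) ^ 2 := by positivity
        constructor
        · rintro (h | h)
          · exact h.2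
          · linarith [h.1]
        · exact fun h => Or.inl ⟨this, h⟩
      rw [e2]
      refine ⟨fun h => ⟨h.2, hw⟩, fun h => ⟨⟨?_, hw⟩, h.1⟩⟩
      rw [aux, sq_norm_rescale hu.ne']
      have h3 := (aux w).1 h.1
      have h4 : (Real.sin (θ / 2) / Real.sin (φ / 2)) ^ 2 * (‖w‖ ^ 2 - 1) < 0 :=
        mul_neg_of_pos_of_neg (by positivity) h3
      have h5 : 0 < 2 * ((rescale θ φ w).re - Real.cos (θ / 2)) *
        (Real.sin ((θ - φ) / 2) / Real.sin (φ / 2)) := by positivity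
      linarith
    · simp [hw]
  ext z
  have hl' : ((Real.sin (θ / 2) / Real.sin (φ / 2) : ℝ) : ℂ) ≠ 0 := by exact_mod_cast hl.ne'
  constructor
  · intro hz
    obtain ⟨w, rfl⟩ : ∃ w, z = rescale θ φ w :=
      ⟨(z - ((Real.cos (θ / 2) - Real.sin (θ / 2) / Real.sin (φ / 2) * Real.cos (φ / 2) : ℝ) : ℂ)) /
        ((Real.sin (θ / 2) / Real.sin (φ / 2) : ℝ) : ℂ), by
          rw [rescale, mul_div_cancel₀ _ hl', sub_add_cancel]⟩
    exact ⟨w, (key w).1 hz, rfl⟩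
  · rintro ⟨w, hw, rfl⟩
    exact (key w).2 hw

/-- The first point being on the arc of angle `φ`, it is on the boundary of the hull, and the other
points are in the segment of angle `φ`, which is then brought back to the unit disk. -/
theorem volume_cons_arcCoord {y : ℝ × ℝ} (hy : y ∈ angleDomain θ) (n m : ℕ) :
    volume {z : Fin n → ℂ | (∀ j, z j ∈ openSeg θ ∩
        {w | arcKey θ w < arcKey θ ⟨(arcCoord θ y).1, (arcCoord θ y).2⟩}) ∧
      outer {circlePoint 1 (-θ / 2), circlePoint 1 (θ / 2)}
        (Fin.cons ⟨(arcCoord θ y).1, (arcCoord θ y).2⟩ z : Fin (n + 1) → ℂ) = m} =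
    if m = 0 then 0 else
      ENNReal.ofReal ((Real.sin (θ / 2) / Real.sin (y.1 / 2)) ^ (2 * n)) *
        hullVol (seg y.1 1) {circlePoint 1 (y.2 - y.1 / 2), circlePoint 1 (-y.1 / 2),
          circlePoint 1 (y.1 / 2)} n (m - 1) := by
  rw [← rescale_circlePoint, rescale_image_openSeg h0 h1 hy]
  obtain ⟨φ, η⟩ := y
  obtain ⟨hη, hηφ, hφ⟩ := hy
  simp only at hη hηφ hφ
  simp only
  have hs := sin_half_pos h0 h1
  have hu := sin_half_pos (θ := φ) (by linarith) (by linarith)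
  have hl : 0 < Real.sin (θ / 2) / Real.sin (φ / 2) := div_pos hs hu
  have hl' : ((Real.sin (θ / 2) / Real.sin (φ / 2) : ℝ) : ℂ) ≠ 0 := by exact_mod_cast hl.ne'
  set p := circlePoint 1 (η - φ / 2)
  set T : Set ℂ := {circlePoint 1 (-φ / 2), circlePoint 1 (φ / 2)} with hT
  have hTim : ({circlePoint 1 (-θ / 2), circlePoint 1 (θ / 2)} : Set ℂ) = rescale θ φ '' T := by
    rw [hT, Set.image_pair, (rescale_endpoint hu.ne').1, (rescale_endpoint hu.ne').2]
  have hcons : ∀ w : Fin n → ℂ, (∀ j, w j ∈ openSeg φ) →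
      outer (rescale θ φ '' T)
        (Fin.cons (rescale θ φ p) (fun j => rescale θ φ (w j)) : Fin (n + 1) → ℂ) =
      outer (insert p T) w + 1 := by
    intro w hw
    have e : (Fin.cons (rescale θ φ p) (fun j => rescale θ φ (w j)) : Fin (n + 1) → ℂ) =
        fun i => rescale θ φ ((Fin.cons p w : Fin (n + 1) → ℂ) i) := by
      ext i; refine Fin.cases ?_ (fun j => ?_) i <;> simp
    rw [e]
    unfold rescale
    rw [outer_similarity hl']
    refine outer_cons T p w fun hp => ?_
    have hsub : convexHull ℝ (T ∪ Set.range (Fin.cons p w : Fin (n + 1) → ℂ)) ⊆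
        Metric.closedBall 0 1 := by
      refine convexHull_min ?_ (convex_closedBall _ _)
      rw [Fin.range_cons]
      rintro v (hv | rfl | ⟨j, rfl⟩)
      · rcases hv with rfl | rfl <;> simp [norm_circlePoint]
      · simp [p, norm_circlePoint]
      · simpa using (hw j).1.le
    have := interior_mono hsub hp
    rw [interior_closedBall _ one_ne_zero] at this
    simp [p, norm_circlePoint] at this
  have hset : ∀ k, {z : Fin n → ℂ | (∀ j, z j ∈ rescale θ φ '' openSeg φ) ∧
      outer (rescale θ φ '' T) (Fin.cons (rescale θ φ p) z : Fin (n + 1) → ℂ) = k} =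
      {z : Fin n → ℂ | (∀ j, z j ∈ rescale θ φ '' openSeg φ) ∧
        outer (rescale θ φ '' insert p T) z + 1 = k} := by
    intro k
    ext z
    simp only [Set.mem_ofPred_eq]
    refine and_congr_right fun hz => ?_
    choose w hw hwz using hz
    obtain rfl : (fun j => rescale θ φ (w j)) = z := funext hwz
    rw [hcons w hw]
    unfold rescale
    rw [outer_similarity hl']
  rw [hTim, hset]
  split_ifs with hm
  · subst hm
    have : {z : Fin n → ℂ | (∀ j, z j ∈ rescale θ φ '' openSeg φ) ∧
        outer (rescale θ φ '' insert p T) z + 1 = 0} = ∅ := by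
      ext z; simp
    rw [this, measure_empty]
  · obtain ⟨k, rfl⟩ := Nat.exists_eq_succ_of_ne_zero hm
    simp only [Nat.succ_eq_add_one, add_left_inj, Nat.add_sub_cancel]
    have hins : ({p, circlePoint 1 (-φ / 2), circlePoint 1 (φ / 2)} : Set ℂ) = insert p T := rfl
    have := hullVol_similarity hl'
      ((Real.cos (θ / 2) - Real.sin (θ / 2) / Real.sin (φ / 2) * Real.cos (φ / 2) : ℝ) : ℂ)
      (isOpen_openSeg φ).measurableSet (T := insert p T) (by simp [T]) n k
    rw [Complex.norm_real, Real.norm_of_nonneg hl.le,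
      hullVol_congr (openSeg_ae_eq_seg (by linarith) (by linarith)) (insert p T)] at this
    rw [hins, ← this]
    rfl

/-- Disintegration with respect to the point of largest `arcKey`. -/
theorem segVol_succ_eq_lintegral (n m : ℕ) :
    segVol (n + 1) m θ = (n + 1) * ∫⁻ y in angleDomain θ,
      ENNReal.ofReal (Real.sin (θ / 2) ^ 2 / Real.sin (y.1 / 2) ^ 3 *
        (Real.sin (y.2 / 2) * Real.sin ((y.1 - y.2) / 2))) *
      if m = 0 then 0 else
      ENNReal.ofReal ((Real.sin (θ / 2) / Real.sin (y.1 / 2)) ^ (2 * n)) *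
        hullVol (seg y.1 1) {circlePoint 1 (y.2 - y.1 / 2), circlePoint 1 (-y.1 / 2),
          circlePoint 1 (y.1 / 2)} n (m - 1) := by
  rw [segVol, ← hullVol_congr (openSeg_ae_eq_seg h0 h1),
    hullVol_succ_eq_lintegral (isOpen_openSeg θ).measurableSet (by simp) (measurable_arcKey θ)
      (volume_arcKey_eq θ), lintegral_openSeg h0 h1]
  congr 1
  refine setLIntegral_congr_fun (measurableSet_angleDomain θ) fun y hy => ?_
  simp only [volume_cons_arcCoord h0 h1 hy]

theorem segVol_succ_zero (n : ℕ) : segVol (n + 1) 0 θ = 0 := by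
  rw [segVol_succ_eq_lintegral h0 h1]; simp

end

/-! ### Probabilities as volumes -/

theorem mem_CP_iff {n m : ℕ} (x : Fin n → ℂ) : x ∈ CP n m ↔ outer ∅ x = m := by
  have : {i : Fin n | x i ∈ frontier (convexHull ℝ (Set.range x))} =
      {i | x i ∉ interior (convexHull ℝ (∅ ∪ Set.range x))} := by
    ext i
    rw [Set.empty_union]
    exact mem_frontier_convexHull_iff ⟨i, rfl⟩
  rw [CP, Set.mem_ofPred_eq, this, outer]

theorem unifLaw_apply {H : Set ℂ} (hH : MeasurableSet H) (h0 : volume H ≠ 0) (ht : volume H ≠ ∞)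
    (n : ℕ) (A : Set (Fin n → ℂ)) :
    unifLaw H n A = (volume H)⁻¹ ^ n * volume {z : Fin n → ℂ | (∀ i, z i ∈ H) ∧ z ∈ A} := by
  have := ProbabilityTheory.cond_isProbabilityMeasure_of_finite h0 ht
  have hpi : MeasurableSet (Set.univ.pi fun _ : Fin n => H) :=
    MeasurableSet.univ_pi fun _ => hH
  have e : unifLaw H n = (volume H)⁻¹ ^ n •
      (volume : Measure (Fin n → ℂ)).restrict (Set.univ.pi fun _ => H) := by
    refine Measure.pi_eq fun s hs => ?_
    rw [Measure.smul_apply, Measure.restrict_apply (MeasurableSet.univ_pi hs),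
      ← Set.pi_inter_distrib,
      volume_pi_pi]
    simp only [ProbabilityTheory.cond_apply hH, Finset.prod_mul_distrib, Finset.prod_const,
      Finset.card_univ, Fintype.card_fin, smul_eq_mul, Set.inter_comm H]
  rw [e, Measure.smul_apply, Measure.restrict_apply' hpi, smul_eq_mul]
  congr 2
  ext z
  simp [and_comm]

section
variable {θ R : ℝ}

theorem outer_bipointed (h0 : 0 < θ) (h1 : θ < 2 * Real.pi) (hR : 0 < R) {n m : ℕ} {z : Fin n → ℂ}
    (hz : ∀ i, z i ∈ seg θ R) : bipointed θ R z ∈ CP (n + 2) (m + 2) ↔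
      outer {circlePoint R (-θ / 2), circlePoint R (θ / 2)} z = m := by
  have hball : ∀ s : Set ℂ, s ⊆ Metric.closedBall 0 R → ∀ ν,
      circlePoint R ν ∉ interior (convexHull ℝ s) := by
    intro s hs ν hν
    have := interior_mono (convexHull_min hs (convex_closedBall _ _)) hν
    rw [interior_closedBall _ hR.ne'] at this
    simp [norm_circlePoint hR.le] at this
  have hz' : ∀ i, z i ∈ Metric.closedBall 0 R := fun i => by
    have := hz i
    rw [seg_eq h0 h1 hR] at this
    simpa using this.1
  have hc : ∀ ν, circlePoint R ν ∈ Metric.closedBall 0 R := fun ν => by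
    simp [norm_circlePoint hR.le]
  rw [mem_CP_iff, bipointed, outer_cons, outer_cons]
  · rw [insert_empty_eq, Set.pair_comm, add_assoc, Nat.add_right_cancel_iff]
  · refine hball _ ?_ _
    rw [Fin.range_cons]
    rintro _ ((rfl | h) | rfl | ⟨i, rfl⟩)
    exacts [hc _, h.elim, hc _, hz' i]
  · refine hball _ ?_ _
    rw [Fin.range_cons, Fin.range_cons]
    rintro _ (h | rfl | rfl | ⟨i, rfl⟩)
    exacts [h.elim, hc _, hc _, hz' i]

theorem volume_seg_ne_zero (h0 : 0 < θ) (h1 : θ < 2 * Real.pi) : volume (seg θ 1) ≠ 0 := by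
  rw [volume_seg h0 h1, ne_eq, ENNReal.ofReal_eq_zero, not_le]
  linarith [Real.sin_lt h0]

theorem volume_seg_ne_top (h0 : 0 < θ) (h1 : θ < 2 * Real.pi) : volume (seg θ 1) ≠ ∞ := by
  rw [volume_seg h0 h1]; exact ENNReal.ofReal_ne_top

open scoped Pointwise in
theorem B_eq (h0 : 0 < θ) (h1 : θ < 2 * Real.pi) (hR : 0 < R) (n m : ℕ) :
    B R n m θ = (segVol n m θ).toReal / ((θ - Real.sin θ) / 2) ^ n := by
  have hR' : (R : ℂ) ≠ 0 := by exact_mod_cast hR.ne'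
  have hv : volume (seg θ R) = ENNReal.ofReal (R ^ 2) * volume (seg θ 1) := by
    have : seg θ R = R • seg θ 1 := by
      rw [seg_scale θ (R := R), ← Set.image_smul]
      congr 1; ext w; simp
    rw [this, Measure.addHaar_smul]; simp
  have hm := (isClosed_seg h0 h1 one_pos).measurableSet
  have hp : 0 < (θ - Real.sin θ) / 2 := by linarith [Real.sin_lt h0]
  have hv0 : volume (seg θ R) ≠ 0 := by
    rw [hv]
    exact mul_ne_zero (by rw [ne_eq, ENNReal.ofReal_eq_zero, not_le]; positivity)
      (volume_seg_ne_zero h0 h1)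
  have hvt : volume (seg θ R) ≠ ∞ := by
    rw [hv]; exact ENNReal.mul_ne_top ENNReal.ofReal_ne_top (volume_seg_ne_top h0 h1)
  have hset : {z : Fin n → ℂ | (∀ i, z i ∈ seg θ R) ∧
      z ∈ {z : Fin n → ℂ | bipointed θ R z ∈ CP (n + 2) (m + 2)}} =
      {z : Fin n → ℂ | (∀ i, z i ∈ seg θ R) ∧
        outer {circlePoint R (-θ / 2), circlePoint R (θ / 2)} z = m} := by
    ext z
    exact and_congr_right fun hz => outer_bipointed h0 h1 hR hz
  have hT : ({circlePoint R (-θ / 2), circlePoint R (θ / 2)} : Set ℂ) =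
      (fun w : ℂ => (R : ℂ) * w + 0) '' {circlePoint 1 (-θ / 2), circlePoint 1 (θ / 2)} := by
    rw [Set.image_pair]; simp [circlePoint]
  rw [B, measureReal_def, unifLaw_apply (isClosed_seg h0 h1 hR).measurableSet hv0 hvt, hset,
    ← hullVol, hT, seg_scale θ (R := R), hullVol_similarity hR' 0 hm (by simp), ← segVol,
    ← seg_scale θ (R := R), hv, volume_seg h0 h1, Complex.norm_real, Real.norm_of_nonneg hR.le]
  simp only [ENNReal.toReal_mul, ENNReal.toReal_pow, ENNReal.toReal_inv]
  rw [ENNReal.toReal_ofReal (by positivity), ENNReal.toReal_ofReal hp.le,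
    ENNReal.toReal_ofReal (by positivity), pow_mul]
  have := hp.ne'
  generalize (θ - Real.sin θ) / 2 = v at *
  rw [inv_pow, mul_pow]
  field_simp

theorem L_eq (h0 : 0 < θ) (h1 : θ < 2 * Real.pi) (hR : 0 < R) (n m : ℕ) :
    L R n m θ = (segVol n m θ).toReal * 2 ^ n * Real.sin (θ / 2) / (n.factorial : ℝ) := by
  have hp : θ - Real.sin θ ≠ 0 := by linarith [Real.sin_lt h0]
  rw [L, B_eq h0 h1 hR, div_pow]
  field_simp

theorem segVol_ne_top_and_le (h0 : 0 < θ) (h1 : θ < 2 * Real.pi) (n m : ℕ) :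
    segVol n m θ ≠ ∞ ∧ (segVol n m θ).toReal ≤ 4 ^ n := by
  obtain ⟨e1, e2⟩ := hullVol_ne_top_and_le (volume_seg_ne_top h0 h1)
    {circlePoint 1 (-θ / 2), circlePoint 1 (θ / 2)} n m
  refine ⟨e1, ?_⟩
  have h4 : volume (seg θ 1) ≤ ENNReal.ofReal 4 := by
    rw [volume_seg h0 h1]
    exact ENNReal.ofReal_le_ofReal (by linarith [Real.neg_one_le_sin θ, Real.pi_lt_d2])
  have := ENNReal.toReal_mono (ENNReal.pow_ne_top ENNReal.ofReal_ne_top)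
    (e2.trans (pow_le_pow_left' h4 n))
  rwa [ENNReal.toReal_pow, ENNReal.toReal_ofReal (by norm_num)] at this

theorem L_nonneg (h0 : 0 < θ) (h1 : θ < 2 * Real.pi) (hR : 0 < R) (n m : ℕ) : 0 ≤ L R n m θ := by
  rw [L_eq h0 h1 hR]
  have := sin_half_pos h0 h1
  positivity

theorem L_le (h0 : 0 < θ) (h1 : θ < 2 * Real.pi) (hR : 0 < R) (n m : ℕ) : L R n m θ ≤ 8 ^ n := by
  rw [L_eq h0 h1 hR]
  have e1 := (segVol_ne_top_and_le h0 h1 n m).2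
  have e2 := Real.sin_le_one (θ / 2)
  have e3 := (sin_half_pos h0 h1).le
  have e4 : (1 : ℝ) ≤ n.factorial := by exact_mod_cast Nat.one_le_iff_ne_zero.2 n.factorial_ne_zero
  have e5 : (8 : ℝ) ^ n = 4 ^ n * 2 ^ n * 1 := by rw [mul_one, ← mul_pow]; norm_num
  rw [div_le_iff₀ (by positivity), e5]
  calc (segVol n m θ).toReal * 2 ^ n * Real.sin (θ / 2) ≤ 4 ^ n * 2 ^ n * 1 := by gcongr
    _ ≤ 4 ^ n * 2 ^ n * 1 * n.factorial := le_mul_of_one_le_right (by positivity) e4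

end

/-- There are at most `n` boundary points besides the endpoints of the chord. -/
theorem L_eq_zero_of_lt {R : ℝ} (hR : 0 < R) {n m : ℕ} (h : n < m) {θ : ℝ} (h0 : 0 < θ)
    (h1 : θ < 2 * Real.pi) : L R n m θ = 0 := by
  rw [L_eq h0 h1 hR, segVol, hullVol_eq_zero_of_lt _ _ h]
  simp

theorem L_zero_zero {R : ℝ} (hR : 0 < R) {θ : ℝ} (h0 : 0 < θ) (h1 : θ < 2 * Real.pi) :
    L R 0 0 θ = Real.sin (θ / 2) := by
  have : hullVol (seg θ 1) {circlePoint 1 (-θ / 2), circlePoint 1 (θ / 2)} 0 0 = 1 := by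
    have h : {z : Fin 0 → ℂ | (∀ i, z i ∈ seg θ 1) ∧
        outer {circlePoint 1 (-θ / 2), circlePoint 1 (θ / 2)} z = 0} = Set.univ := by
      ext z
      have := outer_le_card {circlePoint 1 (-θ / 2), circlePoint 1 (θ / 2)} z
      simp at this
      simp [this]
    rw [hullVol, h, ← Set.pi_univ Set.univ, volume_pi_pi]
    simp
  rw [L_eq h0 h1 hR, segVol, this]
  simp

/-- With at least one point, the one of largest `arcKey` is on the boundary of the hull. -/
theorem L_succ_zero {R : ℝ} (hR : 0 < R) (n : ℕ) {θ : ℝ} (h0 : 0 < θ) (h1 : θ < 2 * Real.pi) :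
    L R (n + 1) 0 θ = 0 := by
  rw [L_eq h0 h1 hR, segVol_succ_zero h0 h1]
  simp

theorem measurable_indicator_L {R : ℝ} (hR : 0 < R) (n m : ℕ) :
    Measurable ((Set.Ioo 0 (2 * Real.pi)).indicator (L R n m)) := by
  set E : Set (ℝ × (Fin n → ℂ)) :=
    {y | (∀ i, ‖y.2 i‖ ≤ 1 ∧ 1 * Real.cos (y.1 / 2) ≤ (y.2 i).re) ∧
      outer {circlePoint 1 (-y.1 / 2), circlePoint 1 (y.1 / 2)} y.2 = m} with hE
  have hEm : MeasurableSet E := by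
    have h1 : MeasurableSet {y : ℝ × (Fin n → ℂ) |
        ∀ i, ‖y.2 i‖ ≤ 1 ∧ 1 * Real.cos (y.1 / 2) ≤ (y.2 i).re} := by
      rw [Set.ofPred_forall]
      refine MeasurableSet.iInter fun i => ?_
      have c1 : Continuous fun y : ℝ × (Fin n → ℂ) => y.2 i := by fun_prop
      exact ((isClosed_le c1.norm continuous_const).inter
        (isClosed_le (f := fun y : ℝ × (Fin n → ℂ) => 1 * Real.cos (y.1 / 2)) (by fun_prop)
          (Complex.continuous_re.comp c1))).measurableSet
    have h2 := measurable_outer (X := ℝ × (Fin n → ℂ))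
      (g := fun (k : Bool) y => circlePoint 1 (if k then y.1 / 2 else -y.1 / 2))
      (z := fun i y => y.2 i)
      (fun k => by
        refine (continuous_circlePoint 1).comp ?_
        cases k <;> simp <;> fun_prop)
      (fun i => by fun_prop)
    refine h1.inter (?_ : MeasurableSet {y : ℝ × (Fin n → ℂ) |
      outer {circlePoint 1 (-y.1 / 2), circlePoint 1 (y.1 / 2)} y.2 = m})
    convert! h2 (measurableSet_singleton m) using 1
    ext y
    simp
  have hmeas := measurable_measure_prodMk_left (ν := (volume : Measure (Fin n → ℂ))) hEm
  have hmeas2 : Measurable fun θ : ℝ =>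
      (volume (Prod.mk θ ⁻¹' E)).toReal * 2 ^ n * Real.sin (θ / 2) / (n.factorial : ℝ) :=
    ((hmeas.ennreal_toReal.mul_const _).mul (by fun_prop)).div_const _
  convert! hmeas2.indicator (measurableSet_Ioo (a := (0 : ℝ)) (b := 2 * Real.pi)) using 1
  ext θ
  by_cases hθ : θ ∈ Set.Ioo 0 (2 * Real.pi)
  · rw [Set.indicator_of_mem hθ, Set.indicator_of_mem hθ, L_eq hθ.1 hθ.2 hR, segVol, hullVol,
      seg_eq hθ.1 hθ.2 one_pos]
    rfl
  · rw [Set.indicator_of_notMem hθ, Set.indicator_of_notMem hθ]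

/-! ### The recursion -/

theorem sum_antidiagonalTuple_three {M : Type*} [AddCommMonoid M] (f : (Fin 3 → ℕ) → M) (n : ℕ) :
    ∑ a ∈ Finset.Nat.antidiagonalTuple 3 n, f a =
      ∑ k ∈ Finset.HasAntidiagonal.antidiagonal n,
        ∑ l ∈ Finset.HasAntidiagonal.antidiagonal k.2, f ![k.1, l.1, l.2] := by
  rw [Finset.sum_sigma']
  refine Finset.sum_bij' (fun a _ => ⟨(a 0, a 1 + a 2), (a 1, a 2)⟩)
    (fun x _ => ![x.1.1, x.2.1, x.2.2]) ?_ ?_ ?_ ?_ ?_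
  · intro a ha
    rw [Finset.Nat.mem_antidiagonalTuple, Fin.sum_univ_three] at ha
    simp only [Finset.mem_sigma, Finset.HasAntidiagonal.mem_antidiagonal, and_true]
    omega
  · rintro ⟨⟨k1, k2⟩, l1, l2⟩ h
    simp only [Finset.mem_sigma, Finset.HasAntidiagonal.mem_antidiagonal] at h
    rw [Finset.Nat.mem_antidiagonalTuple, Fin.sum_univ_three]
    simp
    omega
  · intro a _
    ext i; fin_cases i <;> rfl
  · rintro ⟨⟨k1, k2⟩, l1, l2⟩ h
    simp only [Finset.mem_sigma, Finset.HasAntidiagonal.mem_antidiagonal] at h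
    obtain ⟨-, rfl⟩ := h
    rfl
  · intro a _
    congr 1
    ext i; fin_cases i <;> rfl

/-- The sum in the recursion, for an arbitrary family of functions in place of `L`. -/
noncomputable def convThree (u : ℕ → ℕ → ℝ → ℝ) (n m : ℕ) (φ η : ℝ) : ℝ :=
  ∑ a ∈ Finset.Nat.antidiagonalTuple 3 n, ∑ b ∈ Finset.HasAntidiagonal.antidiagonal m,
    (Real.sin η + Real.sin (φ - η) - Real.sin φ) ^ (a 2) / ((a 2).factorial : ℝ) *
      u (a 0) b.1 η * u (a 1) b.2 (φ - η)

theorem sin_add_sin_sub_sin_nonneg {φ η : ℝ} (h0 : 0 < η) (h1 : η < φ) (h2 : φ < 2 * Real.pi) :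
    0 ≤ Real.sin η + Real.sin (φ - η) - Real.sin φ := by
  rw [sin_add_sin_sub_sin]
  have hα := Real.sin_pos_of_pos_of_lt_pi (x := η / 2) (by linarith) (by linarith)
  have hβ := Real.sin_pos_of_pos_of_lt_pi (x := (φ - η) / 2) (by linarith) (by linarith)
  have hu := Real.sin_pos_of_pos_of_lt_pi (x := φ / 2) (by linarith) (by linarith)
  positivity

theorem convThree_nonneg {R : ℝ} (hR : 0 < R) {φ η : ℝ} (h0 : 0 < η) (h1 : η < φ)
    (h2 : φ < 2 * Real.pi) (n m : ℕ) : 0 ≤ convThree (L R) n m φ η := by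
  refine Finset.sum_nonneg fun a _ => Finset.sum_nonneg fun b _ => ?_
  have e1 := sin_add_sin_sub_sin_nonneg h0 h1 h2
  have e2 := L_nonneg h0 (h1.trans h2) hR (a 0) b.1
  have e3 := L_nonneg (θ := φ - η) (by linarith) (by linarith) hR (a 1) b.2
  positivity

/-- `convThree` is the splitting formula of `hullVol_seg_three`, in the normalization of `L`. -/
theorem hullVol_three_toReal {R : ℝ} (hR : 0 < R) {φ η : ℝ} (h0 : 0 < η) (h1 : η < φ)
    (h2 : φ < 2 * Real.pi) (n m : ℕ) :
    (hullVol (seg φ 1) {circlePoint 1 (η - φ / 2), circlePoint 1 (-φ / 2), circlePoint 1 (φ / 2)}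
      n m).toReal * 2 ^ n * (Real.sin (η / 2) * Real.sin ((φ - η) / 2)) / (n.factorial : ℝ) =
    convThree (L R) n m φ η := by
  have hη2 : η < 2 * Real.pi := h1.trans h2
  have h0' : 0 < φ - η := by linarith
  have h2' : φ - η < 2 * Real.pi := by linarith
  have ht := sin_add_sin_sub_sin_nonneg h0 h1 h2
  have hfin : ∀ k b, segVol k b η ≠ ∞ := fun k b => (segVol_ne_top_and_le h0 hη2 k b).1
  have hfin' : ∀ k b, segVol k b (φ - η) ≠ ∞ := fun k b => (segVol_ne_top_and_le h0' h2' k b).1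
  rw [hullVol_seg_three h0 h1 h2, convThree, sum_antidiagonalTuple_three]
  have hin : ∀ (k b : ℕ × ℕ), ∑ l ∈ Finset.HasAntidiagonal.antidiagonal k.2,
      (k.2.choose l.1 : ℝ≥0∞) * (segVol l.1 b.2 (φ - η) *
        ENNReal.ofReal ((Real.sin η + Real.sin (φ - η) - Real.sin φ) / 2) ^ l.2) ≠ ∞ := fun k b =>
    ENNReal.sum_ne_top.2 fun l _ => ENNReal.mul_ne_top (ENNReal.natCast_ne_top _)
      (ENNReal.mul_ne_top (hfin' _ _) (ENNReal.pow_ne_top ENNReal.ofReal_ne_top))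
  have hmid : ∀ k : ℕ × ℕ, ∑ b ∈ Finset.HasAntidiagonal.antidiagonal m, segVol k.1 b.1 η *
      ∑ l ∈ Finset.HasAntidiagonal.antidiagonal k.2,
      (k.2.choose l.1 : ℝ≥0∞) * (segVol l.1 b.2 (φ - η) *
        ENNReal.ofReal ((Real.sin η + Real.sin (φ - η) - Real.sin φ) / 2) ^ l.2) ≠ ∞ := fun k =>
    ENNReal.sum_ne_top.2 fun b _ => ENNReal.mul_ne_top (hfin _ _) (hin k b)
  rw [ENNReal.toReal_sum fun k _ => ENNReal.mul_ne_top (ENNReal.natCast_ne_top _) (hmid k),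
    Finset.sum_mul, Finset.sum_mul, Finset.sum_div]
  refine Finset.sum_congr rfl fun k hk => ?_
  rw [ENNReal.toReal_mul, ENNReal.toReal_natCast,
    ENNReal.toReal_sum fun b _ => ENNReal.mul_ne_top (hfin _ _) (hin k b), Finset.sum_comm,
    Finset.mul_sum, Finset.sum_mul, Finset.sum_mul, Finset.sum_div]
  refine Finset.sum_congr rfl fun b _ => ?_
  rw [ENNReal.toReal_mul, ENNReal.toReal_sum fun l _ =>
    ENNReal.mul_ne_top (ENNReal.natCast_ne_top _)
      (ENNReal.mul_ne_top (hfin' _ _) (ENNReal.pow_ne_top ENNReal.ofReal_ne_top)),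
    Finset.mul_sum, Finset.mul_sum, Finset.sum_mul, Finset.sum_mul, Finset.sum_div]
  refine Finset.sum_congr rfl fun l hl => ?_
  rw [Finset.HasAntidiagonal.mem_antidiagonal] at hk hl
  simp only [ENNReal.toReal_mul, ENNReal.toReal_natCast, ENNReal.toReal_pow]
  rw [ENNReal.toReal_ofReal (by positivity), div_pow]
  have c1 : (n.choose k.1 : ℝ) * k.1.factorial * k.2.factorial = n.factorial := by
    have := Nat.choose_mul_factorial_mul_factorial (n := n) (k := k.1) (by omega)
    rw [show n - k.1 = k.2 by omega] at this
    exact_mod_cast this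
  have c2 : (k.2.choose l.1 : ℝ) * l.1.factorial * l.2.factorial = k.2.factorial := by
    have := Nat.choose_mul_factorial_mul_factorial (n := k.2) (k := l.1) (by omega)
    rw [show k.2 - l.1 = l.2 by omega] at this
    exact_mod_cast this
  have c3 : (2 : ℝ) ^ n = 2 ^ k.1 * (2 ^ l.1 * 2 ^ l.2) := by
    rw [← pow_add, ← pow_add]; congr 1; omega
  have f0 : (n.factorial : ℝ) ≠ 0 := by positivity
  have f1 : (k.1.factorial : ℝ) ≠ 0 := by positivity
  have f2 : (l.1.factorial : ℝ) ≠ 0 := by positivity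
  have f3 : (l.2.factorial : ℝ) ≠ 0 := by positivity
  have hb : (n.choose k.1 : ℝ) * k.2.choose l.1 / n.factorial =
      1 / (k.1.factorial * l.1.factorial * l.2.factorial) := by
    rw [div_eq_div_iff f0 (by positivity), one_mul, ← c1, ← c2]; ring
  simp only [Matrix.cons_val_zero, Matrix.cons_val_one, Matrix.cons_val]
  rw [L_eq h0 hη2 hR, L_eq h0' h2' hR, c3]
  calc _ = ((n.choose k.1 : ℝ) * k.2.choose l.1 / n.factorial) *
        ((segVol k.1 b.1 η).toReal * (segVol l.1 b.2 (φ - η)).toReal *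
        (Real.sin η + Real.sin (φ - η) - Real.sin φ) ^ l.2 * 2 ^ k.1 * 2 ^ l.1 *
        Real.sin (η / 2) * Real.sin ((φ - η) / 2)) := by field_simp
    _ = _ := by rw [hb]; field_simp

/-- The integrand of the recursion. -/
noncomputable def recKernel (u : ℕ → ℕ → ℝ → ℝ) (n m : ℕ) (θ φ η : ℝ) : ℝ :=
  Real.sin (θ / 2) ^ (2 * (n + 1) + 1) / Real.sin (φ / 2) ^ (2 * (n + 1) + 1) *
    convThree u n m φ η

theorem measurable_convThree {u : ℕ → ℕ → ℝ → ℝ} (hu : ∀ n m, Measurable (u n m)) (n m : ℕ) :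
    Measurable fun y : ℝ × ℝ => convThree u n m y.1 y.2 := by
  unfold convThree
  refine Finset.measurable_sum _ fun a _ => Finset.measurable_sum _ fun b _ => ?_
  have h1 : Measurable fun y : ℝ × ℝ =>
    (Real.sin y.2 + Real.sin (y.1 - y.2) - Real.sin y.1) ^ (a 2) / ((a 2).factorial : ℝ) := by
    fun_prop
  exact (h1.mul ((hu _ _).comp measurable_snd)).mul
    ((hu _ _).comp (measurable_fst.sub measurable_snd))

theorem exists_bound_sum {ι X : Type*} (s : Finset ι) {f : ι → X → ℝ}
    (h : ∀ i ∈ s, ∃ C, ∀ x, |f i x| ≤ C) : ∃ C, ∀ x, |∑ i ∈ s, f i x| ≤ C := by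
  choose! C hC using h
  exact ⟨∑ i ∈ s, C i, fun x => (Finset.abs_sum_le_sum_abs _ _).trans
    (Finset.sum_le_sum fun i hi => hC i hi x)⟩

theorem exists_bound_mul {X : Type*} {f g : X → ℝ} (hf : ∃ C, ∀ x, |f x| ≤ C)
    (hg : ∃ C, ∀ x, |g x| ≤ C) : ∃ C, ∀ x, |f x * g x| ≤ C := by
  obtain ⟨C, hC⟩ := hf
  obtain ⟨D, hD⟩ := hg
  refine ⟨C * D, fun x => ?_⟩
  rw [abs_mul]
  exact mul_le_mul (hC x) (hD x) (abs_nonneg _) ((abs_nonneg _).trans (hC x))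

theorem exists_bound_convThree {u : ℕ → ℕ → ℝ → ℝ} (hu : ∀ n m, ∃ C, ∀ x, |u n m x| ≤ C)
    (n m : ℕ) : ∃ C, ∀ y : ℝ × ℝ, |convThree u n m y.1 y.2| ≤ C := by
  unfold convThree
  refine exists_bound_sum _ fun a _ => exists_bound_sum _ fun b _ =>
    exists_bound_mul (exists_bound_mul ?_ ?_) ?_
  · refine ⟨3 ^ (a 2), fun y => ?_⟩
    have h1 : (1 : ℝ) ≤ (a 2).factorial := by
      exact_mod_cast Nat.one_le_iff_ne_zero.2 (Nat.factorial_ne_zero _)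
    rw [abs_div, abs_pow, abs_of_pos (by linarith : (0 : ℝ) < (a 2).factorial)]
    refine (div_le_self (by positivity) h1).trans (pow_le_pow_left₀ (abs_nonneg _) ?_ _)
    rw [abs_le]
    constructor <;> linarith [Real.sin_le_one y.2, Real.sin_le_one y.1,
      Real.sin_le_one (y.1 - y.2), Real.neg_one_le_sin y.2, Real.neg_one_le_sin y.1,
      Real.neg_one_le_sin (y.1 - y.2)]
  · obtain ⟨C, hC⟩ := hu (a 0) b.1
    exact ⟨C, fun y => hC _⟩
  · obtain ⟨C, hC⟩ := hu (a 1) b.2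
    exact ⟨C, fun y => hC _⟩

/-- The extension of `L R n m` by zero outside `(0, 2π)`: a bounded measurable function. -/
noncomputable def LExt (R : ℝ) (n m : ℕ) : ℝ → ℝ := (Set.Ioo 0 (2 * Real.pi)).indicator (L R n m)

theorem LExt_eq {R : ℝ} {n m : ℕ} {θ : ℝ} (h0 : 0 < θ) (h1 : θ < 2 * Real.pi) :
    LExt R n m θ = L R n m θ :=
  Set.indicator_of_mem (s := Set.Ioo 0 (2 * Real.pi)) ⟨h0, h1⟩ _

theorem measurable_LExt {R : ℝ} (hR : 0 < R) (n m : ℕ) : Measurable (LExt R n m) :=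
  measurable_indicator_L hR n m

theorem exists_bound_LExt {R : ℝ} (hR : 0 < R) (n m : ℕ) : ∃ C, ∀ x, |LExt R n m x| ≤ C := by
  refine ⟨8 ^ n, fun x => ?_⟩
  by_cases hx : x ∈ Set.Ioo 0 (2 * Real.pi)
  · rw [LExt_eq hx.1 hx.2, abs_of_nonneg (L_nonneg hx.1 hx.2 hR n m)]
    exact L_le hx.1 hx.2 hR n m
  · rw [LExt, Set.indicator_of_notMem hx, abs_zero]
    positivity

theorem convThree_LExt {R : ℝ} {φ η : ℝ} (h0 : 0 < η) (h1 : η < φ) (h2 : φ < 2 * Real.pi)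
    (n m : ℕ) : convThree (L R) n m φ η = convThree (LExt R) n m φ η := by
  unfold convThree
  refine Finset.sum_congr rfl fun a _ => Finset.sum_congr rfl fun b _ => ?_
  rw [LExt_eq h0 (h1.trans h2), LExt_eq (by linarith) (by linarith)]

theorem intervalIntegrable_of_bound {f g : ℝ → ℝ} {a b : ℝ} (hab : a ≤ b) (hg : Measurable g)
    (hC : ∃ C, ∀ x, |g x| ≤ C) (h : Set.EqOn f g (Set.Ioo a b)) :
    IntervalIntegrable f volume a b := by
  obtain ⟨C, hC⟩ := hC
  rw [intervalIntegrable_iff_integrableOn_Ioo_of_le hab]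
  exact (Measure.integrableOn_of_bounded (M := C) (by simp) hg.aestronglyMeasurable
    (ae_of_all _ hC)).congr_fun h.symm measurableSet_Ioo

theorem intervalIntegral_congr_Ioo {f g : ℝ → ℝ} {a b : ℝ} (hab : a ≤ b)
    (h : Set.EqOn f g (Set.Ioo a b)) : ∫ x in a..b, f x = ∫ x in a..b, g x := by
  rw [intervalIntegral.integral_of_le hab, intervalIntegral.integral_of_le hab,
    integral_Ioc_eq_integral_Ioo, integral_Ioc_eq_integral_Ioo]
  exact setIntegral_congr_fun measurableSet_Ioo h

theorem measurable_convThree_LExt {R : ℝ} (hR : 0 < R) (n m : ℕ) (φ : ℝ) :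
    Measurable (convThree (LExt R) n m φ) := by
  have h := (measurable_convThree (measurable_LExt hR) n m).comp (measurable_prodMk_left (x := φ))
  simpa only [Function.comp_def] using h

theorem exists_bound_convThree_LExt {R : ℝ} (hR : 0 < R) (n m : ℕ) (φ : ℝ) :
    ∃ C, ∀ η, |convThree (LExt R) n m φ η| ≤ C := by
  obtain ⟨C, hC⟩ := exists_bound_convThree (exists_bound_LExt hR) n m
  exact ⟨C, fun η => by simpa only using hC (φ, η)⟩

theorem intervalIntegrable_recKernel {R θ φ : ℝ} (hR : 0 < R) (h1 : θ < 2 * Real.pi) (n m : ℕ)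
    (hφ : φ ∈ Set.Ioo 0 θ) : IntervalIntegrable (recKernel (L R) n m θ φ) volume 0 φ := by
  have h : IntervalIntegrable (convThree (L R) n m φ) volume 0 φ :=
    intervalIntegrable_of_bound hφ.1.le (measurable_convThree_LExt hR n m φ)
      (exists_bound_convThree_LExt hR n m φ) fun η hη =>
        convThree_LExt hη.1 hη.2 (hφ.2.trans h1) n m
  exact h.const_mul _

section
variable {θ R : ℝ} (h0 : 0 < θ) (h1 : θ < 2 * Real.pi) (hR : 0 < R)
include h0 h1 hR

theorem lintegral_recKernel (n m : ℕ) :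
    ∫⁻ y in angleDomain θ, ENNReal.ofReal (recKernel (L R) n m θ y.1 y.2) =
      ENNReal.ofReal (L R (n + 1) (m + 1) θ / 2) := by
  have hs := sin_half_pos h0 h1
  have hpt : ∀ y ∈ angleDomain θ, ENNReal.ofReal (recKernel (L R) n m θ y.1 y.2) =
      ENNReal.ofReal (2 ^ n * Real.sin (θ / 2) / n.factorial) *
      (ENNReal.ofReal (Real.sin (θ / 2) ^ 2 / Real.sin (y.1 / 2) ^ 3 *
        (Real.sin (y.2 / 2) * Real.sin ((y.1 - y.2) / 2))) *
      (ENNReal.ofReal ((Real.sin (θ / 2) / Real.sin (y.1 / 2)) ^ (2 * n)) *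
        hullVol (seg y.1 1) {circlePoint 1 (y.2 - y.1 / 2), circlePoint 1 (-y.1 / 2),
          circlePoint 1 (y.1 / 2)} n m)) := by
    rintro ⟨φ, η⟩ ⟨hη, hηφ, hφ⟩
    simp only at hη hηφ hφ
    simp only
    have hφ2 := hφ.trans h1
    have hα := Real.sin_pos_of_pos_of_lt_pi (x := η / 2) (by linarith) (by linarith)
    have hβ := Real.sin_pos_of_pos_of_lt_pi (x := (φ - η) / 2) (by linarith) (by linarith)
    have hu := Real.sin_pos_of_pos_of_lt_pi (x := φ / 2) (by linarith) (by linarith)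
    have hfin := (hullVol_ne_top_and_le (volume_seg_ne_top (hη.trans hηφ) hφ2)
      {circlePoint 1 (η - φ / 2),
      circlePoint 1 (-φ / 2), circlePoint 1 (φ / 2)} n m).1
    rw [recKernel, ← hullVol_three_toReal hR hη hηφ hφ2]
    conv_rhs => rw [← ENNReal.ofReal_toReal hfin]
    rw [← ENNReal.ofReal_mul (by positivity), ← ENNReal.ofReal_mul (by positivity),
      ← ENNReal.ofReal_mul (by positivity)]
    congr 1
    generalize (hullVol (seg φ 1) {circlePoint 1 (η - φ / 2), circlePoint 1 (-φ / 2),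
      circlePoint 1 (φ / 2)} n m).toReal = v
    rw [div_pow, show 2 * (n + 1) + 1 = 2 * n + 3 by ring, pow_add, pow_add]
    field_simp
  rw [setLIntegral_congr_fun (measurableSet_angleDomain θ) hpt,
    lintegral_const_mul' _ _ ENNReal.ofReal_ne_top]
  have hmain := segVol_succ_eq_lintegral h0 h1 n (m + 1)
  simp only [Nat.add_sub_cancel, Nat.add_eq_zero_iff, one_ne_zero, and_false, if_false] at hmain
  set I := ∫⁻ y in angleDomain θ, (ENNReal.ofReal (Real.sin (θ / 2) ^ 2 / Real.sin (y.1 / 2) ^ 3 *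
        (Real.sin (y.2 / 2) * Real.sin ((y.1 - y.2) / 2))) *
      (ENNReal.ofReal ((Real.sin (θ / 2) / Real.sin (y.1 / 2)) ^ (2 * n)) *
        hullVol (seg y.1 1) {circlePoint 1 (y.2 - y.1 / 2), circlePoint 1 (-y.1 / 2),
          circlePoint 1 (y.1 / 2)} n m)) with hI
  have hItop : I ≠ ∞ := by
    intro h
    have := (segVol_ne_top_and_le h0 h1 (n + 1) (m + 1)).1
    rw [hmain, h, ENNReal.mul_top (by positivity)] at this
    exact this rfl
  have hreal : (segVol (n + 1) (m + 1) θ).toReal = (n + 1) * I.toReal := by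
    rw [hmain, ENNReal.toReal_mul]
    norm_cast
  rw [L_eq h0 h1 hR, hreal]
  conv_lhs => rw [← ENNReal.ofReal_toReal hItop]
  rw [← ENNReal.ofReal_mul (by positivity)]
  congr 1
  rw [Nat.factorial_succ]
  push_cast
  field_simp
  ring

/-- The recursion. Tonelli's theorem gives the integrability of the inner integral along with the
equality, as the integrand is nonnegative. -/
theorem recursion (n m : ℕ) :
    IntervalIntegrable (fun φ => ∫ η in (0 : ℝ)..φ, recKernel (L R) n m θ φ η) volume 0 θ ∧
      L R (n + 1) (m + 1) θ / 2 =
        ∫ φ in (0 : ℝ)..θ, ∫ η in (0 : ℝ)..φ, recKernel (L R) n m θ φ η := by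
  have hs := sin_half_pos h0 h1
  have hm := measurableSet_angleDomain θ
  have hlin := lintegral_recKernel h0 h1 hR n m
  have hEq : Set.EqOn (fun y : ℝ × ℝ => recKernel (L R) n m θ y.1 y.2)
      (fun y => recKernel (LExt R) n m θ y.1 y.2) (angleDomain θ) := fun y hy => by
    simp only [recKernel]
    rw [convThree_LExt hy.1 hy.2.1 (hy.2.2.trans h1)]
  have hmeas : Measurable fun y : ℝ × ℝ => recKernel (LExt R) n m θ y.1 y.2 := by
    unfold recKernel
    have := measurable_convThree (measurable_LExt hR) n m
    exact Measurable.mul (by fun_prop) this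
  have haesm : AEStronglyMeasurable (fun y : ℝ × ℝ => recKernel (L R) n m θ y.1 y.2)
      (volume.restrict (angleDomain θ)) :=
    hmeas.aestronglyMeasurable.congr
      ((ae_restrict_iff' hm).2 (ae_of_all _ fun y hy => (hEq hy).symm))
  have hnn : ∀ y ∈ angleDomain θ, 0 ≤ recKernel (L R) n m θ y.1 y.2 := fun y hy => by
    have := convThree_nonneg hR hy.1 hy.2.1 (hy.2.2.trans h1) n m
    have hu := Real.sin_pos_of_pos_of_lt_pi (x := y.1 / 2) (by linarith [hy.1, hy.2.1])
      (by linarith [hy.2.2])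
    unfold recKernel
    positivity
  have hnn' : 0 ≤ᵐ[volume.restrict (angleDomain θ)]
      fun y : ℝ × ℝ => recKernel (L R) n m θ y.1 y.2 :=
    (ae_restrict_iff' hm).2 (ae_of_all _ hnn)
  have hint : IntegrableOn (fun y : ℝ × ℝ => recKernel (L R) n m θ y.1 y.2) (angleDomain θ) := by
    refine ⟨haesm, ?_⟩
    rw [hasFiniteIntegral_iff_ofReal hnn', hlin]
    exact ENNReal.ofReal_lt_top
  have hval : ∫ y in angleDomain θ, recKernel (L R) n m θ y.1 y.2 =
      L R (n + 1) (m + 1) θ / 2 := by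
    rw [integral_eq_lintegral_of_nonneg_ae hnn' haesm, hlin, ENNReal.toReal_ofReal]
    exact div_nonneg (L_nonneg h0 h1 hR _ _) zero_le_two
  rw [← integrable_indicator_iff hm] at hint
  rw [← integral_indicator hm] at hval
  have hsec : ∀ φ, ∫ η, (angleDomain θ).indicator
      (fun y : ℝ × ℝ => recKernel (L R) n m θ y.1 y.2) (φ, η) =
      (Set.Ioo 0 θ).indicator (fun φ => ∫ η in (0 : ℝ)..φ, recKernel (L R) n m θ φ η) φ := by
    intro φ
    by_cases hφ : φ ∈ Set.Ioo 0 θ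
    · rw [Set.indicator_of_mem hφ, intervalIntegral.integral_of_le hφ.1.le,
        integral_Ioc_eq_integral_Ioo, ← integral_indicator measurableSet_Ioo]
      congr 1
      ext η
      by_cases hη : η ∈ Set.Ioo 0 φ
      · rw [Set.indicator_of_mem hη, Set.indicator_of_mem]
        exact ⟨hη.1, hη.2, hφ.2⟩
      · rw [Set.indicator_of_notMem hη, Set.indicator_of_notMem]
        exact fun h => hη ⟨h.1, h.2.1⟩
    · rw [Set.indicator_of_notMem hφ]
      refine integral_eq_zero_of_ae (ae_of_all _ fun η => ?_)
      refine Set.indicator_of_notMem (fun h => hφ ⟨?_, h.2.2⟩) _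
      exact lt_trans h.1 h.2.1
  have hprod := hint.integral_prod_left
  simp only [hsec] at hprod
  rw [integrable_indicator_iff measurableSet_Ioo] at hprod
  refine ⟨(intervalIntegrable_iff_integrableOn_Ioo_of_le h0.le).2 hprod, ?_⟩
  rw [Measure.volume_eq_prod] at hval
  rw [Measure.volume_eq_prod] at hint
  rw [← hval, integral_prod _ hint]
  simp only [hsec]
  rw [integral_indicator measurableSet_Ioo, intervalIntegral.integral_of_le h0.le,
    integral_Ioc_eq_integral_Ioo]

end

/-! ### Uniform points in a disk -/

theorem sum_hullVol {S T : Set ℂ} (hS : MeasurableSet S) (hT : T.Finite) (n : ℕ) :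
    ∑ m ∈ Finset.range (n + 1), hullVol S T n m = volume S ^ n := by
  have h : (Set.univ.pi fun _ : Fin n => S) = ⋃ m ∈ Finset.range (n + 1),
      {z : Fin n → ℂ | (∀ i, z i ∈ S) ∧ outer T z = m} := by
    ext z
    have := outer_le_card T z
    rw [Fintype.card_fin] at this
    simp only [Set.mem_univ_pi, Set.mem_iUnion, Finset.mem_range, Set.mem_ofPred_eq, exists_prop]
    exact ⟨fun h => ⟨_, by omega, h, rfl⟩, fun ⟨_, _, h, _⟩ => h⟩
  have e : volume S ^ n = volume (Set.univ.pi fun _ : Fin n => S) := by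
    rw [volume_pi_pi]; simp
  rw [e, h, measure_biUnion_finset _ fun m _ => measurableSet_outer_eq hS hT m]
  · rfl
  · exact fun m _ m' _ hne => Set.disjoint_left.2 fun z hz hz' => hne (hz.2.symm.trans hz'.2)

/-- The farthest point from the center being `x`, it is on the boundary of the hull, and the other
points are in the disk of radius `|x|`, which is brought back to the unit disk with `x` at `-1`. -/
theorem volume_cons_disk {x : ℂ} (hx : x ≠ 0) (hx1 : ‖x‖ ≤ 1) (n m : ℕ) :
    volume {z : Fin n → ℂ | (∀ j, z j ∈ Metric.closedBall 0 1 ∩ {w | ‖w‖ < ‖x‖}) ∧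
      outer ∅ (Fin.cons x z : Fin (n + 1) → ℂ) = m} =
    if m = 0 then 0 else
      ENNReal.ofReal (‖x‖ ^ (2 * n)) * hullVol (Metric.closedBall 0 1) {-1} n (m - 1) := by
  have hnx : 0 < ‖x‖ := norm_pos_iff.2 hx
  have hS : Metric.closedBall (0 : ℂ) 1 ∩ {w | ‖w‖ < ‖x‖} = Metric.ball 0 ‖x‖ := by
    ext w
    simp only [Set.mem_inter_iff, mem_closedBall_zero_iff, Set.mem_ofPred_eq, mem_ball_zero_iff]
    exact ⟨fun h => h.2, fun h => ⟨(h.trans_le hx1).le, h⟩⟩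
  have hset : {z : Fin n → ℂ | (∀ j, z j ∈ Metric.ball 0 ‖x‖) ∧
      outer ∅ (Fin.cons x z : Fin (n + 1) → ℂ) = m} =
      {z : Fin n → ℂ | (∀ j, z j ∈ Metric.ball 0 ‖x‖) ∧ outer {x} z + 1 = m} := by
    ext z
    simp only [Set.mem_ofPred_eq]
    refine and_congr_right fun hz => ?_
    rw [outer_cons, insert_empty_eq]
    intro h
    have hsub : convexHull ℝ (∅ ∪ Set.range (Fin.cons x z : Fin (n + 1) → ℂ)) ⊆
        Metric.closedBall 0 ‖x‖ := by
      refine convexHull_min ?_ (convex_closedBall _ _)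
      rw [Fin.range_cons, Set.empty_union]
      rintro v (rfl | ⟨j, rfl⟩)
      · simp
      · exact Metric.ball_subset_closedBall (hz j)
    have := interior_mono hsub h
    rw [interior_closedBall _ hnx.ne'] at this
    simp at this
  rw [hS, hset]
  split_ifs with hm
  · subst hm
    simp
  · obtain ⟨k, rfl⟩ := Nat.exists_eq_succ_of_ne_zero hm
    simp only [Nat.succ_eq_add_one, add_left_inj, Nat.add_sub_cancel]
    have h1 : Metric.ball 0 ‖x‖ = (fun w => -x * w + 0) '' Metric.ball 0 1 := by
      ext w
      simp only [mem_ball_zero_iff, Set.mem_image, add_zero]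
      constructor
      · intro h
        refine ⟨w / (-x), ?_, by field_simp⟩
        rwa [norm_div, norm_neg, div_lt_one hnx]
      · rintro ⟨v, hv, rfl⟩
        rw [norm_mul, norm_neg]
        exact mul_lt_of_lt_one_right hnx hv
    have h2 : ({x} : Set ℂ) = (fun w => -x * w + 0) '' {-1} := by simp
    have h3 : (Metric.ball 0 1 : Set ℂ) =ᵐ[volume] Metric.closedBall 0 1 := by
      filter_upwards [ae_norm_ne_one] with z hz
      refine propext ?_
      change z ∈ Metric.ball 0 1 ↔ z ∈ Metric.closedBall 0 1
      rw [mem_ball_zero_iff, mem_closedBall_zero_iff, lt_iff_le_and_ne]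
      tauto
    change hullVol (Metric.ball 0 ‖x‖) {x} n k = _
    rw [h1, h2, hullVol_similarity (neg_ne_zero.2 hx) 0 Metric.isOpen_ball.measurableSet (by simp),
      norm_neg, hullVol_congr h3]

/-- Disintegration with respect to the farthest point from the center. -/
theorem hullVol_disk_succ (n m : ℕ) :
    hullVol (Metric.closedBall 0 1) ∅ (n + 1) m = if m = 0 then 0 else
      volume (Metric.closedBall (0 : ℂ) 1) * hullVol (Metric.closedBall 0 1) {-1} n (m - 1) := by
  have hD : MeasurableSet (Metric.closedBall (0 : ℂ) 1) := Metric.isClosed_closedBall.measurableSet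
  have hv0 : volume (Metric.closedBall (0 : ℂ) 1) ≠ 0 :=
    (Metric.measure_closedBall_pos _ _ one_pos).ne'
  have hvt : volume (Metric.closedBall (0 : ℂ) 1) ≠ ∞ := measure_closedBall_lt_top.ne
  set K : ℝ≥0∞ := ∫⁻ x in Metric.closedBall (0 : ℂ) 1, ENNReal.ofReal (‖x‖ ^ (2 * n)) with hK
  have key : ∀ m, hullVol (Metric.closedBall 0 1) ∅ (n + 1) m = if m = 0 then 0 else
      (n + 1) * K * hullVol (Metric.closedBall 0 1) {-1} n (m - 1) := by
    intro m
    have hκ : ∀ c : ℝ, volume (Metric.closedBall (0 : ℂ) 1 ∩ {x | ‖x‖ = c}) = 0 := fun c => by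
      refine measure_mono_null (t := Metric.sphere 0 c) ?_ (Measure.addHaar_sphere _ _ _)
      rintro x ⟨_, hx⟩
      simpa using hx
    rw [hullVol_succ_eq_lintegral hD (by simp) measurable_norm hκ]
    have hae : ∀ᵐ x : ℂ, x ∈ Metric.closedBall (0 : ℂ) 1 →
        volume {z : Fin n → ℂ | (∀ j, z j ∈ Metric.closedBall 0 1 ∩ {w | ‖w‖ < ‖x‖}) ∧
          outer ∅ (Fin.cons x z : Fin (n + 1) → ℂ) = m} =
        if m = 0 then 0 else
          ENNReal.ofReal (‖x‖ ^ (2 * n)) * hullVol (Metric.closedBall 0 1) {-1} n (m - 1) := by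
      have : ∀ᵐ x : ℂ, x ≠ 0 := by simp [ae_iff]
      filter_upwards [this] with x hx hx1
      exact volume_cons_disk hx (by simpa using hx1) n m
    rw [setLIntegral_congr_fun_ae hD hae]
    split_ifs with hm
    · simp
    · rw [lintegral_mul_const' _ _ (hullVol_ne_top_and_le hvt _ _ _).1, mul_assoc]
  -- the factor is found by summing over `m`
  have hKval : (n + 1) * K = volume (Metric.closedBall (0 : ℂ) 1) := by
    have h1 := sum_hullVol hD (T := ∅) (by simp) (n + 1)
    have h2 := sum_hullVol hD (T := {-1}) (by simp) n
    rw [Finset.sum_range_succ', key 0] at h1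
    simp only [key, if_true, add_zero, Nat.add_eq_zero_iff, one_ne_zero, and_false, if_false,
      Nat.add_sub_cancel] at h1
    rw [← Finset.mul_sum, h2, pow_succ, mul_comm _ (volume _)] at h1
    exact (ENNReal.mul_left_inj (pow_ne_zero n hv0) (ENNReal.pow_ne_top hvt)).1 h1
  rw [key, hKval]

theorem volume_disk : volume (Metric.closedBall (0 : ℂ) 1) = ENNReal.ofReal Real.pi := by
  rw [Complex.volume_closedBall]
  simp [ENNReal.ofReal, NNReal.pi, Real.toNNReal_of_nonneg Real.pi_pos.le]
  rfl

/-- For random points in a disk, one of the points may be assumed to be on the bounding circle. -/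
theorem hullProb_closedBall (c : ℂ) {r : ℝ} (hr : 0 < r) (n m : ℕ) :
    hullProb (Metric.closedBall c r) (n + 1) m = if m = 0 then 0 else
      (hullVol (Metric.closedBall 0 1) {-1} n (m - 1)).toReal / Real.pi ^ n := by
  have hr' : (r : ℂ) ≠ 0 := by exact_mod_cast hr.ne'
  have hD : MeasurableSet (Metric.closedBall (0 : ℂ) 1) := Metric.isClosed_closedBall.measurableSet
  have h1 : Metric.closedBall c r = (fun w : ℂ => (r : ℂ) * w + c) '' Metric.closedBall 0 1 := by
    ext w
    simp only [mem_closedBall_iff_norm, Set.mem_image, sub_zero]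
    constructor
    · intro h
      refine ⟨(w - c) / r, ?_, by field_simp; ring⟩
      rwa [norm_div, Complex.norm_real, Real.norm_of_nonneg hr.le, div_le_one hr]
    · rintro ⟨v, hv, rfl⟩
      rw [add_sub_cancel_right, norm_mul, Complex.norm_real, Real.norm_of_nonneg hr.le]
      exact mul_le_of_le_one_right hr.le hv
  have hv : volume (Metric.closedBall c r) = ENNReal.ofReal (r ^ 2 * Real.pi) := by
    rw [ENNReal.ofReal_mul (by positivity), ← volume_disk, Complex.volume_closedBall,
      Complex.volume_closedBall, ENNReal.ofReal_pow hr.le]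
    simp
  have hset : {z : Fin (n + 1) → ℂ | (∀ i, z i ∈ Metric.closedBall c r) ∧ z ∈ CP (n + 1) m} =
      {z : Fin (n + 1) → ℂ | (∀ i, z i ∈ Metric.closedBall c r) ∧ outer ∅ z = m} := by
    ext z; simp only [Set.mem_ofPred_eq, mem_CP_iff]
  have h2 := hullVol_similarity hr' c hD (T := ∅) (by simp) (n + 1) m
  rw [← h1, Set.image_empty, hullVol_disk_succ, volume_disk, Complex.norm_real,
    Real.norm_of_nonneg hr.le] at h2
  rw [hullProb, measureReal_def, unifLaw_apply Metric.isClosed_closedBall.measurableSet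
    (Metric.measure_closedBall_pos _ _ hr).ne' measure_closedBall_lt_top.ne, hset, ← hullVol, h2,
    hv]
  split_ifs with hm
  · simp
  · have hπ := Real.pi_pos
    simp only [ENNReal.toReal_mul, ENNReal.toReal_pow, ENNReal.toReal_inv]
    rw [ENNReal.toReal_ofReal (by positivity), ENNReal.toReal_ofReal (by positivity),
      ENNReal.toReal_ofReal hπ.le, pow_mul, inv_pow, mul_pow, pow_succ Real.pi]
    field_simp

theorem notMem_convexHull_iff {s : Set ℂ} (hs : s.Finite) {p : ℂ} :
    p ∉ convexHull ℝ s ↔ ∃ u : ℂ, ∀ q ∈ s, 0 < inner ℝ u (q - p) := by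
  constructor
  · intro hp
    obtain ⟨f, t, h1, h2⟩ := geometric_hahn_banach_point_closed (convex_convexHull ℝ s)
      (hs.isCompact_convexHull ℝ).isClosed hp
    refine ⟨(InnerProductSpace.toDual ℝ ℂ).symm f, fun q hq => ?_⟩
    rw [InnerProductSpace.toDual_symm_apply, map_sub]
    linarith [h2 q (subset_convexHull ℝ s hq)]
  · rintro ⟨u, hu⟩ hp
    have hc : Convex ℝ {q : ℂ | inner ℝ u p < innerSL ℝ u q} :=
      convex_halfSpace_gt (f := innerSL ℝ u) (innerSL ℝ u).toLinearMap.isLinear _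
    have : p ∈ {q : ℂ | inner ℝ u p < innerSL ℝ u q} :=
      convexHull_min (fun q hq => by
        have := hu q hq
        rw [inner_sub_right] at this
        simpa using this) hc hp
    simp at this

theorem notMem_interior_convexHull_of_inner {s : Set ℂ} {p u : ℂ} (hu : u ≠ 0)
    (h : ∀ q ∈ s, 0 ≤ inner ℝ u (q - p)) : p ∉ interior (convexHull ℝ s) := by
  rw [notMem_interior_convexHull_iff]
  refine ⟨(‖u‖⁻¹ : ℝ) • u, by simp [hu], fun q hq => ?_⟩
  rw [real_inner_smul_left]
  exact mul_nonneg (by positivity) (h q hq)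

/-- Almost surely, a given point is not on the boundary of the hull of `a` and the other ones, as the
boundary of a convex set is a null set. -/
theorem ae_notMem_frontier (k : ℕ) (i : Fin (k + 1)) (a : ℂ) :
    ∀ᵐ z : Fin (k + 1) → ℂ,
      z i ∉ frontier (convexHull ℝ (insert a (Set.range fun j => z (i.succAbove j)))) := by
  set H : Set (ℂ × (Fin k → ℂ)) :=
    {y | y.1 ∈ frontier (convexHull ℝ (insert a (Set.range y.2)))} with hH
  have hr : ∀ w : Fin k → ℂ, insert a (Set.range w) =
      Set.range (Fin.cons a w : Fin (k + 1) → ℂ) := fun w => (Fin.range_cons a w).symm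
  have hcont : ∀ j : Fin (k + 1), Continuous fun y : ℂ × (Fin k → ℂ) =>
      (Fin.cons a y.2 : Fin (k + 1) → ℂ) j := by
    intro j
    refine Fin.cases ?_ (fun j => ?_) j
    · simpa using continuous_const
    · simp only [Fin.cons_succ]; fun_prop
  have hHm : MeasurableSet H := by
    have h1 : IsOpen {y : ℂ × (Fin k → ℂ) | y.1 ∉ convexHull ℝ (insert a (Set.range y.2))} := by
      simp only [hr, notMem_convexHull_iff (Set.finite_range _), Set.forall_mem_range,
        Set.ofPred_exists, Set.ofPred_forall]
      exact isOpen_iUnion fun u => isOpen_iInter_of_finite fun j => isOpen_lt continuous_const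
        (continuous_const.inner ((hcont j).sub continuous_fst))
    have h2 : IsClosed {y : ℂ × (Fin k → ℂ) |
        y.1 ∉ interior (convexHull ℝ (insert a (Set.range y.2)))} := by
      simp only [hr]
      exact isClosed_notMem_interior_convexHull hcont continuous_fst
    have h3 : H = {y : ℂ × (Fin k → ℂ) | y.1 ∉ convexHull ℝ (insert a (Set.range y.2))}ᶜ ∩
        {y : ℂ × (Fin k → ℂ) | y.1 ∉ interior (convexHull ℝ (insert a (Set.range y.2)))} := by
      ext y
      have hcl : IsClosed (convexHull ℝ (insert a (Set.range y.2))) :=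
        (((Set.finite_range _).insert a).isCompact_convexHull ℝ).isClosed
      simp [hH, hcl.frontier_eq]
    rw [h3]
    exact h1.measurableSet.compl.inter h2.measurableSet
  have hH0 : volume H = 0 := by
    rw [Measure.volume_eq_prod, Measure.prod_apply_symm hHm]
    refine (lintegral_congr fun w => ?_).trans lintegral_zero
    exact (convex_convexHull ℝ (insert a (Set.range w))).addHaar_frontier volume
  have := (volume_preserving_piFinSuccAbove (fun _ => ℂ) i).measure_preimage_equiv H
  rw [ae_iff, ← hH0, ← this]
  congr 1
  ext z
  simp only [not_not, Set.mem_ofPred_eq, Set.mem_preimage, hH, MeasurableEquiv.piFinSuccAbove_apply]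
  rfl

theorem circlePoint_pi : circlePoint 1 (2 * Real.pi / 2) = -1 ∧
    circlePoint 1 (-(2 * Real.pi) / 2) = -1 := by
  constructor <;> apply Complex.ext <;> simp [circlePoint_re, circlePoint_im, neg_div]

/-- The two endpoints of the chord merge as the angle tends to `2π`: in general position, boundary
counts do not change for angles close to `2π`. -/
theorem eventually_outer_eq {n : ℕ} {z : Fin n → ℂ}
    (hz : ∀ i, z i ∈ interior (convexHull ℝ ({-1} ∪ Set.range z)) ∨
      ∃ u : ℂ, 0 < inner ℝ u (-1 - z i) ∧ ∀ j, 0 ≤ inner ℝ u (z j - z i)) :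
    ∀ᶠ t in 𝓝 (2 * Real.pi),
      outer {circlePoint 1 (-t / 2), circlePoint 1 (t / 2)} z = outer {-1} z := by
  have hpair : ∀ t : ℝ, {circlePoint 1 (-t / 2), circlePoint 1 (t / 2)} ∪ Set.range z =
      Set.range (Fin.cons (circlePoint 1 (-t / 2)) (Fin.cons (circlePoint 1 (t / 2)) z) :
        Fin (n + 2) → ℂ) := by
    intro t
    rw [Fin.range_cons, Fin.range_cons, Set.insert_union, Set.singleton_union]
  have hc1 : Continuous fun t : ℝ => circlePoint 1 (-t / 2) :=
    (continuous_circlePoint 1).comp (by fun_prop)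
  have hc2 : Continuous fun t : ℝ => circlePoint 1 (t / 2) :=
    (continuous_circlePoint 1).comp (by fun_prop)
  have hcont : ∀ j : Fin (n + 2), Continuous fun t : ℝ =>
      (Fin.cons (circlePoint 1 (-t / 2)) (Fin.cons (circlePoint 1 (t / 2)) z) :
        Fin (n + 2) → ℂ) j := by
    intro j
    refine Fin.cases ?_ (fun j => Fin.cases ?_ (fun j => ?_) j) j
    · simpa using hc1
    · simpa using hc2
    · simpa using continuous_const
  have hev : ∀ i, ∀ᶠ t in 𝓝 (2 * Real.pi),
      (z i ∉ interior (convexHull ℝ ({circlePoint 1 (-t / 2), circlePoint 1 (t / 2)} ∪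
        Set.range z)) ↔ z i ∉ interior (convexHull ℝ ({-1} ∪ Set.range z))) := by
    intro i
    rcases hz i with h | ⟨u, hu, huz⟩
    · have hcl := isClosed_notMem_interior_convexHull hcont (continuous_const (y := z i))
      have hmem : 2 * Real.pi ∈ {t : ℝ | z i ∉ interior (convexHull ℝ (Set.range fun j =>
          (Fin.cons (circlePoint 1 (-t / 2)) (Fin.cons (circlePoint 1 (t / 2)) z) :
            Fin (n + 2) → ℂ) j))}ᶜ := by
        rw [Set.mem_compl_iff, Set.mem_ofPred_eq, not_not, ← hpair, circlePoint_pi.1,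
          circlePoint_pi.2, Set.pair_eq_singleton]
        exact h
      filter_upwards [hcl.isOpen_compl.mem_nhds hmem] with t ht
      rw [Set.mem_compl_iff, Set.mem_ofPred_eq, not_not, ← hpair] at ht
      simp only [ht, h]
    · have hu0 : u ≠ 0 := by
        rintro rfl
        simp at hu
      have e1 : ∀ᶠ t : ℝ in 𝓝 (2 * Real.pi), 0 < inner ℝ u (circlePoint 1 (-t / 2) - z i) := by
        refine (continuous_const.inner (hc1.sub continuous_const)).continuousAt.eventually
          (lt_mem_nhds ?_)
        change 0 < inner ℝ u (circlePoint 1 (-(2 * Real.pi) / 2) - z i)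
        rw [circlePoint_pi.2]; exact hu
      have e2 : ∀ᶠ t : ℝ in 𝓝 (2 * Real.pi), 0 < inner ℝ u (circlePoint 1 (t / 2) - z i) := by
        refine (continuous_const.inner (hc2.sub continuous_const)).continuousAt.eventually
          (lt_mem_nhds ?_)
        change 0 < inner ℝ u (circlePoint 1 (2 * Real.pi / 2) - z i)
        rw [circlePoint_pi.1]; exact hu
      filter_upwards [e1, e2] with t h1 h2
      refine iff_of_true (notMem_interior_convexHull_of_inner hu0 ?_)
        (notMem_interior_convexHull_of_inner hu0 ?_)
      · rintro q ((rfl | rfl) | ⟨j, rfl⟩)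
        exacts [h1.le, h2.le, huz j]
      · rintro q (rfl | ⟨j, rfl⟩)
        exacts [hu.le, huz j]
  filter_upwards [eventually_all.2 hev] with t ht
  unfold outer
  congr 1
  ext i
  exact ht i

/-- Almost surely, `eventually_outer_eq` applies: no point is on the boundary of the hull of `-1` and
the other points. -/
theorem ae_general_position (n : ℕ) : ∀ᵐ z : Fin n → ℂ, ∀ i,
    z i ∈ interior (convexHull ℝ ({-1} ∪ Set.range z)) ∨
      ∃ u : ℂ, 0 < inner ℝ u (-1 - z i) ∧ ∀ j, 0 ≤ inner ℝ u (z j - z i) := by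
  cases n with
  | zero => exact ae_of_all _ fun z i => i.elim0
  | succ k =>
    filter_upwards [ae_all_iff.2 fun i => ae_notMem_frontier k i (-1)] with z hz i
    set s : Set ℂ := insert (-1) (Set.range fun j => z (i.succAbove j)) with hs
    have hfin : s.Finite := (Set.finite_range _).insert _
    by_cases h : z i ∈ convexHull ℝ s
    · left
      have h1 : z i ∈ interior (convexHull ℝ s) := by
        by_contra h2
        refine hz i ?_
        rw [(hfin.isCompact_convexHull ℝ).isClosed.frontier_eq]
        exact ⟨h, h2⟩
      refine interior_mono (convexHull_mono ?_) h1
      rintro w (rfl | ⟨j, rfl⟩)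
      exacts [Or.inl rfl, Or.inr ⟨_, rfl⟩]
    · right
      obtain ⟨u, hu⟩ := (notMem_convexHull_iff hfin).1 h
      refine ⟨u, hu _ (Or.inl rfl), fun j => ?_⟩
      rcases Fin.eq_self_or_eq_succAbove i j with rfl | ⟨j', rfl⟩
      · simp
      · exact (hu _ (Or.inr ⟨j', rfl⟩)).le

theorem tendsto_segVol (n m : ℕ) : Tendsto (fun t => segVol n m t) (𝓝[<] (2 * Real.pi))
    (𝓝 (hullVol (Metric.closedBall 0 1) {-1} n m)) := by
  have hnear : ∀ᶠ t in 𝓝[<] (2 * Real.pi), 0 < t ∧ t < 2 * Real.pi :=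
    Ioo_mem_nhdsLT (by positivity)
  have hD : MeasurableSet (Metric.closedBall (0 : ℂ) 1) := Metric.isClosed_closedBall.measurableSet
  -- outside `(0, 2π)`, the events are replaced by the empty set, to make them all measurable
  set A : ℝ → Set (Fin n → ℂ) := fun t => {z | (0 < t ∧ t < 2 * Real.pi) ∧ (∀ i, z i ∈ seg t 1) ∧
    outer {circlePoint 1 (-t / 2), circlePoint 1 (t / 2)} z = m} with hA
  have hAm : ∀ t, MeasurableSet (A t) := by
    intro t
    by_cases ht : 0 < t ∧ t < 2 * Real.pi
    · have := measurableSet_outer_eq (ι := Fin n) (isClosed_seg ht.1 ht.2 one_pos).measurableSet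
        (T := {circlePoint 1 (-t / 2), circlePoint 1 (t / 2)}) (by simp) m
      simpa only [hA, ht.1, ht.2, and_self, true_and] using this
    · simp [hA, ht]
  have hlim : Tendsto (fun t => volume (A t)) (𝓝[<] (2 * Real.pi))
      (𝓝 (hullVol (Metric.closedBall 0 1) {-1} n m)) := by
    refine tendsto_measure_of_ae_tendsto_indicator (𝓝[<] (2 * Real.pi))
      (measurableSet_outer_eq hD (by simp) m) hAm
      (B := Set.univ.pi fun _ => Metric.closedBall 0 1) (MeasurableSet.univ_pi fun _ => hD) ?_ ?_ ?_
    · rw [volume_pi_pi]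
      exact ENNReal.prod_ne_top fun _ _ => measure_closedBall_lt_top.ne
    · filter_upwards with t z hz i _
      have := hz.2.1 i
      rw [seg_eq hz.1.1 hz.1.2 one_pos] at this
      simpa using this.1
    · have hsph : ∀ᵐ z : Fin n → ℂ, ∀ i, ‖z i‖ ≠ 1 := by
        refine ae_all_iff.2 fun i => ?_
        exact (Measure.quasiMeasurePreserving_eval (fun _ => (volume : Measure ℂ)) i).ae
          (p := fun w => ‖w‖ ≠ 1) ae_norm_ne_one
      filter_upwards [ae_general_position n, hsph] with z hz hzs
      have hseg : ∀ i, ∀ᶠ t in 𝓝[<] (2 * Real.pi),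
          (z i ∈ seg t 1 ↔ z i ∈ Metric.closedBall (0 : ℂ) 1) := by
        intro i
        have hcos : Tendsto (fun t => Real.cos (t / 2)) (𝓝[<] (2 * Real.pi)) (𝓝 (-1)) := by
          have : Continuous fun t => Real.cos (t / 2) := by fun_prop
          have h2 := this.tendsto (2 * Real.pi)
          rw [mul_div_cancel_left₀ _ two_ne_zero, Real.cos_pi] at h2
          exact h2.mono_left nhdsWithin_le_nhds
        by_cases hi : ‖z i‖ ≤ 1
        · have hlt : ‖z i‖ < 1 := lt_of_le_of_ne hi (hzs i)
          have hre : -1 < (z i).re :=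
            (abs_lt.1 ((Complex.abs_re_le_norm _).trans_lt hlt)).1
          filter_upwards [hnear, hcos.eventually (gt_mem_nhds hre)] with t ht hc
          rw [seg_eq ht.1 ht.2 one_pos]
          simp [hi, hc.le]
        · filter_upwards [hnear] with t ht
          rw [seg_eq ht.1 ht.2 one_pos]
          simp [hi]
      filter_upwards [hnear, eventually_all.2 hseg,
        (eventually_outer_eq hz).filter_mono nhdsWithin_le_nhds] with t ht h1 h2
      simp only [hA, Set.mem_ofPred_eq, h1, h2, ht.1, ht.2, and_self, true_and]
  refine hlim.congr' ?_
  filter_upwards [hnear] with t ht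
  simp only [hA, ht.1, ht.2, and_self, true_and]
  rfl

theorem tendsto_B {R : ℝ} (hR : 0 < R) (c : ℂ) {r : ℝ} (hr : 0 < r) (n m : ℕ) :
    Tendsto (fun t => B R n m t) (𝓝[<] (2 * Real.pi))
      (𝓝 (hullProb (Metric.closedBall c r) (n + 1) (m + 1))) := by
  rw [hullProb_closedBall c hr]
  simp only [Nat.add_eq_zero_iff, one_ne_zero, and_false, if_false, Nat.add_sub_cancel]
  have h1 := (ENNReal.tendsto_toReal
    (hullVol_ne_top_and_le (S := Metric.closedBall (0 : ℂ) 1) measure_closedBall_lt_top.ne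
      {-1} n m).1).comp (tendsto_segVol n m)
  have h2 : Tendsto (fun t => ((t - Real.sin t) / 2) ^ n) (𝓝[<] (2 * Real.pi))
      (𝓝 (Real.pi ^ n)) := by
    have : Continuous fun t => ((t - Real.sin t) / 2) ^ n := by fun_prop
    have h := this.tendsto (2 * Real.pi)
    rw [Real.sin_two_pi, sub_zero, mul_div_cancel_left₀ _ two_ne_zero] at h
    exact h.mono_left nhdsWithin_le_nhds
  refine (h1.div h2 (by positivity)).congr' ?_
  have hnear : ∀ᶠ t in 𝓝[<] (2 * Real.pi), 0 < t ∧ t < 2 * Real.pi :=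
    Ioo_mem_nhdsLT (by positivity)
  filter_upwards [hnear] with t ht
  rw [B_eq ht.1 ht.2 hR]
  rfl

/-! ### The limit of the recursion at angle `2π` -/

theorem integral_cos_div_sin_pow {N : ℕ} (hN : N ≠ 0) {a b : ℝ} (h0 : 0 < a) (hab : a ≤ b)
    (h1 : b < 2 * Real.pi) :
    IntervalIntegrable (fun φ => -Real.cos (φ / 2) / Real.sin (φ / 2) ^ (2 * N + 1)) volume a b ∧
    ∫ φ in a..b, -Real.cos (φ / 2) / Real.sin (φ / 2) ^ (2 * N + 1) =
      ((Real.sin (b / 2) ^ (2 * N))⁻¹ - (Real.sin (a / 2) ^ (2 * N))⁻¹) / N := by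
  have hs : ∀ x ∈ Set.uIcc a b, Real.sin (x / 2) ≠ 0 := fun x hx => by
    rw [Set.uIcc_of_le hab] at hx
    exact (Real.sin_pos_of_pos_of_lt_pi (by linarith [hx.1]) (by linarith [hx.2])).ne'
  have hN' : (N : ℝ) ≠ 0 := by exact_mod_cast hN
  have hd : ∀ x ∈ Set.uIcc a b, HasDerivAt (fun x => (Real.sin (x / 2) ^ (2 * N))⁻¹ / N)
      (-Real.cos (x / 2) / Real.sin (x / 2) ^ (2 * N + 1)) x := fun x hx => by
    have hsx := hs x hx
    have h2 : HasDerivAt (fun x : ℝ => Real.sin (x / 2)) (Real.cos (x / 2) * (1 / 2)) x :=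
      ((hasDerivAt_id x).div_const 2).sin
    refine (((h2.pow (2 * N)).inv (pow_ne_zero _ hsx)).div_const (N : ℝ)).congr_deriv ?_
    obtain ⟨k, rfl⟩ := Nat.exists_eq_succ_of_ne_zero hN
    rw [show 2 * k.succ - 1 = 2 * k + 1 by omega, show 2 * k.succ = 2 * k + 2 by omega]
    rw [Pi.pow_apply]
    push_cast
    field_simp
    ring
  have hi : IntervalIntegrable (fun φ => -Real.cos (φ / 2) / Real.sin (φ / 2) ^ (2 * N + 1))
      volume a b := by
    refine ContinuousOn.intervalIntegrable fun x hx => ContinuousAt.continuousWithinAt ?_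
    exact ContinuousAt.div (by fun_prop) (by fun_prop) (pow_ne_zero _ (hs x hx))
  refine ⟨hi, ?_⟩
  rw [intervalIntegral.integral_eq_sub_of_hasDerivAt hd hi, sub_div]

/-- As `θ → 2π`, the mass of the integral concentrates near `θ`. This is l'Hôpital's rule, in the
form `∞ / ∞`. -/
theorem tendsto_sin_pow_mul_integral {N : ℕ} (hN : N ≠ 0) {F : ℝ → ℝ} {ℓ : ℝ}
    (hF : Tendsto F (𝓝[<] (2 * Real.pi)) (𝓝 ℓ))
    (hi : ∀ θ ∈ Set.Ioo 0 (2 * Real.pi),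
      IntervalIntegrable (fun φ => F φ / Real.sin (φ / 2) ^ (2 * N + 1)) volume 0 θ) :
    Tendsto (fun θ => Real.sin (θ / 2) ^ (2 * N) *
      ∫ φ in (0 : ℝ)..θ, F φ / Real.sin (φ / 2) ^ (2 * N + 1)) (𝓝[<] (2 * Real.pi))
      (𝓝 (ℓ / N)) := by
  have hπ := Real.pi_pos
  have hN' : (1 : ℝ) ≤ N := by exact_mod_cast Nat.one_le_iff_ne_zero.2 hN
  have hcos : Tendsto (fun t => Real.cos (t / 2)) (𝓝[<] (2 * Real.pi)) (𝓝 (-1)) := by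
    have : Continuous fun t => Real.cos (t / 2) := by fun_prop
    have h2 := this.tendsto (2 * Real.pi)
    rw [mul_div_cancel_left₀ _ two_ne_zero, Real.cos_pi] at h2
    exact h2.mono_left nhdsWithin_le_nhds
  have hsin : Tendsto (fun t => Real.sin (t / 2) ^ (2 * N)) (𝓝[<] (2 * Real.pi)) (𝓝 0) := by
    have : Continuous fun t => Real.sin (t / 2) ^ (2 * N) := by fun_prop
    have h2 := this.tendsto (2 * Real.pi)
    rw [mul_div_cancel_left₀ _ two_ne_zero, Real.sin_pi, zero_pow (by omega)] at h2
    exact h2.mono_left nhdsWithin_le_nhds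
  rw [Metric.tendsto_nhds]
  intro ε hε
  have hev : ∀ᶠ φ in 𝓝[<] (2 * Real.pi), |F φ + ℓ * Real.cos (φ / 2)| ≤
      ε / 2 * -Real.cos (φ / 2) := by
    have h1 : Tendsto (fun φ => |F φ + ℓ * Real.cos (φ / 2)| - ε / 2 * -Real.cos (φ / 2))
        (𝓝[<] (2 * Real.pi)) (𝓝 (|ℓ + ℓ * -1| - ε / 2 * - -1)) :=
      (hF.add (hcos.const_mul ℓ)).abs.sub (hcos.neg.const_mul _)
    have h2 : |ℓ + ℓ * -1| - ε / 2 * - -1 < 0 := by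
      rw [show ℓ + ℓ * -1 = 0 by ring, abs_zero]; linarith
    filter_upwards [h1.eventually (gt_mem_nhds h2)] with φ h
    linarith
  obtain ⟨a', ha', hsub⟩ := (mem_nhdsLT_iff_exists_Ioo_subset' (show (0 : ℝ) < 2 * Real.pi by
    positivity)).1 hev
  obtain ⟨a, ha1, ha2⟩ := exists_between (max_lt ha' (show (0 : ℝ) < 2 * Real.pi by positivity))
  have ha0 : 0 < a := (le_max_right _ _).trans_lt ha1
  have haa : a' < a := (le_max_left _ _).trans_lt ha1
  set J := ∫ φ in (0 : ℝ)..a, F φ / Real.sin (φ / 2) ^ (2 * N + 1) with hJ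
  set C := J - ℓ * ((Real.sin (a / 2) ^ (2 * N))⁻¹ / N) with hC
  have hsmall : ∀ᶠ θ in 𝓝[<] (2 * Real.pi), |Real.sin (θ / 2) ^ (2 * N) * C| < ε / 2 := by
    have := (hsin.mul_const C).abs
    rw [zero_mul, abs_zero] at this
    exact this.eventually (gt_mem_nhds (by positivity))
  filter_upwards [hsmall, Ioo_mem_nhdsLT ha2] with θ hθ haθ
  have hθ0 : 0 < θ := ha0.trans haθ.1
  have hs := sin_half_pos hθ0 haθ.2
  obtain ⟨hwi, hwv⟩ := integral_cos_div_sin_pow hN ha0 haθ.1.le haθ.2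
  have hia := hi a ⟨ha0, ha2⟩
  have hiθ : IntervalIntegrable (fun φ => F φ / Real.sin (φ / 2) ^ (2 * N + 1)) volume a θ :=
    hia.symm.trans (hi θ ⟨hθ0, haθ.2⟩)
  have hsplit := intervalIntegral.integral_add_adjacent_intervals hia hiθ
  set K := ∫ φ in a..θ, F φ / Real.sin (φ / 2) ^ (2 * N + 1) with hK
  have hdiff : |K - ℓ * (((Real.sin (θ / 2) ^ (2 * N))⁻¹ - (Real.sin (a / 2) ^ (2 * N))⁻¹) / N)| ≤
      ε / 2 * (((Real.sin (θ / 2) ^ (2 * N))⁻¹ - (Real.sin (a / 2) ^ (2 * N))⁻¹) / N) := by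
    rw [← hwv, hK, ← intervalIntegral.integral_const_mul, ← intervalIntegral.integral_const_mul,
      ← intervalIntegral.integral_sub hiθ (hwi.const_mul ℓ), ← Real.norm_eq_abs]
    refine intervalIntegral.norm_integral_le_of_norm_le haθ.1.le (ae_of_all _ fun φ hφ => ?_)
      (hwi.const_mul _)
    have h2 : φ ∈ Set.Ioo a' (2 * Real.pi) := ⟨haa.trans hφ.1, hφ.2.trans_lt haθ.2⟩
    have h3 : |F φ + ℓ * Real.cos (φ / 2)| ≤ ε / 2 * -Real.cos (φ / 2) := hsub h2
    have h4 := sin_half_pos (ha0.trans hφ.1) h2.2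
    rw [Real.norm_eq_abs, ← mul_div_assoc, ← sub_div, ← mul_div_assoc, abs_div,
      abs_of_pos (pow_pos h4 _)]
    refine div_le_div_of_nonneg_right ?_ (by positivity)
    rwa [mul_neg, sub_neg_eq_add]
  have hga : 0 ≤ (Real.sin (a / 2) ^ (2 * N))⁻¹ / N := by
    rw [pow_mul]; positivity
  set S := Real.sin (θ / 2) ^ (2 * N) with hS
  have hSpos : 0 < S := pow_pos hs _
  rw [Real.dist_eq, ← hsplit]
  have e : S * (J + K) - ℓ / N = S * C +
      S * (K - ℓ * ((S⁻¹ - (Real.sin (a / 2) ^ (2 * N))⁻¹) / N)) := by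
    have : S * S⁻¹ = 1 := mul_inv_cancel₀ hSpos.ne'
    rw [hC]
    linear_combination (ℓ / N) * this
  have hlast : |S * (K - ℓ * ((S⁻¹ - (Real.sin (a / 2) ^ (2 * N))⁻¹) / N))| ≤ ε / 2 := by
    rw [abs_mul, abs_of_pos hSpos]
    have h5 : ε / 2 * ((S⁻¹ - (Real.sin (a / 2) ^ (2 * N))⁻¹) / N) ≤ ε / 2 * S⁻¹ := by
      refine mul_le_mul_of_nonneg_left ?_ (by positivity)
      rw [sub_div]
      have := div_le_self (inv_nonneg.2 hSpos.le) hN'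
      linarith
    calc _ ≤ S * (ε / 2 * S⁻¹) := mul_le_mul_of_nonneg_left (hdiff.trans h5) hSpos.le
      _ = ε / 2 := by field_simp
  rw [e]
  exact (abs_add_le _ _).trans_lt (by linarith)

/-- The inner integral of the recursion, without the powers of sines. -/
noncomputable def innerIntegral (R : ℝ) (n m : ℕ) (φ : ℝ) : ℝ :=
  ∫ η in (0 : ℝ)..φ, convThree (L R) n m φ η

theorem integral_recKernel (R : ℝ) (n m : ℕ) (θ φ : ℝ) :
    ∫ η in (0 : ℝ)..φ, recKernel (L R) n m θ φ η = Real.sin (θ / 2) ^ (2 * (n + 1) + 1) *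
      (innerIntegral R n m φ / Real.sin (φ / 2) ^ (2 * (n + 1) + 1)) := by
  unfold recKernel innerIntegral
  rw [intervalIntegral.integral_const_mul]
  ring

/-- The part of the recursion that survives at angle `2π`, where the two chords are equal, so that
the triangle between them is flat. -/
theorem convThree_two_pi (u : ℕ → ℕ → ℝ → ℝ) (n m : ℕ) (η : ℝ) :
    convThree u n m (2 * Real.pi) η = ∑ a ∈ Finset.HasAntidiagonal.antidiagonal n,
      ∑ b ∈ Finset.HasAntidiagonal.antidiagonal m,
        u a.1 b.1 η * u a.2 b.2 (2 * Real.pi - η) := by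
  rw [convThree, sum_antidiagonalTuple_three]
  refine Finset.sum_congr rfl fun k _ => ?_
  rw [Finset.sum_eq_single (k.2, 0)]
  · simp
  · rintro ⟨l1, l2⟩ hl hne
    rw [Finset.HasAntidiagonal.mem_antidiagonal] at hl
    have : l2 ≠ 0 := by
      rintro rfl
      exact hne (by simp at hl; rw [hl])
    simp [this]
  · intro h
    simp at h

section
variable {R : ℝ} (hR : 0 < R)
include hR

theorem intervalIntegrable_innerIntegral_div (n m : ℕ) {θ : ℝ}
    (hθ : θ ∈ Set.Ioo 0 (2 * Real.pi)) :
    IntervalIntegrable (fun φ => innerIntegral R n m φ / Real.sin (φ / 2) ^ (2 * (n + 1) + 1))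
      volume 0 θ := by
  have h := (recursion hθ.1 hθ.2 hR n m).1
  have hs : Real.sin (θ / 2) ^ (2 * (n + 1) + 1) ≠ 0 := (pow_pos (sin_half_pos hθ.1 hθ.2) _).ne'
  simp only [integral_recKernel] at h
  refine (h.const_mul (Real.sin (θ / 2) ^ (2 * (n + 1) + 1))⁻¹).congr ?_
  exact fun φ _ => inv_mul_cancel_left₀ hs _

theorem L_succ_succ (n m : ℕ) {θ : ℝ} (hθ : θ ∈ Set.Ioo 0 (2 * Real.pi)) :
    L R (n + 1) (m + 1) θ = 2 * Real.sin (θ / 2) ^ (2 * (n + 1) + 1) *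
      ∫ φ in (0 : ℝ)..θ, innerIntegral R n m φ / Real.sin (φ / 2) ^ (2 * (n + 1) + 1) := by
  have h := (recursion hθ.1 hθ.2 hR n m).2
  simp only [integral_recKernel, intervalIntegral.integral_const_mul] at h
  linarith

/-- By the recursion, `L` is the product of a power of a sine and a primitive. -/
theorem continuousAt_LExt (n m : ℕ) {θ : ℝ} (hθ : θ ∈ Set.Ioo 0 (2 * Real.pi)) :
    ContinuousAt (LExt R n m) θ := by
  have hnear : Set.Ioo 0 (2 * Real.pi) ∈ 𝓝 θ := Ioo_mem_nhds hθ.1 hθ.2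
  rcases n with - | n
  · rcases m with - | m
    · have : Continuous fun t : ℝ => Real.sin (t / 2) := by fun_prop
      refine this.continuousAt.congr ?_
      filter_upwards [hnear] with t ht
      rw [LExt_eq ht.1 ht.2, L_zero_zero hR ht.1 ht.2]
    · refine (continuousAt_const (y := (0 : ℝ))).congr ?_
      filter_upwards [hnear] with t ht
      rw [LExt_eq ht.1 ht.2, L_eq_zero_of_lt hR (Nat.succ_pos m) ht.1 ht.2]
  · rcases m with - | m
    · refine (continuousAt_const (y := (0 : ℝ))).congr ?_
      filter_upwards [hnear] with t ht
      rw [LExt_eq ht.1 ht.2, L_succ_zero hR n ht.1 ht.2]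
    · obtain ⟨b, hb, hb2⟩ := exists_between hθ.2
      have hb0 : 0 < b := hθ.1.trans hb
      have hi := intervalIntegrable_innerIntegral_div hR n m ⟨hb0, hb2⟩
      have hc := (intervalIntegral.continuousOn_primitive_interval' hi
        (a := 0) (Set.left_mem_uIcc)).continuousAt
        (by rw [Set.uIcc_of_le hb0.le]; exact Icc_mem_nhds hθ.1 hb)
      have hs : Continuous fun t : ℝ => 2 * Real.sin (t / 2) ^ (2 * (n + 1) + 1) := by fun_prop
      refine (hs.continuousAt.mul hc).congr ?_
      filter_upwards [hnear] with t ht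
      rw [LExt_eq ht.1 ht.2, L_succ_succ hR n m ht]
      rfl

/-- `LExt` vanishes at negative numbers, which makes the domain of integration independent of `φ`. -/
theorem innerIntegral_eq (n m : ℕ) {φ : ℝ} (hφ : φ ∈ Set.Ioo 0 (2 * Real.pi)) :
    innerIntegral R n m φ = ∫ η in (0 : ℝ)..(2 * Real.pi), convThree (LExt R) n m φ η := by
  have h1 : innerIntegral R n m φ = ∫ η in (0 : ℝ)..φ, convThree (LExt R) n m φ η :=
    intervalIntegral_congr_Ioo hφ.1.le fun η hη => convThree_LExt hη.1 hη.2 hφ.2 n m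
  have h2 : Set.EqOn (convThree (LExt R) n m φ) 0 (Set.Icc φ (2 * Real.pi)) := by
    intro η hη
    refine Finset.sum_eq_zero fun a _ => Finset.sum_eq_zero fun b _ => ?_
    have : LExt R (a 1) b.2 (φ - η) = 0 :=
      Set.indicator_of_notMem (fun h => by linarith [h.1, hη.1]) _
    rw [this, mul_zero]
  have hm := measurable_convThree_LExt hR n m φ
  have hb := exists_bound_convThree_LExt hR n m φ
  rw [h1, ← intervalIntegral.integral_add_adjacent_intervals (b := φ)
    (intervalIntegrable_of_bound hφ.1.le hm hb fun _ _ => rfl)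
    (intervalIntegrable_of_bound hφ.2.le hm hb fun _ _ => rfl)]
  have h4 : ∫ η in φ..(2 * Real.pi), convThree (LExt R) n m φ η = 0 := by
    rw [intervalIntegral.integral_congr (g := fun _ => (0 : ℝ))
      (by rw [Set.uIcc_of_le hφ.2.le]; exact h2)]
    simp
  rw [h4, add_zero]

theorem tendsto_innerIntegral (n m : ℕ) :
    Tendsto (innerIntegral R n m) (𝓝[<] (2 * Real.pi))
      (𝓝 (∫ η in (0 : ℝ)..(2 * Real.pi), convThree (LExt R) n m (2 * Real.pi) η)) := by
  have hπ := Real.pi_pos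
  obtain ⟨C, hC⟩ := exists_bound_convThree (exists_bound_LExt hR) n m
  have hlim : Tendsto (fun φ => ∫ η in (0 : ℝ)..(2 * Real.pi), convThree (LExt R) n m φ η)
      (𝓝[<] (2 * Real.pi))
      (𝓝 (∫ η in (0 : ℝ)..(2 * Real.pi), convThree (LExt R) n m (2 * Real.pi) η)) := by
    refine intervalIntegral.tendsto_integral_filter_of_dominated_convergence (fun _ => C) ?_ ?_
      intervalIntegrable_const ?_
    · exact Eventually.of_forall fun φ =>
        (measurable_convThree_LExt hR n m φ).aestronglyMeasurable
    · exact Eventually.of_forall fun φ => ae_of_all _ fun η _ => by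
        simpa only [Real.norm_eq_abs] using hC (φ, η)
    · have hne : ∀ᵐ η : ℝ, η ≠ 2 * Real.pi := by simp [ae_iff]
      filter_upwards [hne] with η hη hη'
      rw [Set.uIoc_of_le (by positivity)] at hη'
      have hη2 : η < 2 * Real.pi := lt_of_le_of_ne hη'.2 hη
      unfold convThree
      refine tendsto_finsetSum _ fun a _ => tendsto_finsetSum _ fun b _ => ?_
      refine Tendsto.mul (Tendsto.mul ?_ tendsto_const_nhds) ?_
      · have : Continuous fun φ => (Real.sin η + Real.sin (φ - η) - Real.sin φ) ^ (a 2) /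
          ((a 2).factorial : ℝ) := by fun_prop
        exact (this.tendsto _).mono_left nhdsWithin_le_nhds
      · have h1 : ContinuousAt (LExt R (a 1) b.2) (2 * Real.pi - η) :=
          continuousAt_LExt hR _ _ ⟨by linarith, by linarith [hη'.1]⟩
        have h2 : Tendsto (fun φ : ℝ => φ - η) (𝓝[<] (2 * Real.pi)) (𝓝 (2 * Real.pi - η)) :=
          ((continuous_id.sub continuous_const).tendsto _).mono_left nhdsWithin_le_nhds
        exact h1.tendsto.comp h2
  refine hlim.congr' ?_
  filter_upwards [Ioo_mem_nhdsLT (show (0 : ℝ) < 2 * Real.pi by positivity)] with φ hφ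
  rw [innerIntegral_eq hR n m hφ]

theorem tendsto_B_two_pi (n m : ℕ) :
    Tendsto (fun t => B R (n + 1) (m + 1) t) (𝓝[<] (2 * Real.pi))
      (𝓝 ((n.factorial : ℝ) / (2 ^ n * Real.pi ^ (n + 1)) *
        ∫ η in (0 : ℝ)..(2 * Real.pi), convThree (LExt R) n m (2 * Real.pi) η)) := by
  have hπ := Real.pi_pos
  have h1 := tendsto_sin_pow_mul_integral (N := n + 1) n.succ_ne_zero (tendsto_innerIntegral hR n m)
    fun θ hθ => intervalIntegrable_innerIntegral_div hR n m hθ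
  have h2 : Tendsto (fun t => ((n + 1).factorial : ℝ) * 2 / (t - Real.sin t) ^ (n + 1))
      (𝓝[<] (2 * Real.pi)) (𝓝 (((n + 1).factorial : ℝ) * 2 / (2 * Real.pi) ^ (n + 1))) := by
    have : Continuous fun t => (t - Real.sin t) ^ (n + 1) := by fun_prop
    have h := this.tendsto (2 * Real.pi)
    rw [Real.sin_two_pi, sub_zero] at h
    exact tendsto_const_nhds.div (h.mono_left nhdsWithin_le_nhds) (by positivity)
  have h3 := h2.mul h1
  have e : ∀ I : ℝ, ((n + 1).factorial : ℝ) * 2 / (2 * Real.pi) ^ (n + 1) * (I / (n + 1 : ℕ)) =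
      (n.factorial : ℝ) / (2 ^ n * Real.pi ^ (n + 1)) * I := fun I => by
    rw [Nat.factorial_succ, mul_pow]
    push_cast
    field_simp
    ring
  rw [e] at h3
  refine h3.congr' ?_
  filter_upwards [Ioo_mem_nhdsLT (show (0 : ℝ) < 2 * Real.pi by positivity)] with t ht
  have h4 := L_succ_succ hR n m ht
  have hs := sin_half_pos ht.1 ht.2
  have hd : 0 < t - Real.sin t := sub_pos.2 (Real.sin_lt ht.1)
  set J := ∫ φ in (0 : ℝ)..t, innerIntegral R n m φ / Real.sin (φ / 2) ^ (2 * (n + 1) + 1)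
  rw [L, div_eq_iff (by positivity), pow_succ (Real.sin (t / 2))] at h4
  have h5 : B R (n + 1) (m + 1) t * (t - Real.sin t) ^ (n + 1) =
      2 * Real.sin (t / 2) ^ (2 * (n + 1)) * J * (n + 1).factorial := by
    refine mul_right_cancel₀ hs.ne' ?_
    rw [h4]; ring
  rw [div_mul_eq_mul_div, div_eq_iff (by positivity), h5]
  ring

end

/-! ### Convex position -/

/-- In convex position, no point is in the triangle between the two chords, and all the points of
the two smaller segments are on the hull. -/
theorem convThree_diag {R : ℝ} (hR : 0 < R) (n : ℕ) {φ η : ℝ} (h0 : 0 < η) (h1 : η < φ)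
    (h2 : φ ≤ 2 * Real.pi) :
    convThree (L R) n n φ η =
      ∑ k ∈ Finset.range (n + 1), L R k k η * L R (n - k) (n - k) (φ - η) := by
  have z1 : ∀ k l, k < l → L R k l η = 0 := fun k l h =>
    L_eq_zero_of_lt hR h h0 (h1.trans_le h2)
  have z2 : ∀ k l, k < l → L R k l (φ - η) = 0 := fun k l h =>
    L_eq_zero_of_lt hR h (by linarith) (by linarith)
  rw [convThree, sum_antidiagonalTuple_three,
    ← Finset.Nat.sum_antidiagonal_eq_sum_range_succ (fun k l => L R k k η * L R l l (φ - η))]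
  refine Finset.sum_congr rfl fun k hk => ?_
  rw [Finset.HasAntidiagonal.mem_antidiagonal] at hk
  have hz : ∀ l b : ℕ × ℕ, l.1 + l.2 = k.2 → b.1 + b.2 = n → (l ≠ (k.2, 0) ∨ b ≠ k) →
      L R k.1 b.1 η * L R l.1 b.2 (φ - η) = 0 := by
    intro l b hl hb hne
    by_cases hlt : k.1 < b.1
    · rw [z1 _ _ hlt, zero_mul]
    · by_cases hlt2 : l.1 < b.2
      · rw [z2 _ _ hlt2, mul_zero]
      · simp only [ne_eq, Prod.ext_iff] at hne
        omega
  rw [Finset.sum_eq_single (k.2, 0), Finset.sum_eq_single k]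
  · simp
  · intro b hb hne
    rw [Finset.HasAntidiagonal.mem_antidiagonal] at hb
    rw [mul_assoc]
    exact mul_eq_zero_of_right _ (hz (k.2, 0) b (by simp) hb (Or.inr hne))
  · intro h
    simp [hk] at h
  · intro l hl hne
    rw [Finset.HasAntidiagonal.mem_antidiagonal] at hl
    refine Finset.sum_eq_zero fun b hb => ?_
    rw [Finset.HasAntidiagonal.mem_antidiagonal] at hb
    rw [mul_assoc]
    exact mul_eq_zero_of_right _ (hz l b hl hb (Or.inl hne))
  · intro h
    simp at h

theorem filter_range_product_eq_antidiagonal (m : ℕ) :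
    (Finset.range (m + 2) ×ˢ Finset.range (m + 2)).filter (fun b => b.1 + b.2 + 2 = m + 2) =
      Finset.HasAntidiagonal.antidiagonal m := by
  ext b
  simp only [Finset.mem_filter, Finset.mem_product, Finset.mem_range,
    Finset.HasAntidiagonal.mem_antidiagonal]
  omega

theorem convThree_LExt_two_pi (R : ℝ) (n m : ℕ) : Set.EqOn
    (fun φ => ∑ a ∈ Finset.HasAntidiagonal.antidiagonal n,
      ∑ b ∈ Finset.HasAntidiagonal.antidiagonal m, L R a.1 b.1 φ * L R a.2 b.2 (2 * Real.pi - φ))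
    (fun φ => convThree (LExt R) n m (2 * Real.pi) φ) (Set.Ioo 0 (2 * Real.pi)) := by
  intro φ hφ
  simp only [convThree_two_pi]
  refine Finset.sum_congr rfl fun a _ => Finset.sum_congr rfl fun b _ => ?_
  rw [LExt_eq hφ.1 hφ.2, LExt_eq (by linarith [hφ.2]) (by linarith [hφ.1])]

section
variable {R : ℝ} (hR : 0 < R)
include hR

/-- At angle `2π`, the endpoints of the chord are one point of the circle, and the chord from it to
the point of largest `arcKey` cuts the disk into two complementary circular segments. -/
theorem hullProb_eq_integral (c : ℂ) {r : ℝ} (hr : 0 < r) (n m : ℕ) :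
    IntervalIntegrable (fun φ => ∑ a ∈ Finset.HasAntidiagonal.antidiagonal n,
      ∑ b ∈ Finset.HasAntidiagonal.antidiagonal m, L R a.1 b.1 φ * L R a.2 b.2 (2 * Real.pi - φ))
      volume 0 (2 * Real.pi) ∧
    hullProb (Metric.closedBall c r) (n + 2) (m + 2) =
      (n.factorial : ℝ) / (2 ^ n * Real.pi ^ (n + 1)) *
        ∫ φ in (0 : ℝ)..(2 * Real.pi), ∑ a ∈ Finset.HasAntidiagonal.antidiagonal n,
          ∑ b ∈ Finset.HasAntidiagonal.antidiagonal m,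
            L R a.1 b.1 φ * L R a.2 b.2 (2 * Real.pi - φ) := by
  have hπ : 0 ≤ 2 * Real.pi := by positivity
  refine ⟨intervalIntegrable_of_bound hπ (measurable_convThree_LExt hR n m _)
    (exists_bound_convThree_LExt hR n m _) (convThree_LExt_two_pi R n m), ?_⟩
  rw [intervalIntegral_congr_Ioo hπ (convThree_LExt_two_pi R n m)]
  exact tendsto_nhds_unique (tendsto_B hR c hr (n + 1) (m + 1)) (tendsto_B_two_pi hR n m)

theorem hullProb_eq_integral_diag (c : ℂ) {r : ℝ} (hr : 0 < r) (n : ℕ) :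
    IntervalIntegrable (fun φ => ∑ k ∈ Finset.range (n + 1),
      L R k k φ * L R (n - k) (n - k) (2 * Real.pi - φ)) volume 0 (2 * Real.pi) ∧
    hullProb (Metric.closedBall c r) (n + 2) (n + 2) =
      (n.factorial : ℝ) / (2 ^ n * Real.pi ^ (n + 1)) *
        ∫ φ in (0 : ℝ)..(2 * Real.pi), ∑ k ∈ Finset.range (n + 1),
          L R k k φ * L R (n - k) (n - k) (2 * Real.pi - φ) := by
  have hπ : 0 ≤ 2 * Real.pi := by positivity
  obtain ⟨h1, h2⟩ := hullProb_eq_integral hR c hr n n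
  have he : Set.EqOn (fun φ => ∑ a ∈ Finset.HasAntidiagonal.antidiagonal n,
      ∑ b ∈ Finset.HasAntidiagonal.antidiagonal n, L R a.1 b.1 φ * L R a.2 b.2 (2 * Real.pi - φ))
      (fun φ => ∑ k ∈ Finset.range (n + 1), L R k k φ * L R (n - k) (n - k) (2 * Real.pi - φ))
      (Set.Ioo 0 (2 * Real.pi)) := fun φ hφ => by
    simp only
    rw [← convThree_two_pi, convThree_diag hR n hφ.1 hφ.2 le_rfl]
  rw [← intervalIntegral_congr_Ioo hπ he]
  refine ⟨?_, h2⟩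
  rw [intervalIntegrable_iff_integrableOn_Ioo_of_le hπ] at h1 ⊢
  exact h1.congr_fun he measurableSet_Ioo

/-- With at least two points, one extreme point has probability zero. -/
theorem hullProb_one (c : ℂ) {r : ℝ} (hr : 0 < r) (n : ℕ) :
    hullProb (Metric.closedBall c r) (n + 2) 1 = 0 := by
  refine tendsto_nhds_unique (tendsto_B hR c hr (n + 1) 0) (tendsto_const_nhds.congr' ?_)
  filter_upwards [Ioo_mem_nhdsLT (show (0 : ℝ) < 2 * Real.pi by positivity)] with t ht
  rw [B_eq ht.1 ht.2 hR, segVol_succ_zero ht.1 ht.2]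
  simp

theorem recursion_diag {θ : ℝ} (h0 : 0 < θ) (h1 : θ < 2 * Real.pi) (n : ℕ) :
    (∀ φ ∈ Set.Ioo (0 : ℝ) θ, IntervalIntegrable (fun η => ∑ k ∈ Finset.range (n + 1),
      L R k k η * L R (n - k) (n - k) (φ - η)) volume 0 φ) ∧
    IntervalIntegrable (fun φ =>
      Real.sin (θ / 2) ^ (2 * (n + 1) + 1) / Real.sin (φ / 2) ^ (2 * (n + 1) + 1) *
        ∫ η in (0 : ℝ)..φ, ∑ k ∈ Finset.range (n + 1),
          L R k k η * L R (n - k) (n - k) (φ - η)) volume 0 θ ∧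
    L R (n + 1) (n + 1) θ / 2 = ∫ φ in (0 : ℝ)..θ,
      Real.sin (θ / 2) ^ (2 * (n + 1) + 1) / Real.sin (φ / 2) ^ (2 * (n + 1) + 1) *
        ∫ η in (0 : ℝ)..φ, ∑ k ∈ Finset.range (n + 1),
          L R k k η * L R (n - k) (n - k) (φ - η) := by
  have he : ∀ φ ∈ Set.Ioo 0 θ, Set.EqOn (fun η => convThree (LExt R) n n φ η)
      (fun η => ∑ k ∈ Finset.range (n + 1), L R k k η * L R (n - k) (n - k) (φ - η))
      (Set.Ioo 0 φ) := fun φ hφ η hη => by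
    simp only
    rw [← convThree_LExt hη.1 hη.2 (hφ.2.trans h1),
      convThree_diag hR n hη.1 hη.2 (hφ.2.trans h1).le]
  have hI : Set.EqOn (fun φ => ∫ η in (0 : ℝ)..φ, recKernel (L R) n n θ φ η) (fun φ =>
      Real.sin (θ / 2) ^ (2 * (n + 1) + 1) / Real.sin (φ / 2) ^ (2 * (n + 1) + 1) *
        ∫ η in (0 : ℝ)..φ, ∑ k ∈ Finset.range (n + 1),
          L R k k η * L R (n - k) (n - k) (φ - η)) (Set.Ioo 0 θ) := fun φ hφ => by
    simp only
    rw [← intervalIntegral_congr_Ioo hφ.1.le (he φ hφ), integral_recKernel, innerIntegral,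
      intervalIntegral_congr_Ioo hφ.1.le fun η hη =>
        convThree_LExt hη.1 hη.2 (hφ.2.trans h1) n n]
    ring
  obtain ⟨hi, hv⟩ := recursion h0 h1 hR n n
  refine ⟨fun φ hφ => intervalIntegrable_of_bound hφ.1.le (measurable_convThree_LExt hR n n φ)
    (exists_bound_convThree_LExt hR n n φ) (he φ hφ).symm, ?_, ?_⟩
  · rw [intervalIntegrable_iff_integrableOn_Ioo_of_le h0.le] at hi ⊢
    exact hi.congr_fun hI measurableSet_Ioo
  · rw [hv, intervalIntegral_congr_Ioo h0.le hI]

end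

end ConvexPosition

theorem theorem1 (c : ℂ) (r R : ℝ) (hr : 0 < r) (hR : 0 < R) :
    -- (i)
    (∀ n : ℕ, 1 ≤ n →
      Tendsto (fun t : ℝ => B R (n - 1) (n - 1) t) (𝓝[<] (2 * Real.pi))
        (𝓝 (hullProb (Metric.closedBall c r) n n))) ∧
    -- (i')
    (∀ n : ℕ, 2 ≤ n →
      IntervalIntegrable
        (fun φ : ℝ => ∑ k ∈ Finset.range (n - 1),
          L R k k φ * L R (n - 2 - k) (n - 2 - k) (2 * Real.pi - φ))
        volume 0 (2 * Real.pi) ∧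
      hullProb (Metric.closedBall c r) n n =
        ((n - 2).factorial : ℝ) / (2 ^ (n - 2) * Real.pi ^ (n - 1)) *
          ∫ φ in (0 : ℝ)..(2 * Real.pi), ∑ k ∈ Finset.range (n - 1),
            L R k k φ * L R (n - 2 - k) (n - 2 - k) (2 * Real.pi - φ)) ∧
    -- (ii)
    (∀ θ ∈ Set.Ioo (0 : ℝ) (2 * Real.pi), ∀ n : ℕ, 1 ≤ n →
      (∀ φ ∈ Set.Ioo (0 : ℝ) θ,
        IntervalIntegrable
          (fun η : ℝ => ∑ k ∈ Finset.range n,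
            L R k k η * L R (n - 1 - k) (n - 1 - k) (φ - η))
          volume 0 φ) ∧
      IntervalIntegrable
        (fun φ : ℝ =>
          Real.sin (θ / 2) ^ (2 * n + 1) / Real.sin (φ / 2) ^ (2 * n + 1) *
            ∫ η in (0 : ℝ)..φ, ∑ k ∈ Finset.range n,
              L R k k η * L R (n - 1 - k) (n - 1 - k) (φ - η))
        volume 0 θ ∧
      L R n n θ / 2 =
        ∫ φ in (0 : ℝ)..θ,
          Real.sin (θ / 2) ^ (2 * n + 1) / Real.sin (φ / 2) ^ (2 * n + 1) *
            ∫ η in (0 : ℝ)..φ, ∑ k ∈ Finset.range n,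
              L R k k η * L R (n - 1 - k) (n - 1 - k) (φ - η)) ∧
    -- (iii), vanishing
    (∀ θ ∈ Set.Ioo (0 : ℝ) (2 * Real.pi), ∀ k l : ℕ, k + 1 ≤ l → L R k l θ = 0) ∧
    -- (iii), recursion; the entries of `a` are `n₁, n₂, n₃` and those of `b` are `m₁, m₂`
    (∀ θ ∈ Set.Ioo (0 : ℝ) (2 * Real.pi), ∀ n m : ℕ, 1 ≤ n → 1 ≤ m → m ≤ n →
      (∀ φ ∈ Set.Ioo (0 : ℝ) θ,
        IntervalIntegrable
          (fun η : ℝ =>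
            Real.sin (θ / 2) ^ (2 * n + 1) / Real.sin (φ / 2) ^ (2 * n + 1) *
              ∑ a ∈ Finset.Nat.antidiagonalTuple 3 (n - 1),
                ∑ b ∈ Finset.HasAntidiagonal.antidiagonal (m - 1),
                  (Real.sin η + Real.sin (φ - η) - Real.sin φ) ^ (a 2) / ((a 2).factorial : ℝ) *
                    L R (a 0) b.1 η * L R (a 1) b.2 (φ - η))
          volume 0 φ) ∧
      IntervalIntegrable
        (fun φ : ℝ => ∫ η in (0 : ℝ)..φ,
          Real.sin (θ / 2) ^ (2 * n + 1) / Real.sin (φ / 2) ^ (2 * n + 1) *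
            ∑ a ∈ Finset.Nat.antidiagonalTuple 3 (n - 1),
              ∑ b ∈ Finset.HasAntidiagonal.antidiagonal (m - 1),
                (Real.sin η + Real.sin (φ - η) - Real.sin φ) ^ (a 2) / ((a 2).factorial : ℝ) *
                  L R (a 0) b.1 η * L R (a 1) b.2 (φ - η))
        volume 0 θ ∧
      L R n m θ / 2 =
        ∫ φ in (0 : ℝ)..θ, ∫ η in (0 : ℝ)..φ,
          Real.sin (θ / 2) ^ (2 * n + 1) / Real.sin (φ / 2) ^ (2 * n + 1) *
            ∑ a ∈ Finset.Nat.antidiagonalTuple 3 (n - 1),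
              ∑ b ∈ Finset.HasAntidiagonal.antidiagonal (m - 1),
                (Real.sin η + Real.sin (φ - η) - Real.sin φ) ^ (a 2) / ((a 2).factorial : ℝ) *
                  L R (a 0) b.1 η * L R (a 1) b.2 (φ - η)) ∧
    -- (iii), the identity giving the alternative form
    (∀ φ η : ℝ, Real.sin η + Real.sin (φ - η) - Real.sin φ =
      4 * Real.sin ((φ - η) / 2) * Real.sin (φ / 2) * Real.sin (η / 2)) ∧
    -- (iii'); the sum is over `n₁ + n₂ = n - 2` and `m₁ + m₂ = m - 2`, and is empty for `m = 1`
    (∀ n m : ℕ, 2 ≤ n → 1 ≤ m → m ≤ n →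
      IntervalIntegrable
        (fun φ : ℝ => ∑ a ∈ Finset.HasAntidiagonal.antidiagonal (n - 2),
          ∑ b ∈ (Finset.range m ×ˢ Finset.range m).filter (fun b => b.1 + b.2 + 2 = m),
            L R a.1 b.1 φ * L R a.2 b.2 (2 * Real.pi - φ))
        volume 0 (2 * Real.pi) ∧
      hullProb (Metric.closedBall c r) n m =
        ((n - 2).factorial : ℝ) / (2 ^ (n - 2) * Real.pi ^ (n - 1)) *
          ∫ φ in (0 : ℝ)..(2 * Real.pi), ∑ a ∈ Finset.HasAntidiagonal.antidiagonal (n - 2),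
            ∑ b ∈ (Finset.range m ×ˢ Finset.range m).filter (fun b => b.1 + b.2 + 2 = m),
              L R a.1 b.1 φ * L R a.2 b.2 (2 * Real.pi - φ)) ∧
    -- (iv)
    (∀ n m : ℕ, 1 ≤ n → 1 ≤ m →
      Tendsto (fun t : ℝ => B R (n - 1) (m - 1) t) (𝓝[<] (2 * Real.pi))
        (𝓝 (hullProb (Metric.closedBall c r) n m))) := by
  refine ⟨?_, ?_, ?_, ?_, ?_, ?_, ?_, ?_⟩
  · intro n hn
    obtain ⟨n, rfl⟩ := Nat.exists_eq_add_of_le' hn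
    exact tendsto_B hR c hr n n
  · intro n hn
    obtain ⟨n, rfl⟩ := Nat.exists_eq_add_of_le' hn
    exact hullProb_eq_integral_diag hR c hr n
  · intro θ hθ n hn
    obtain ⟨n, rfl⟩ := Nat.exists_eq_add_of_le' hn
    exact recursion_diag hR hθ.1 hθ.2 n
  · intro θ hθ k l hkl
    exact L_eq_zero_of_lt hR hkl hθ.1 hθ.2
  · intro θ hθ n m hn hm _
    obtain ⟨n, rfl⟩ := Nat.exists_eq_add_of_le' hn
    obtain ⟨m, rfl⟩ := Nat.exists_eq_add_of_le' hm
    have h := recursion hθ.1 hθ.2 hR n m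
    have h' := fun φ hφ => intervalIntegrable_recKernel hR hθ.2 n m (φ := φ) hφ
    unfold recKernel convThree at h h'
    exact ⟨h', h⟩
  · exact fun φ η => sin_add_sin_sub_sin φ η
  · intro n m hn hm _
    obtain ⟨n, rfl⟩ := Nat.exists_eq_add_of_le' hn
    rcases hm.eq_or_lt with rfl | hm
    · simp [hullProb_one hR c hr n]
    · obtain ⟨m, rfl⟩ := Nat.exists_eq_add_of_le' hm
      simp only [Nat.succ_eq_add_one, Nat.reduceAdd, filter_range_product_eq_antidiagonal]
      exact hullProb_eq_integral hR c hr n m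
  · intro n m hn hm
    obtain ⟨n, rfl⟩ := Nat.exists_eq_add_of_le' hn
    obtain ⟨m, rfl⟩ := Nat.exists_eq_add_of_le' hm
    exact tendsto_B hR c hr n m
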